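/- **Tobit model selection consistency.** Let $y_i=\max(y_L,z_i)$, $z_i=\alpha_0+w_i^\top\beta_0+\varepsilon_i$ with $\varepsilon_i$ i.i.d. $\mathcal N(0,\sigma_0^2)$, $\sigma_0>0$, $y_L\in\mathbb R$ fixed, and fixed regressors $w_i\in\mathbb R^p$ ($p$ fixed). Let $X$ be the $n\times p$ matrix of regressors centered by their means over $i\le n$. Assume the regularity conditions that, for some $r>2$ and $C_0<\infty$, $\frac1n\sum_{i\le n}|w_{ij}|^r\le C_0$ for all $n\geq 1$ and all $j$, and that, for some $c_0>0$, $\frac1n X^\top X\succeq c_0 I$ for all large $n$. The candidate models are all subsets $k\subseteq\{1,\dots,p\}$; model $k$ uses an intercept and the $p_k=|k|$ columns $X_k$ of $X$ (with rows $x_i^\top$), with priors $p(\alpha)\propto1$, $p(\sigma^2)\propto1/\sigma^2$, $\beta_k\mid\sigma^2\sim\mathcal N(0,g\sigma^2(X_k^\top X_k)^{-1})$, $g=n$. The true model is $k^*=\{j:\beta_{0,j}\ne0\}$. A variational posterior of model $k$ is a mean-field law $q(\alpha)q(\beta)q(\sigma^2)\prod_{i:\,y_i=y_L}q(z_i)$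 with $q(\alpha)=\mathcal N(\mu_\alpha,\omega_\alpha)$, $q(\beta)=\mathcal N(\mu_\beta,\Omega_\beta)$, $q(\sigma^2)=\mathcal{IG}(a,b)$, $b>0$, and $q(z_i)=\mathcal N(\mu_i,b/a)$ truncated to $(-\infty,y_L]$, $\mu_i=\mu_\alpha+x_i^\top\mu_\beta$ ($z_i=y_i$ is fixed if $y_i>y_L$), that is a fixed point of the coordinate ascent updates: with $m_i,s_i$ the mean and the variance of $z_i$ under $q$ (so $m_i=y_i$, $s_i=0$ if $y_i>y_L$), $$\mu_\alpha=\tfrac1n\sum_i m_i,\quad \omega_\alpha=\tfrac{b}{na},\quad \mu_\beta=\tfrac{g}{1+g}(X_k^\top X_k)^{-1}X_k^\top m,\quad \Omega_\beta=\tfrac{g}{1+g}\tfrac ba(X_k^\top X_k)^{-1},\quad a=\tfrac{n+p_k}2,$$ $$b=\tfrac12\Big[\sum_i(m_i-\mu_i)^2+\sum_i s_i+n\omega_\alpha+\tfrac1g\mu_\beta^\top X_k^\top X_k\mu_\beta+(1+\tfrac1g)\operatorname{tr}(X_k^\top X_k\Omega_\beta)\Big].$$ With $\hat z=\mathbb E_q[z]$,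 $\hat\theta=\mathbb E_q[(\alpha,\beta,\sigma^2)]$, put $p_{\rm VBC}(y)=\frac{p(y\mid\hat z)\,p(\hat z\mid\hat\theta)\,p(\hat\theta)}{q(\hat z)\,q(\hat\theta)}$ and $\mathrm{VBC}_k=-2\log p_{\rm VBC}(y)$ for model $k$; $p(y\mid\theta)$ denotes the Tobit likelihood $\prod_{y_i>y_L}\mathcal N(y_i;\mu_i,\sigma^2)\prod_{y_i=y_L}\Phi((y_L-\mu_i)/\sigma)$. Then model selection based on the VBC is consistent: with probability tending to $1$ as $n\to\infty$, every model has a variational posterior and, for every choice of variational posteriors of the models, $\arg\min_k\mathrm{VBC}_k=\{k^*\}$. Moreover, there is a constant $C$ such that, with probability tending to $1$, for all models and all their variational posteriors: $\mathbb E_q[\sigma^2]=b/(a-1)$ and $|b/(a-1)-b/a|\le C/n$; the condition $p(y\mid\hat z)p(\hat z\mid\hat\theta)/q(\hat z)=p(y\mid\hat\theta)$ holds up to an additive error of at most $C$ on the log scale; and the VBC has the BIC form $|\log p_{\rm VBC}(y)-(\log p(y\mid\hat\theta)-\frac{p_k+2}2\log n)|\le C$. Finally, for every $\delta>0$, with probability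 tending to $1$, for all models, all their variational posteriors and all $i\le n$, $\big|\log\frac{p(y_i\mid\hat z_i)p(\hat z_i\mid\hat\theta)}{q(\hat z_i)}-\log p(y_i\mid\hat\theta)\big|\le\delta$ (with $q(\hat z_i)=1$ if $y_i>y_L$). -/

import Mathlib

open MeasureTheory ProbabilityTheory Filter Topology Matrix

namespace TobitVB

noncomputable section

/-! ### Data: regressors, left-censored responses -/

/-- Sample mean of regressor `j` over the first `n` observations. -/
def colMean {p : ℕ} (w : ℕ → Fin p → ℝ) (n : ℕ) (j : Fin p) : ℝ :=
  (∑ i : Fin n, w i j) / n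

/-- The `n × p` matrix of all candidate regressors, centered by subtracting the sample means. -/
def design {p : ℕ} (w : ℕ → Fin p → ℝ) (n : ℕ) : Matrix (Fin n) (Fin p) ℝ :=
  Matrix.of fun i j => w i j - colMean w n j

/-- The columns of the centered regressor matrix that are included in the model `k`. -/
def subDesign {p : ℕ} (w : ℕ → Fin p → ℝ) (n : ℕ) (k : Finset (Fin p)) :
    Matrix (Fin n) k ℝ :=
  (design w n).submatrix id (fun j : k => (j : Fin p))

/-- The first `n` observed responses `y_i = max (y_L, z_i)` for the latent regression
`z_i = α₀ + w_iᵀ β₀ + ε_i`. -/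
def response {Ω : Type*} {p : ℕ} (w : ℕ → Fin p → ℝ) (yL α₀ : ℝ) (β₀ : Fin p → ℝ)
    (ε : ℕ → Ω → ℝ) (n : ℕ) (ω : Ω) (i : Fin n) : ℝ :=
  max yL (α₀ + w i ⬝ᵥ β₀ + ε i ω)

/-- The model that generated the data: the set of regressors with non-zero true coefficient. -/
def trueModel {p : ℕ} (β₀ : Fin p → ℝ) : Finset (Fin p) :=
  Finset.univ.filter fun j => β₀ j ≠ 0

/-! ### Densities -/

/-- Density of the normal distribution with mean `μ` and variance `v`. -/
def normalPDF (μ v x : ℝ) : ℝ := gaussianPDFReal μ v.toNNReal x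

/-- `Φ ((c - μ) / √v)`, the probability that a normal variable with mean `μ` and variance `v`
is at most `c`. -/
def normalCDF (μ v c : ℝ) : ℝ := (gaussianReal μ v.toNNReal).real (Set.Iic c)

/-- Density of the multivariate normal distribution with mean `m` and covariance matrix `S`. -/
def mvNormalPDF {κ : Type*} [Fintype κ] [DecidableEq κ] (m : κ → ℝ) (S : Matrix κ κ ℝ)
    (x : κ → ℝ) : ℝ :=
  (Real.sqrt ((2 * Real.pi) ^ Fintype.card κ * S.det))⁻¹ *
    Real.exp (-((x - m) ⬝ᵥ (S⁻¹ *ᵥ (x - m))) / 2)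

/-- Density of the inverse gamma distribution `IG(a, b)` on `(0, ∞)`. -/
def invGammaPDF (a b x : ℝ) : ℝ :=
  b ^ a / Real.Gamma a * x ^ (-a - 1) * Real.exp (-b / x)

/-- The law `N(μ, v)` truncated to `(-∞, c]`. -/
def truncNormal (μ v c : ℝ) : Measure ℝ :=
  ProbabilityTheory.cond (gaussianReal μ v.toNNReal) (Set.Iic c)

/-- Density of `N(μ, v)` truncated to `(-∞, c]`. -/
def truncNormalPDF (μ v c x : ℝ) : ℝ :=
  if x ≤ c then normalPDF μ v x / normalCDF μ v c else 0

/-! ### The mean-field variational family and the variational posterior -/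

/-- Parameters of the variational factors
`q(α) = N(muAlpha, omegaAlpha)`, `q(β) = N(muBeta, OmegaBeta)`, `q(σ²) = IG(a, b)` of a model with
regressors indexed by `κ`. -/
structure VBState (κ : Type*) where
  muAlpha : ℝ
  omegaAlpha : ℝ
  muBeta : κ → ℝ
  OmegaBeta : Matrix κ κ ℝ
  a : ℝ
  b : ℝ

variable {n : ℕ} {κ : Type*} [Fintype κ] [DecidableEq κ]

/-- The location `μ_i = μ_α + x_iᵀ μ_β`. -/
def VBState.loc (q : VBState κ) (X : Matrix (Fin n) κ ℝ) (i : Fin n) : ℝ :=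
  q.muAlpha + (X *ᵥ q.muBeta) i

/-- The scale (variance) parameter `ξ = b / a` of the truncated normal factors. -/
def VBState.xi (q : VBState κ) : ℝ := q.b / q.a

/-- Variational law of the latent `z_i`: it is fixed at `y_i` if `y_i > y_L`, and it is
`N(μ_i, ξ)` truncated to `(-∞, y_L]` if `y_i = y_L`. -/
def VBState.zLaw (q : VBState κ) (X : Matrix (Fin n) κ ℝ) (yL : ℝ) (y : Fin n → ℝ)
    (i : Fin n) : Measure ℝ :=
  if yL < y i then Measure.dirac (y i) else truncNormal (q.loc X i) q.xi yL

/-- The variational expectation `m_i = ẑ_i` of `z_i`. -/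
def VBState.zHat (q : VBState κ) (X : Matrix (Fin n) κ ℝ) (yL : ℝ) (y : Fin n → ℝ)
    (i : Fin n) : ℝ :=
  ∫ z, z ∂(q.zLaw X yL y i)

/-- The variational variance `s_i` of `z_i`. -/
def VBState.zVar (q : VBState κ) (X : Matrix (Fin n) κ ℝ) (yL : ℝ) (y : Fin n → ℝ)
    (i : Fin n) : ℝ :=
  variance (fun z : ℝ => z) (q.zLaw X yL y i)

/-- The variational expectation `E_q[σ²]` of the error variance under `q(σ²) = IG(a, b)`. -/
def VBState.sigmaSqHat (q : VBState κ) : ℝ :=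
  ∫ x in Set.Ioi (0 : ℝ), x * invGammaPDF q.a q.b x

/-- `q` is a variational posterior of the left-censored Tobit model with centered regressor
matrix `X`, priors `p(α) ∝ 1`, `p(σ²) ∝ 1 / σ²`, `β ∣ σ² ∼ N(0, g σ² (Xᵀ X)⁻¹)` and data `y`:
every factor equals its coordinate ascent (CAVI) update given the others. The update of the
latent factors is built into `VBState.zLaw`. -/
structure IsVB (q : VBState κ) (X : Matrix (Fin n) κ ℝ) (yL : ℝ) (y : Fin n → ℝ) (g : ℝ) :
    Prop where
  b_pos : 0 < q.b
  muAlpha_eq : q.muAlpha = (∑ i, q.zHat X yL y i) / n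
  omegaAlpha_eq : q.omegaAlpha = q.b / (n * q.a)
  muBeta_eq : q.muBeta = (g / (1 + g)) • ((Xᵀ * X)⁻¹ *ᵥ (Xᵀ *ᵥ q.zHat X yL y))
  OmegaBeta_eq : q.OmegaBeta = (g / (1 + g) * (q.b / q.a)) • (Xᵀ * X)⁻¹
  a_eq : q.a = ((n : ℝ) + Fintype.card κ) / 2
  b_eq : q.b = 1 / 2 *
    (∑ i, (q.zHat X yL y i - q.loc X i) ^ 2 + ∑ i, q.zVar X yL y i + n * q.omegaAlpha
      + 1 / g * (q.muBeta ⬝ᵥ ((Xᵀ * X) *ᵥ q.muBeta))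
      + (1 + 1 / g) * (Xᵀ * X * q.OmegaBeta).trace)

/-! ### The variational Bayes criterion, evaluated at the variational expectations

The variational expectations of `α` and `β` are `muAlpha` and `muBeta`, so that
`q.loc X i` is also the linear predictor at the point estimate. -/

/-- `p(y_i ∣ ẑ_i)`, the indicator of `y_i = max (y_L, ẑ_i)`. -/
def VBState.linkAt (q : VBState κ) (X : Matrix (Fin n) κ ℝ) (yL : ℝ) (y : Fin n → ℝ)
    (i : Fin n) : ℝ :=
  if y i = max yL (q.zHat X yL y i) then 1 else 0

/-- `p(ẑ_i ∣ θ̂)`. -/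
def VBState.latentAt (q : VBState κ) (X : Matrix (Fin n) κ ℝ) (yL : ℝ) (y : Fin n → ℝ)
    (i : Fin n) : ℝ :=
  normalPDF (q.loc X i) q.sigmaSqHat (q.zHat X yL y i)

/-- `q(ẑ_i)` for a censored observation; uncensored observations have no variational factor. -/
def VBState.zFactorAt (q : VBState κ) (X : Matrix (Fin n) κ ℝ) (yL : ℝ) (y : Fin n → ℝ)
    (i : Fin n) : ℝ :=
  if yL < y i then 1 else truncNormalPDF (q.loc X i) q.xi yL (q.zHat X yL y i)

/-- `p(y_i ∣ θ̂)`, the Tobit likelihood contribution. -/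
def VBState.tobitAt (q : VBState κ) (X : Matrix (Fin n) κ ℝ) (yL : ℝ) (y : Fin n → ℝ)
    (i : Fin n) : ℝ :=
  if yL < y i then normalPDF (q.loc X i) q.sigmaSqHat (y i)
  else normalCDF (q.loc X i) q.sigmaSqHat yL

/-- `p(θ̂)`; the arbitrary constants of the improper priors of `α` and `σ²`, which are common to
all models, are set to one. -/
def VBState.priorAt (q : VBState κ) (X : Matrix (Fin n) κ ℝ) (g : ℝ) : ℝ :=
  1 / q.sigmaSqHat * mvNormalPDF 0 ((g * q.sigmaSqHat) • (Xᵀ * X)⁻¹) q.muBeta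

/-- `q(θ̂) = q(α̂) q(β̂) q(σ̂²)`. -/
def VBState.thetaFactorAt (q : VBState κ) : ℝ :=
  normalPDF q.muAlpha q.omegaAlpha q.muAlpha * mvNormalPDF q.muBeta q.OmegaBeta q.muBeta *
    invGammaPDF q.a q.b q.sigmaSqHat

/-- `p_VBC(y) = p(y ∣ ẑ) p(ẑ ∣ θ̂) p(θ̂) / (q(ẑ) q(θ̂))`. -/
def VBState.pVBC (q : VBState κ) (X : Matrix (Fin n) κ ℝ) (yL : ℝ) (y : Fin n → ℝ) (g : ℝ) : ℝ :=
  ((∏ i, q.linkAt X yL y i) * (∏ i, q.latentAt X yL y i) * q.priorAt X g) /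
    ((∏ i, q.zFactorAt X yL y i) * q.thetaFactorAt)

/-- The variational Bayes criterion `VBC = -2 log p_VBC(y)`. -/
def VBState.VBC (q : VBState κ) (X : Matrix (Fin n) κ ℝ) (yL : ℝ) (y : Fin n → ℝ) (g : ℝ) : ℝ :=
  -2 * Real.log (q.pVBC X yL y g)

/-- The Tobit likelihood `p(y ∣ θ̂)`. -/
def VBState.tobitLik (q : VBState κ) (X : Matrix (Fin n) κ ℝ) (yL : ℝ) (y : Fin n → ℝ) : ℝ :=
  ∏ i, q.tobitAt X yL y i

/-- `log (p(y_i ∣ ẑ_i) p(ẑ_i ∣ θ̂) / q(ẑ_i)) - log p(y_i ∣ θ̂)`. -/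
def VBState.obsGap (q : VBState κ) (X : Matrix (Fin n) κ ℝ) (yL : ℝ) (y : Fin n → ℝ)
    (i : Fin n) : ℝ :=
  Real.log (q.linkAt X yL y i * q.latentAt X yL y i / q.zFactorAt X yL y i) -
    Real.log (q.tobitAt X yL y i)

/-- `log (p(y ∣ ẑ) p(ẑ ∣ θ̂) / q(ẑ)) - log p(y ∣ θ̂)`. -/
def VBState.gap (q : VBState κ) (X : Matrix (Fin n) κ ℝ) (yL : ℝ) (y : Fin n → ℝ) : ℝ :=
  Real.log ((∏ i, q.linkAt X yL y i) * (∏ i, q.latentAt X yL y i) / ∏ i, q.zFactorAt X yL y i) -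
    Real.log (q.tobitLik X yL y)

end

/-! ### Model selection -/

/-- The set of minimizers of `f`. -/
def argminSet {ι : Type*} (f : ι → ℝ) : Set ι := {k | ∀ j, f k ≤ f j}

/-- The events `E n` hold with probability tending to one: they contain measurable events whose
probabilities tend to one. -/
def WithProbTendingToOne {Ω : Type*} [MeasurableSpace Ω] (P : Measure Ω) (E : ℕ → Set Ω) : Prop :=
  ∃ A : ℕ → Set Ω, (∀ n, MeasurableSet (A n)) ∧ (∀ n, A n ⊆ E n) ∧
    Tendsto (fun n => P (A n)) atTop (𝓝 1)

end TobitVB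

open TobitVB

/-!
A variational posterior is determined by its inverse scale `τ = √(a / b)` and its rescaled
coefficients `d₀ = τ μ_α`, `d = τ μ_β`. Since the mean of a truncated normal law is `μ - √ξ λ(u)`
with `λ = φ / Φ` the inverse Mills ratio, the coordinate ascent updates are, after the variances
are eliminated, exactly the score equations of the function `penLogLik`: the Tobit log-likelihood
in Olsen's parameterization `(τ, d₀, d)` minus `log τ` and minus the ridge penalty `|X d|² / (2
g)` (`IsVB.scoreEq`, `ScoreEq.exists_isVB`). This function is concave once a response is
uncensored, so variational posteriors are its maximizers (`ScoreEq.penLogLik_le`), and one exists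
as soon as the superlevel sets are bounded (`exists_max_penLogLik`).

The likelihood is compared with its value at the truth by one inequality (`logLik_le_true`):
censored terms lie below their tangents because `log Φ` is concave, and uncensored terms keep
their full quadratic curvature. If that curvature is at least `c n` and the squared scores at the
truth are at most `D`, the log-likelihood loses `c n / 4` times the squared distance from the
truth, up to an error `(p + 2) D / (c n)` (`GoodSample.logLik_le`). This confines all variational
posteriors to a fixed compact set (`GoodSample.localize`), shows that a model without a relevant
regressor loses a term of order `n`, and bounds the gain of superfluous regressors by `(log n) /
4` when `D` is a small multiple of `n log n`.

The plug-in variance is `b / (a - 1)`, and the discrepancy of an observation is due only to its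
difference from `b / a`; it is at most a multiple of `1 / n` times one plus the truncated second
moment (`IsVB.abs_obsGap_le`). The score equation of the scale bounds the sum of these moments by
`n`, hence `IsVB.abs_gap_le`. In the remaining ratio of prior and variational densities the terms
of order `n` cancel by Stirling's formula, which leaves `- (p_k + 2) / 2 * log n + O(1)`
(`IsVB.abs_log_pVBC_sub_le`). All consequences for a single sample are collected in
`exists_regularSample_constants`.

The sample properties hold with probability tending to one by Chebyshev's inequality
(`exists_failureVanishes_regularSample`). The scores are sums of independent conditional
expectations given the censored data, so they have mean zero and variance of order `n`. For the
curvature it suffices to count observations whose regressors are bounded by `M` and whose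
standardized errors lie in a window `[K, K + 1]` above all their thresholds
(`failureVanishes_curvature`); the moment condition of order `r > 2` makes the discarded
regressors negligible for large `M`.
-/

/-! ### Standard normal distribution function and inverse Mills ratio -/

namespace TobitVB

/-- Standard normal distribution function. -/
noncomputable def stdCDF (u : ℝ) : ℝ := (gaussianReal 0 1).real (Set.Iic u)

/-- The inverse Mills ratio `φ / Φ` of the lower tail. -/
noncomputable def mills (u : ℝ) : ℝ := gaussianPDFReal 0 1 u / stdCDF u

lemma stdPDF_eq (x : ℝ) :
    gaussianPDFReal 0 1 x = (Real.sqrt (2 * Real.pi))⁻¹ * Real.exp (-x ^ 2 / 2) := by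
  simp [gaussianPDFReal]

lemma continuous_stdPDF : Continuous (gaussianPDFReal 0 1) := by
  have : gaussianPDFReal 0 1 =
      fun x => (Real.sqrt (2 * Real.pi))⁻¹ * Real.exp (-x ^ 2 / 2) := funext stdPDF_eq
  rw [this]; fun_prop

lemma hasDerivAt_stdPDF (x : ℝ) :
    HasDerivAt (gaussianPDFReal 0 1) (-x * gaussianPDFReal 0 1 x) x := by
  have : gaussianPDFReal 0 1 =
      fun x => (Real.sqrt (2 * Real.pi))⁻¹ * Real.exp (-x ^ 2 / 2) := funext stdPDF_eq
  rw [this]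
  have h1 : HasDerivAt (fun x : ℝ => -x ^ 2 / 2) (-x) x := by
    exact (((hasDerivAt_pow 2 x).fun_neg).div_const 2).congr_deriv (by norm_num; ring)
  exact ((h1.exp).const_mul (Real.sqrt (2 * Real.pi))⁻¹).congr_deriv (by ring)

/-- Polynomial moments exist under the standard normal law. -/
lemma integrable_pow_gaussian (k : ℕ) : Integrable (fun x : ℝ => x ^ k) (gaussianReal 0 1) := by
  have h := memLp_id_gaussianReal (μ := 0) (v := 1) (k : NNReal)
  rcases Nat.eq_zero_or_pos k with rfl | hk
  · simp
  · have := h.integrable_norm_rpow (by simp; omega) (by simp)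
    refine (integrable_norm_iff (by fun_prop)).1 ?_
    simpa [norm_pow] using this

lemma integrableOn_pow_mul_stdPDF (k : ℕ) (s : Set ℝ) :
    IntegrableOn (fun x : ℝ => x ^ k * gaussianPDFReal 0 1 x) s := by
  have h := integrable_pow_gaussian k
  rw [gaussianReal_of_var_ne_zero 0 one_ne_zero,
    integrable_withDensity_iff (measurable_gaussianPDF 0 1)
      (ae_of_all _ fun _ => gaussianPDF_lt_top)] at h
  simp only [toReal_gaussianPDF] at h
  exact h.integrableOn

lemma setIntegral_stdGaussian {s : Set ℝ} (hs : MeasurableSet s) (f : ℝ → ℝ) :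
    ∫ x in s, f x ∂(gaussianReal 0 1) = ∫ x in s, f x * gaussianPDFReal 0 1 x := by
  rw [← integral_indicator hs, ← integral_indicator hs,
    integral_gaussianReal_eq_integral_smul one_ne_zero]
  congr 1; ext x
  by_cases hx : x ∈ s <;> simp [hx, mul_comm]

lemma stdCDF_eq_integral (u : ℝ) : stdCDF u = ∫ x in Set.Iic u, gaussianPDFReal 0 1 x := by
  have := setIntegral_stdGaussian (measurableSet_Iic (a := u)) (fun _ => 1)
  simpa [stdCDF] using this

lemma tendsto_stdPDF_atBot : Tendsto (gaussianPDFReal 0 1) atBot (𝓝 0) := by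
  have h2 : Tendsto (fun x : ℝ => -x ^ 2 / 2) atBot atBot := by
    have h3 : Tendsto (fun x : ℝ => x ^ 2) atBot atTop := by
      have : (fun x : ℝ => x ^ 2) = fun x => x * x := by ext; ring
      rw [this]; exact tendsto_id.atBot_mul_atBot₀ tendsto_id
    have h4 := (tendsto_neg_atTop_atBot.comp h3).atBot_div_const (two_pos)
    exact h4
  have := (Real.tendsto_exp_atBot.comp h2).const_mul (Real.sqrt (2 * Real.pi))⁻¹
  simp only [mul_zero] at this
  refine this.congr fun x => ?_
  simp [stdPDF_eq]

lemma tendsto_mul_stdPDF_atBot :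
    Tendsto (fun x => x * gaussianPDFReal 0 1 x) atBot (𝓝 0) := by
  -- `|x| exp (-x² / 2) ≤ 2 / |x|`
  have h0 : Tendsto (fun x : ℝ => 2 * |x|⁻¹) atBot (𝓝 0) := by
    have := (tendsto_inv_atTop_zero.comp tendsto_abs_atBot_atTop).const_mul (2 : ℝ)
    simpa using this
  refine squeeze_zero_norm' ?_ h0
  filter_upwards [eventually_lt_atBot (0 : ℝ)] with x hx
  have hx' : 0 < |x| := abs_pos.2 hx.ne
  rw [norm_mul, Real.norm_eq_abs, Real.norm_eq_abs, abs_of_nonneg (gaussianPDFReal_nonneg _ _ _),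
    stdPDF_eq]
  have h1 : (Real.sqrt (2 * Real.pi))⁻¹ ≤ 1 := by
    apply inv_le_one_of_one_le₀
    rw [Real.one_le_sqrt]
    nlinarith [Real.pi_gt_three]
  have hx2 : 0 < x ^ 2 := by nlinarith
  have h2 : Real.exp (-x ^ 2 / 2) ≤ 2 * (|x| ^ 2)⁻¹ := by
    have h3 : x ^ 2 / 2 ≤ Real.exp (x ^ 2 / 2) := by
      have := Real.add_one_le_exp (x ^ 2 / 2); linarith
    rw [show -x ^ 2 / 2 = -(x ^ 2 / 2) by ring, Real.exp_neg, sq_abs,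
      show 2 * (x ^ 2)⁻¹ = (x ^ 2 / 2)⁻¹ by field_simp]
    exact inv_anti₀ (by positivity) h3
  calc |x| * ((Real.sqrt (2 * Real.pi))⁻¹ * Real.exp (-x ^ 2 / 2))
      ≤ |x| * (1 * (2 * (|x| ^ 2)⁻¹)) := by gcongr
    _ = 2 * |x|⁻¹ := by field_simp

lemma integral_Iic_mul_stdPDF (u : ℝ) :
    ∫ x in Set.Iic u, x * gaussianPDFReal 0 1 x = -gaussianPDFReal 0 1 u := by
  have h := integral_Iic_of_hasDerivAt_of_tendsto' (a := u) (m := 0)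
    (f := fun x => -gaussianPDFReal 0 1 x) (f' := fun x => x * gaussianPDFReal 0 1 x)
    (fun x _ => (hasDerivAt_stdPDF x).fun_neg.congr_deriv (by ring))
    (by simpa using integrableOn_pow_mul_stdPDF 1 (Set.Iic u))
    (by simpa using tendsto_stdPDF_atBot.neg)
  simpa using h

lemma integral_Iic_sq_mul_stdPDF (u : ℝ) :
    ∫ x in Set.Iic u, x ^ 2 * gaussianPDFReal 0 1 x = stdCDF u - u * gaussianPDFReal 0 1 u := by
  have hi0 : IntegrableOn (gaussianPDFReal 0 1) (Set.Iic u) := by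
    simpa using integrableOn_pow_mul_stdPDF 0 (Set.Iic u)
  have hi2 := integrableOn_pow_mul_stdPDF 2 (Set.Iic u)
  have h := integral_Iic_of_hasDerivAt_of_tendsto' (a := u) (m := 0)
    (f := fun x => -(x * gaussianPDFReal 0 1 x))
    (f' := fun x => x ^ 2 * gaussianPDFReal 0 1 x - gaussianPDFReal 0 1 x)
    (fun x _ => by
      exact ((hasDerivAt_id' x).fun_mul (hasDerivAt_stdPDF x)).fun_neg.congr_deriv (by ring))
    (hi2.sub hi0)
    (by simpa using tendsto_mul_stdPDF_atBot.neg)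
  rw [integral_sub hi2 hi0, ← stdCDF_eq_integral] at h
  linarith

lemma stdCDF_pos (u : ℝ) : 0 < stdCDF u := by
  rw [stdCDF_eq_integral]
  rw [setIntegral_pos_iff_support_of_nonneg_ae]
  · have : Function.support (gaussianPDFReal 0 1) = Set.univ := by
      ext x; simp [(gaussianPDFReal_pos 0 1 x one_ne_zero).ne']
    simp [this]
  · exact ae_of_all _ fun x => gaussianPDFReal_nonneg 0 1 x
  · simpa using integrableOn_pow_mul_stdPDF 0 (Set.Iic u)

lemma stdCDF_le_one (u : ℝ) : stdCDF u ≤ 1 := measureReal_le_one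

lemma log_stdCDF_nonpos (u : ℝ) : Real.log (stdCDF u) ≤ 0 :=
  Real.log_nonpos (stdCDF_pos u).le (stdCDF_le_one u)

lemma mills_pos (u : ℝ) : 0 < mills u :=
  div_pos (gaussianPDFReal_pos 0 1 u one_ne_zero) (stdCDF_pos u)

lemma mills_mul_stdCDF (u : ℝ) : mills u * stdCDF u = gaussianPDFReal 0 1 u :=
  div_mul_cancel₀ _ (stdCDF_pos u).ne'

lemma hasDerivAt_stdCDF (u : ℝ) : HasDerivAt stdCDF (gaussianPDFReal 0 1 u) u := by
  have hi : ∀ v, IntegrableOn (gaussianPDFReal 0 1) (Set.Iic v) := fun v => by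
    simpa using integrableOn_pow_mul_stdPDF 0 (Set.Iic v)
  have h : stdCDF = fun v => (∫ x in (0 : ℝ)..v, gaussianPDFReal 0 1 x) + stdCDF 0 := by
    ext v
    rw [stdCDF_eq_integral, stdCDF_eq_integral,
      ← intervalIntegral.integral_Iic_sub_Iic (hi 0) (hi v)]
    ring
  rw [h]
  exact (intervalIntegral.integral_hasDerivAt_right
    (continuous_stdPDF.intervalIntegrable _ _)
    (continuous_stdPDF.stronglyMeasurableAtFilter _ _) continuous_stdPDF.continuousAt).add_const _

lemma continuous_stdCDF : Continuous stdCDF :=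
  continuous_iff_continuousAt.2 fun u => (hasDerivAt_stdCDF u).continuousAt

lemma hasDerivAt_log_stdCDF (u : ℝ) :
    HasDerivAt (fun v => Real.log (stdCDF v)) (mills u) u :=
  (hasDerivAt_stdCDF u).log (stdCDF_pos u).ne'

lemma hasDerivAt_mills (u : ℝ) : HasDerivAt mills (-mills u * (u + mills u)) u := by
  refine ((hasDerivAt_stdPDF u).fun_div (hasDerivAt_stdCDF u) (stdCDF_pos u).ne').congr_deriv ?_
  have := (stdCDF_pos u).ne'
  unfold mills
  field_simp
  ring

lemma setIntegral_id_stdGaussian (u : ℝ) :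
    ∫ x in Set.Iic u, x ∂(gaussianReal 0 1) = -gaussianPDFReal 0 1 u := by
  rw [setIntegral_stdGaussian measurableSet_Iic, integral_Iic_mul_stdPDF]

lemma setIntegral_sq_stdGaussian (u : ℝ) :
    ∫ x in Set.Iic u, x ^ 2 ∂(gaussianReal 0 1) = stdCDF u - u * gaussianPDFReal 0 1 u := by
  rw [setIntegral_stdGaussian measurableSet_Iic (fun x => x ^ 2), integral_Iic_sq_mul_stdPDF]

lemma setIntegral_const_stdGaussian (u c : ℝ) :
    ∫ _ in Set.Iic u, c ∂(gaussianReal 0 1) = stdCDF u * c := by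
  simp [stdCDF]

lemma integrableOn_id_stdGaussian (s : Set ℝ) :
    IntegrableOn (fun x : ℝ => x) s (gaussianReal 0 1) := by
  simpa using (integrable_pow_gaussian 1).integrableOn

/-- The truncated mean lies below the truncation point. -/
lemma add_mills_nonneg (u : ℝ) : 0 ≤ u + mills u := by
  have h : 0 ≤ ∫ x in Set.Iic u, (u - x) ∂(gaussianReal 0 1) :=
    setIntegral_nonneg measurableSet_Iic fun x hx => sub_nonneg.2 hx
  rw [integral_sub (integrable_const _) (integrableOn_id_stdGaussian _),
    setIntegral_const_stdGaussian, setIntegral_id_stdGaussian, ← mills_mul_stdCDF] at h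
  have : 0 ≤ stdCDF u * (u + mills u) := by linarith
  exact nonneg_of_mul_nonneg_right this (stdCDF_pos u)

lemma setIntegral_add_sq_stdGaussian (u a : ℝ) :
    ∫ x in Set.Iic u, (x + a) ^ 2 ∂(gaussianReal 0 1) =
      stdCDF u * (1 - u * mills u - 2 * a * mills u + a ^ 2) := by
  have e : (fun x : ℝ => (x + a) ^ 2) = fun x => x ^ 2 + (2 * a * x + a ^ 2) := by
    ext; ring
  have hi1 : IntegrableOn (fun x => 2 * a * x) (Set.Iic u) (gaussianReal 0 1) :=
    (integrableOn_id_stdGaussian _).const_mul _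
  have hi2 : IntegrableOn (fun x => 2 * a * x + a ^ 2) (Set.Iic u)
    (gaussianReal 0 1) := hi1.add (integrable_const _)
  rw [e, integral_add (integrable_pow_gaussian 2).integrableOn hi2,
    integral_add hi1 (integrable_const _), integral_const_mul,
    setIntegral_const_stdGaussian, setIntegral_id_stdGaussian, setIntegral_sq_stdGaussian,
    ← mills_mul_stdCDF]
  ring

/-- The variance of the truncated standard normal law is nonnegative. -/
lemma mills_sq_add_le (u : ℝ) : mills u ^ 2 + u * mills u ≤ 1 := by
  have h : 0 ≤ ∫ x in Set.Iic u, (x + mills u) ^ 2 ∂(gaussianReal 0 1) :=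
    setIntegral_nonneg measurableSet_Iic fun x _ => sq_nonneg _
  rw [setIntegral_add_sq_stdGaussian] at h
  have : 0 ≤ stdCDF u * (1 - (mills u ^ 2 + u * mills u)) := by nlinarith
  linarith [nonneg_of_mul_nonneg_right this (stdCDF_pos u)]

lemma mills_sq_le (u : ℝ) : mills u ^ 2 ≤ 2 + u ^ 2 := by
  nlinarith [mills_sq_add_le u, sq_nonneg (u + mills u)]

lemma antitone_mills : Antitone mills := by
  refine antitone_of_hasDerivAt_nonpos (fun u => hasDerivAt_mills u) fun u => ?_
  have := mul_nonneg (mills_pos u).le (add_mills_nonneg u)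
  simp only [Pi.zero_apply]
  linarith

lemma concaveOn_log_stdCDF : ConcaveOn ℝ Set.univ (fun v => Real.log (stdCDF v)) := by
  refine AntitoneOn.concaveOn_of_deriv convex_univ
    (fun u _ => (hasDerivAt_log_stdCDF u).continuousAt.continuousWithinAt)
    (fun u _ => (hasDerivAt_log_stdCDF u).differentiableAt.differentiableWithinAt) ?_
  rw [show deriv (fun v => Real.log (stdCDF v)) = mills from
    funext fun u => (hasDerivAt_log_stdCDF u).deriv]
  exact antitone_mills.antitoneOn _

/-- Log-concavity of the normal distribution function, as a tangent line bound. -/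
lemma log_stdCDF_le_tangent (u v : ℝ) :
    Real.log (stdCDF v) ≤ Real.log (stdCDF u) + mills u * (v - u) := by
  rcases lt_trichotomy u v with h | rfl | h
  · have := concaveOn_log_stdCDF.slope_le_of_hasDerivAt (Set.mem_univ u) (Set.mem_univ v) h
      (hasDerivAt_log_stdCDF u)
    rw [slope_def_field, div_le_iff₀ (by linarith)] at this
    linarith
  · simp
  · have := concaveOn_log_stdCDF.le_slope_of_hasDerivAt (Set.mem_univ v) (Set.mem_univ u) h
      (hasDerivAt_log_stdCDF u)
    rw [slope_def_field, le_div_iff₀ (by linarith)] at this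
    linarith

end TobitVB

/-! ### Truncated normal moments and projections onto censored data -/

namespace TobitVB

lemma gaussianReal_eq_map_std (μ : ℝ) {v : ℝ} (hv : 0 < v) :
    gaussianReal μ v.toNNReal = (gaussianReal 0 1).map (fun x => Real.sqrt v * x + μ) := by
  have h : (fun x => Real.sqrt v * x + μ) = (fun x => x + μ) ∘ (fun x => Real.sqrt v * x) := rfl
  rw [h, ← Measure.map_map (by fun_prop) (by fun_prop), gaussianReal_map_const_mul,
    gaussianReal_map_add_const]
  congr 1
  · simp
  · ext
    simp [Real.sq_sqrt hv.le, hv.le]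

lemma setIntegral_gaussian_eq_std (μ : ℝ) {v : ℝ} (hv : 0 < v) (c : ℝ) {h : ℝ → ℝ}
    (hh : Continuous h) :
    ∫ z in Set.Iic c, h z ∂(gaussianReal μ v.toNNReal) =
      ∫ x in Set.Iic ((c - μ) / Real.sqrt v), h (Real.sqrt v * x + μ) ∂(gaussianReal 0 1) := by
  have hs : 0 < Real.sqrt v := Real.sqrt_pos.2 hv
  rw [gaussianReal_eq_map_std μ hv,
    setIntegral_map measurableSet_Iic hh.aestronglyMeasurable (by fun_prop)]
  congr 2
  ext x
  simp only [Set.mem_preimage, Set.mem_Iic]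
  rw [le_div_iff₀ hs]
  constructor <;> intro h <;> linarith

lemma normalCDF_eq (μ : ℝ) {v : ℝ} (hv : 0 < v) (c : ℝ) :
    normalCDF μ v c = stdCDF ((c - μ) / Real.sqrt v) := by
  have := setIntegral_gaussian_eq_std μ hv c (continuous_const (y := (1 : ℝ)))
  simpa [normalCDF, stdCDF] using this

lemma normalPDF_pos (μ : ℝ) {v : ℝ} (hv : 0 < v) (x : ℝ) : 0 < normalPDF μ v x :=
  gaussianPDFReal_pos _ _ _ (by simpa using hv)

lemma log_normalPDF (μ : ℝ) {v : ℝ} (hv : 0 < v) (x : ℝ) :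
    Real.log (normalPDF μ v x) =
      -(1 / 2) * Real.log (2 * Real.pi) - 1 / 2 * Real.log v - (x - μ) ^ 2 / (2 * v) := by
  have hp : 0 < 2 * Real.pi := by positivity
  rw [normalPDF, gaussianPDFReal_def]
  simp only [Real.coe_toNNReal v hv.le]
  rw [Real.log_mul (by positivity) (Real.exp_pos _).ne', Real.log_inv, Real.log_exp,
    Real.log_sqrt (by positivity), Real.log_mul hp.ne' hv.ne']
  ring

lemma integral_truncNormal (μ : ℝ) {v : ℝ} (hv : 0 < v) (c : ℝ) {h : ℝ → ℝ}
    (hh : Continuous h) :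
    ∫ z, h z ∂(truncNormal μ v c) = (stdCDF ((c - μ) / Real.sqrt v))⁻¹ *
      ∫ x in Set.Iic ((c - μ) / Real.sqrt v), h (Real.sqrt v * x + μ) ∂(gaussianReal 0 1) := by
  rw [truncNormal, ProbabilityTheory.cond, integral_smul_measure,
    setIntegral_gaussian_eq_std μ hv c hh, ← normalCDF_eq μ hv]
  simp [normalCDF, Measure.real]

lemma integral_id_truncNormal (μ : ℝ) {v : ℝ} (hv : 0 < v) (c : ℝ) :
    ∫ z, z ∂(truncNormal μ v c) = μ - Real.sqrt v * mills ((c - μ) / Real.sqrt v) := by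
  rw [integral_truncNormal μ hv c continuous_id']
  have hi : IntegrableOn (fun x => Real.sqrt v * x) (Set.Iic ((c - μ) / Real.sqrt v))
    (gaussianReal 0 1) := (integrableOn_id_stdGaussian _).const_mul _
  rw [integral_add hi (integrable_const _), integral_const_mul, setIntegral_id_stdGaussian,
    setIntegral_const_stdGaussian, ← mills_mul_stdCDF]
  have := (stdCDF_pos ((c - μ) / Real.sqrt v)).ne'
  field_simp
  ring

lemma variance_truncNormal (μ : ℝ) {v : ℝ} (hv : 0 < v) (c : ℝ) :
    variance (fun z : ℝ => z) (truncNormal μ v c) =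
      v * (1 - (c - μ) / Real.sqrt v * mills ((c - μ) / Real.sqrt v) -
        mills ((c - μ) / Real.sqrt v) ^ 2) := by
  rw [variance_eq_integral (by fun_prop), integral_id_truncNormal μ hv c]
  rw [integral_truncNormal μ hv c (h := fun z =>
    (z - (μ - Real.sqrt v * mills ((c - μ) / Real.sqrt v))) ^ 2) (by fun_prop)]
  set u := (c - μ) / Real.sqrt v
  have e : (fun x => (Real.sqrt v * x + μ - (μ - Real.sqrt v * mills u)) ^ 2) =
      fun x => v * (x + mills u) ^ 2 := by
    ext x
    have := Real.sq_sqrt hv.le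
    calc _ = (Real.sqrt v) ^ 2 * (x + mills u) ^ 2 := by ring
      _ = _ := by rw [this]
  rw [e, integral_const_mul, setIntegral_add_sq_stdGaussian]
  have := (stdCDF_pos u).ne'
  field_simp
  ring

/-- The conditional expectation of `h e` for a standard normal `e` that is observed only
if it exceeds `u`, as a function of `e`. For `h = id` and `h = 1 - x²` this is the score of a
censored observation, so that scores inherit mean zero and bounded variance from `h`. -/
noncomputable def censorProj (h : ℝ → ℝ) (u e : ℝ) : ℝ :=
  if u < e then h e else (∫ x in Set.Iic u, h x ∂(gaussianReal 0 1)) / stdCDF u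

lemma censorProj_eq_indicator (h : ℝ → ℝ) (u : ℝ) :
    censorProj h u = fun e => (Set.Ioi u).indicator h e + (Set.Iic u).indicator
      (fun _ => (∫ x in Set.Iic u, h x ∂(gaussianReal 0 1)) / stdCDF u) e := by
  ext e
  by_cases he : u < e
  · simp [censorProj, he]
  · simp [censorProj, he, not_lt.1 he]

lemma measurable_censorProj {h : ℝ → ℝ} (hh : Measurable h) (u : ℝ) :
    Measurable (censorProj h u) :=
  Measurable.ite measurableSet_Ioi hh measurable_const

lemma integral_censorProj {h : ℝ → ℝ} (hh : Integrable h (gaussianReal 0 1)) (u : ℝ) :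
    ∫ e, censorProj h u e ∂(gaussianReal 0 1) = ∫ e, h e ∂(gaussianReal 0 1) := by
  rw [censorProj_eq_indicator, integral_add (hh.indicator measurableSet_Ioi)
    ((integrable_const _).indicator measurableSet_Iic), integral_indicator measurableSet_Ioi,
    integral_indicator measurableSet_Iic, setIntegral_const_stdGaussian,
    mul_div_cancel₀ _ (stdCDF_pos u).ne', add_comm, ← integral_add_compl measurableSet_Iic hh,
    Set.compl_Iic]

lemma censorProj_sq (h : ℝ → ℝ) (u : ℝ) :
    (fun e => censorProj h u e ^ 2) = fun e => (Set.Ioi u).indicator (fun e => h e ^ 2) e +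
      (Set.Iic u).indicator
        (fun _ => ((∫ x in Set.Iic u, h x ∂(gaussianReal 0 1)) / stdCDF u) ^ 2) e := by
  ext e
  by_cases he : u < e
  · simp [censorProj, he]
  · simp [censorProj, he, not_lt.1 he]

lemma integrable_censorProj_sq {h : ℝ → ℝ}
    (hh2 : Integrable (fun x => h x ^ 2) (gaussianReal 0 1)) (u : ℝ) :
    Integrable (fun e => censorProj h u e ^ 2) (gaussianReal 0 1) := by
  rw [censorProj_sq]
  exact (hh2.indicator measurableSet_Ioi).add
    ((integrable_const _).indicator measurableSet_Iic)

/-- Conditional expectations contract the second moment. -/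
lemma integral_censorProj_sq_le {h : ℝ → ℝ} (hh : Integrable h (gaussianReal 0 1))
    (hh2 : Integrable (fun x => h x ^ 2) (gaussianReal 0 1)) (u : ℝ) :
    ∫ e, censorProj h u e ^ 2 ∂(gaussianReal 0 1) ≤ ∫ e, h e ^ 2 ∂(gaussianReal 0 1) := by
  rw [censorProj_sq, integral_add (hh2.indicator measurableSet_Ioi)
    ((integrable_const _).indicator measurableSet_Iic), integral_indicator measurableSet_Ioi,
    integral_indicator measurableSet_Iic, setIntegral_const_stdGaussian,
    ← integral_add_compl measurableSet_Iic hh2, Set.compl_Iic, add_comm]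
  refine add_le_add ?_ le_rfl
  set c := (∫ x in Set.Iic u, h x ∂(gaussianReal 0 1)) / stdCDF u with hc
  have hc' : ∫ x in Set.Iic u, h x ∂(gaussianReal 0 1) = stdCDF u * c := by
    rw [hc, mul_div_cancel₀ _ (stdCDF_pos u).ne']
  have h0 : 0 ≤ ∫ x in Set.Iic u, (h x - c) ^ 2 ∂(gaussianReal 0 1) :=
    setIntegral_nonneg measurableSet_Iic fun x _ => sq_nonneg _
  have e : (fun x : ℝ => (h x - c) ^ 2) = fun x => h x ^ 2 + ((-2 * c) * h x + c ^ 2) := by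
    ext; ring
  have hi1 : IntegrableOn (fun x => (-2 * c) * h x) (Set.Iic u) (gaussianReal 0 1) :=
    hh.integrableOn.const_mul _
  have hi2 : IntegrableOn (fun x => (-2 * c) * h x + c ^ 2) (Set.Iic u)
    (gaussianReal 0 1) := hi1.add (integrable_const _)
  rw [e, integral_add hh2.integrableOn hi2, integral_add hi1 (integrable_const _),
    integral_const_mul, setIntegral_const_stdGaussian, hc'] at h0
  nlinarith

end TobitVB

/-! ### The penalized Tobit log-likelihood in Olsen's parameterization -/

namespace TobitVB

/-- Log-likelihood contribution of a response `y` left-censored at `yL` in Olsen's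
parameterization: inverse scale `τ` and linear predictor `f` on the standardized scale. -/
noncomputable def obsLogLik (yL τ y f : ℝ) : ℝ :=
  if yL < y then Real.log τ - 1 / 2 * Real.log (2 * Real.pi) - 1 / 2 * (τ * y - f) ^ 2
  else Real.log (stdCDF (τ * yL - f))

/-- Generalized residual: the derivative of `obsLogLik` in the predictor `f`. -/
noncomputable def genResid (yL τ y f : ℝ) : ℝ :=
  if yL < y then τ * y - f else -mills (τ * yL - f)

/-- Concavity of the log-likelihood in `(τ, f)`, keeping the full curvature of uncensored terms;
censored terms contribute only the tangent of the concave function `log Φ`. -/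
lemma obsLogLik_le {yL τ τ' y : ℝ} (hτ : 0 < τ) (hτ' : 0 < τ') (hy : yL ≤ y) (f f' : ℝ) :
    obsLogLik yL τ' y f' ≤ obsLogLik yL τ y f +
      genResid yL τ y f * ((f' - f) - (τ' - τ) * y) +
      if yL < y then Real.log (τ' / τ) - 1 / 2 * ((τ' - τ) * y - (f' - f)) ^ 2 else 0 := by
  unfold obsLogLik genResid
  split_ifs with h
  · rw [Real.log_div hτ'.ne' hτ.ne']
    apply le_of_eq
    ring
  · obtain rfl : yL = y := le_antisymm hy (not_lt.1 h)
    have := log_stdCDF_le_tangent (τ * yL - f) (τ' * yL - f')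
    linarith

lemma hasDerivAt_obsLogLik {yL τ y : ℝ} (hτ : 0 < τ) (hy : yL ≤ y) (f σ h : ℝ) :
    HasDerivAt (fun t => obsLogLik yL (τ + t * σ) y (f + t * h))
      (genResid yL τ y f * (h - σ * y) + if yL < y then σ / τ else 0) 0 := by
  have h1 : HasDerivAt (fun t : ℝ => τ + t * σ) σ 0 :=
    (((hasDerivAt_id' (0 : ℝ)).mul_const σ).const_add τ).congr_deriv (by ring)
  have h2 : HasDerivAt (fun t : ℝ => f + t * h) h 0 :=
    (((hasDerivAt_id' (0 : ℝ)).mul_const h).const_add f).congr_deriv (by ring)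
  unfold obsLogLik genResid
  split_ifs with hc
  · have h3 := (h1.log (by simpa using hτ.ne')).sub_const (1 / 2 * Real.log (2 * Real.pi))
    have h4 := (((h1.mul_const y).fun_sub h2).fun_pow 2).const_mul (1 / 2)
    refine (h3.fun_sub h4).congr_deriv ?_
    simp
    ring
  · obtain rfl : yL = y := le_antisymm hy (not_lt.1 hc)
    have h3 := (h1.mul_const yL).fun_sub h2
    have h4 : HasDerivAt (fun v => Real.log (stdCDF v)) (mills (τ * yL - f))
      ((τ + 0 * σ) * yL - (f + 0 * h)) := by
      simpa using hasDerivAt_log_stdCDF (τ * yL - f)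
    refine (h4.comp (0 : ℝ) h3).congr_deriv ?_
    ring

variable {n : ℕ} {κ : Type*} [Fintype κ]

/-- Number of uncensored responses. -/
noncomputable def numUncensored (yL : ℝ) (y : Fin n → ℝ) : ℝ :=
  ∑ i, if yL < y i then 1 else 0

/-- Tobit log-likelihood in Olsen's parameterization. -/
noncomputable def logLik (yL : ℝ) (y : Fin n → ℝ) (τ : ℝ) (f : Fin n → ℝ) : ℝ :=
  ∑ i, obsLogLik yL τ (y i) (f i)

/-- Linear predictor with intercept `d₀` and slopes `d`. -/
def linPred (X : Matrix (Fin n) κ ℝ) (d₀ : ℝ) (d : κ → ℝ) (i : Fin n) : ℝ :=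
  d₀ + (X *ᵥ d) i

/-- The objective whose stationary points are the variational posteriors: the Tobit
log-likelihood with a ridge penalty from the prior of `β`. The term `- log τ` is what remains of the
prior of `σ²` and of the degrees of freedom spent on `α` and `β`. -/
noncomputable def penLogLik (X : Matrix (Fin n) κ ℝ) (yL : ℝ) (y : Fin n → ℝ) (g τ d₀ : ℝ)
    (d : κ → ℝ) : ℝ :=
  logLik yL y τ (linPred X d₀ d) - Real.log τ - 1 / (2 * g) * ((X *ᵥ d) ⬝ᵥ (X *ᵥ d))

/-- Generalized residuals of all responses. -/
noncomputable def resid (X : Matrix (Fin n) κ ℝ) (yL : ℝ) (y : Fin n → ℝ) (τ d₀ : ℝ)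
    (d : κ → ℝ) (i : Fin n) : ℝ :=
  genResid yL τ (y i) (linPred X d₀ d i)

/-- Score equations of `penLogLik`. The `- 1` in the equation of the scale comes from the term
`- log τ`. -/
structure ScoreEq (X : Matrix (Fin n) κ ℝ) (yL : ℝ) (y : Fin n → ℝ) (g τ d₀ : ℝ)
    (d : κ → ℝ) : Prop where
  intercept : ∑ i, resid X yL y τ d₀ d i = 0
  slope : Xᵀ *ᵥ resid X yL y τ d₀ d = (1 / g) • ((Xᵀ * X) *ᵥ d)
  scale : τ * ∑ i, resid X yL y τ d₀ d i * y i = numUncensored yL y - 1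

lemma sum_mul_mulVec (X : Matrix (Fin n) κ ℝ) (r : Fin n → ℝ) (h : κ → ℝ) :
    ∑ i, r i * (X *ᵥ h) i = h ⬝ᵥ (Xᵀ *ᵥ r) := by
  change r ⬝ᵥ (X *ᵥ h) = _
  rw [dotProduct_mulVec, mulVec_transpose, dotProduct_comm]

lemma dotProduct_gram_mulVec (X : Matrix (Fin n) κ ℝ) (h d : κ → ℝ) :
    h ⬝ᵥ ((Xᵀ * X) *ᵥ d) = (X *ᵥ h) ⬝ᵥ (X *ᵥ d) := by
  rw [← mulVec_mulVec, dotProduct_mulVec, vecMul_transpose]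

lemma logLik_le {yL : ℝ} {y : Fin n → ℝ} (hy : ∀ i, yL ≤ y i) {τ τ' : ℝ} (hτ : 0 < τ)
    (hτ' : 0 < τ') (f f' : Fin n → ℝ) :
    logLik yL y τ' f' ≤ logLik yL y τ f +
      ∑ i, genResid yL τ (y i) (f i) * ((f' i - f i) - (τ' - τ) * y i) +
      numUncensored yL y * Real.log (τ' / τ) -
      1 / 2 * ∑ i, if yL < y i then ((τ' - τ) * y i - (f' i - f i)) ^ 2 else 0 := by
  unfold logLik numUncensored
  rw [Finset.sum_mul, Finset.mul_sum, ← Finset.sum_add_distrib, ← Finset.sum_add_distrib,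
    ← Finset.sum_sub_distrib]
  refine Finset.sum_le_sum fun i _ => (obsLogLik_le hτ hτ' (hy i) (f i) (f' i)).trans ?_
  split_ifs <;> linarith

/-- A solution of the score equations maximizes the objective, by concavity. -/
lemma ScoreEq.penLogLik_le {X : Matrix (Fin n) κ ℝ} {yL : ℝ} {y : Fin n → ℝ} {g τ d₀ : ℝ}
    {d : κ → ℝ} (hS : ScoreEq X yL y g τ d₀ d) (hg : 0 < g) (hy : ∀ i, yL ≤ y i) (hτ : 0 < τ)
    (hn : 1 ≤ numUncensored yL y) {τ' : ℝ} (hτ' : 0 < τ') (d₀' : ℝ) (d' : κ → ℝ) :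
    penLogLik X yL y g τ' d₀' d' ≤ penLogLik X yL y g τ d₀ d := by
  have h := logLik_le hy hτ hτ' (linPred X d₀ d) (linPred X d₀' d')
  have hsq : 0 ≤ ∑ i, if yL < y i then ((τ' - τ) * y i -
      (linPred X d₀' d' i - linPred X d₀ d i)) ^ 2 else 0 :=
    Finset.sum_nonneg fun i _ => by split_ifs <;> positivity
  have e : ∑ i, genResid yL τ (y i) (linPred X d₀ d i) *
      ((linPred X d₀' d' i - linPred X d₀ d i) - (τ' - τ) * y i) =
      (d₀' - d₀) * ∑ i, resid X yL y τ d₀ d i +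
      ∑ i, resid X yL y τ d₀ d i * (X *ᵥ (d' - d)) i -
      (τ' - τ) * ∑ i, resid X yL y τ d₀ d i * y i := by
    rw [Finset.mul_sum, Finset.mul_sum, ← Finset.sum_add_distrib, ← Finset.sum_sub_distrib]
    refine Finset.sum_congr rfl fun i _ => ?_
    simp only [resid, linPred, mulVec_sub, Pi.sub_apply]
    ring
  rw [e, hS.intercept, sum_mul_mulVec, hS.slope, dotProduct_smul, dotProduct_gram_mulVec,
    smul_eq_mul, mulVec_sub, sub_dotProduct] at h
  have hsc : ∑ i, resid X yL y τ d₀ d i * y i = (numUncensored yL y - 1) / τ := by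
    rw [← hS.scale]; field_simp
  rw [hsc] at h
  have hlog : Real.log (τ' / τ) ≤ τ' / τ - 1 := Real.log_le_sub_one_of_pos (by positivity)
  have hlog' := mul_le_mul_of_nonneg_left hlog (sub_nonneg.2 hn)
  have e2 : (τ' - τ) * ((numUncensored yL y - 1) / τ) =
      (numUncensored yL y - 1) * (τ' / τ - 1) := by field_simp
  have e3 : Real.log (τ' / τ) = Real.log τ' - Real.log τ := Real.log_div hτ'.ne' hτ.ne'
  have hquad : 0 ≤ (X *ᵥ d' - X *ᵥ d) ⬝ᵥ (X *ᵥ d' - X *ᵥ d) := by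
    simpa using dotProduct_star_self_nonneg (X *ᵥ d' - X *ᵥ d)
  simp only [sub_dotProduct, dotProduct_sub] at hquad
  rw [dotProduct_comm (X *ᵥ d) (X *ᵥ d')] at hquad
  have hquad' := mul_nonneg (by positivity : 0 ≤ 1 / (2 * g)) hquad
  have e4 : 1 / g = 2 * (1 / (2 * g)) := by field_simp
  unfold penLogLik
  rw [e4] at h
  rw [e2] at h
  nlinarith

lemma hasDerivAt_penLogLik {X : Matrix (Fin n) κ ℝ} {yL : ℝ} {y : Fin n → ℝ} {g τ : ℝ}
    (hg : 0 < g) (hy : ∀ i, yL ≤ y i) (hτ : 0 < τ) (d₀ σ h₀ : ℝ) (d h : κ → ℝ) :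
    HasDerivAt (fun t : ℝ => penLogLik X yL y g (τ + t * σ) (d₀ + t * h₀) (d + t • h))
      (∑ i, (resid X yL y τ d₀ d i * (h₀ + (X *ᵥ h) i - σ * y i) +
        if yL < y i then σ / τ else 0) - σ / τ - 1 / g * ((X *ᵥ d) ⬝ᵥ (X *ᵥ h))) 0 := by
  have h1 : HasDerivAt (fun t : ℝ => τ + t * σ) σ 0 :=
    (((hasDerivAt_id' (0 : ℝ)).mul_const σ).const_add τ).congr_deriv (by ring)
  have hL : HasDerivAt (fun t : ℝ => ∑ i, obsLogLik yL (τ + t * σ) (y i)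
      (linPred X d₀ d i + t * (h₀ + (X *ᵥ h) i)))
      (∑ i, (resid X yL y τ d₀ d i * (h₀ + (X *ᵥ h) i - σ * y i) +
        if yL < y i then σ / τ else 0)) 0 :=
    HasDerivAt.fun_sum fun i _ => hasDerivAt_obsLogLik hτ (hy i) _ _ _
  have hlog := h1.log (by simpa using hτ.ne')
  have hq : HasDerivAt (fun t : ℝ => (X *ᵥ d) ⬝ᵥ (X *ᵥ d) + t * (2 * ((X *ᵥ d) ⬝ᵥ (X *ᵥ h))) +
      t ^ 2 * ((X *ᵥ h) ⬝ᵥ (X *ᵥ h))) (2 * ((X *ᵥ d) ⬝ᵥ (X *ᵥ h))) 0 :=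
    ((((hasDerivAt_id' (0 : ℝ)).mul_const _).const_add _).fun_add
      ((hasDerivAt_pow 2 (0 : ℝ)).mul_const _)).congr_deriv (by simp)
  refine (((hL.fun_sub hlog).fun_sub (hq.const_mul (1 / (2 * g)))).congr_of_eventuallyEq
    (Eventually.of_forall fun t => ?_)).congr_deriv ?_
  · simp only [penLogLik, logLik]
    congr 1
    · congr 1
      refine Finset.sum_congr rfl fun i _ => ?_
      congr 1
      simp only [linPred, mulVec_add, mulVec_smul, Pi.add_apply, Pi.smul_apply, smul_eq_mul]
      ring
    · congr 1
      simp only [mulVec_add, mulVec_smul, add_dotProduct, dotProduct_add, smul_dotProduct,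
        dotProduct_smul, smul_eq_mul]
      rw [dotProduct_comm (X *ᵥ h) (X *ᵥ d)]
      ring
  · rw [zero_mul, add_zero, show 1 / (2 * g) * (2 * (X *ᵥ d) ⬝ᵥ (X *ᵥ h)) =
      1 / g * ((X *ᵥ d) ⬝ᵥ (X *ᵥ h)) by field_simp]

/-- A maximizer of the objective solves the score equations. -/
lemma scoreEq_of_isMax {X : Matrix (Fin n) κ ℝ} {yL : ℝ} {y : Fin n → ℝ} {g τ d₀ : ℝ}
    {d : κ → ℝ} (hg : 0 < g) (hy : ∀ i, yL ≤ y i) (hτ : 0 < τ)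
    (hmax : ∀ τ' d₀' d', 0 < τ' → penLogLik X yL y g τ' d₀' d' ≤ penLogLik X yL y g τ d₀ d) :
    ScoreEq X yL y g τ d₀ d := by
  have key : ∀ (σ h₀ : ℝ) (h : κ → ℝ),
      ∑ i, (resid X yL y τ d₀ d i * (h₀ + (X *ᵥ h) i - σ * y i) +
        if yL < y i then σ / τ else 0) - σ / τ - 1 / g * ((X *ᵥ d) ⬝ᵥ (X *ᵥ h)) = 0 := by
    intro σ h₀ h
    refine IsLocalMax.hasDerivAt_eq_zero ?_ (hasDerivAt_penLogLik hg hy hτ d₀ σ h₀ d h)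
    have hpos : ∀ᶠ t : ℝ in 𝓝 0, 0 < τ + t * σ := by
      have : ContinuousAt (fun t : ℝ => τ + t * σ) 0 := by fun_prop
      exact this.eventually (lt_mem_nhds (by simpa using hτ))
    filter_upwards [hpos] with t ht
    simpa using hmax _ (d₀ + t * h₀) (d + t • h) ht
  refine ⟨?_, ?_, ?_⟩
  · simpa using key 0 1 0
  · have h1 : ∀ h : κ → ℝ, h ⬝ᵥ (Xᵀ *ᵥ resid X yL y τ d₀ d - (1 / g) • ((Xᵀ * X) *ᵥ d)) = 0 := by
      intro h
      have := key 0 0 h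
      rw [dotProduct_sub, dotProduct_smul, dotProduct_gram_mulVec, ← sum_mul_mulVec, smul_eq_mul,
        dotProduct_comm (X *ᵥ h)]
      simpa using this
    exact sub_eq_zero.1 (dotProduct_self_eq_zero.1 (h1 _))
  · have := key 1 0 0
    simp only [zero_add, mulVec_zero, Pi.zero_apply, zero_sub, one_mul, mul_neg,
      dotProduct_zero, mul_zero, sub_zero, Finset.sum_add_distrib, Finset.sum_neg_distrib] at this
    have e : ∑ i, (if yL < y i then 1 / τ else 0) = numUncensored yL y / τ := by
      rw [numUncensored, Finset.sum_div]
      exact Finset.sum_congr rfl fun i _ => by split_ifs <;> simp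
    rw [e] at this
    field_simp at this
    linarith

end TobitVB

/-! ### Variational posteriors as solutions of the score equations -/

namespace TobitVB

variable {n : ℕ} {κ : Type*}

/-- The inverse scale `1 / √ξ` of a variational state. -/
noncomputable def VBState.tau (q : VBState κ) : ℝ := (Real.sqrt q.xi)⁻¹

lemma VBState.tau_pos {q : VBState κ} (h : 0 < q.xi) : 0 < q.tau :=
  inv_pos.2 (Real.sqrt_pos.2 h)

lemma VBState.tau_mul_sqrt_xi {q : VBState κ} (h : 0 < q.xi) : q.tau * Real.sqrt q.xi = 1 :=
  inv_mul_cancel₀ (Real.sqrt_pos.2 h).ne'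

lemma VBState.tau_sq_mul_xi {q : VBState κ} (h : 0 < q.xi) : q.tau ^ 2 * q.xi = 1 := by
  have := VBState.tau_mul_sqrt_xi h
  calc q.tau ^ 2 * q.xi = (q.tau * Real.sqrt q.xi) ^ 2 := by
        rw [mul_pow, Real.sq_sqrt h.le]
    _ = 1 := by rw [this, one_pow]

lemma VBState.linPred_tau [Fintype κ] (q : VBState κ) (X : Matrix (Fin n) κ ℝ) (i : Fin n) :
    linPred X (q.tau * q.muAlpha) (q.tau • q.muBeta) i = q.tau * q.loc X i := by
  simp only [linPred, VBState.loc, mulVec_smul, Pi.smul_apply, smul_eq_mul]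
  ring

/-- Generalized residuals at a variational state. -/
noncomputable def VBState.res [Fintype κ] (q : VBState κ) (X : Matrix (Fin n) κ ℝ) (yL : ℝ)
    (y : Fin n → ℝ) :
    Fin n → ℝ :=
  resid X yL y q.tau (q.tau * q.muAlpha) (q.tau • q.muBeta)

lemma VBState.res_of_lt [Fintype κ] {q : VBState κ} {X : Matrix (Fin n) κ ℝ} {yL : ℝ}
    {y : Fin n → ℝ}
    {i : Fin n} (h : yL < y i) : q.res X yL y i = q.tau * (y i - q.loc X i) := by
  rw [VBState.res, resid, genResid, if_pos h, q.linPred_tau]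
  ring

lemma VBState.res_of_le [Fintype κ] {q : VBState κ} {X : Matrix (Fin n) κ ℝ} {yL : ℝ}
    {y : Fin n → ℝ}
    {i : Fin n} (h : ¬ yL < y i) : q.res X yL y i = -mills (q.tau * (yL - q.loc X i)) := by
  rw [VBState.res, resid, genResid, if_neg h, q.linPred_tau, mul_sub]

lemma VBState.zHat_of_lt [Fintype κ] (q : VBState κ) {X : Matrix (Fin n) κ ℝ} {yL : ℝ}
    {y : Fin n → ℝ}
    {i : Fin n} (h : yL < y i) : q.zHat X yL y i = y i := by
  simp [VBState.zHat, VBState.zLaw, h]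

lemma VBState.zHat_sub_loc [Fintype κ] {q : VBState κ} (hξ : 0 < q.xi) (X : Matrix (Fin n) κ ℝ)
    (yL : ℝ)
    (y : Fin n → ℝ) (i : Fin n) :
    q.zHat X yL y i - q.loc X i = Real.sqrt q.xi * q.res X yL y i := by
  by_cases h : yL < y i
  · rw [q.zHat_of_lt h, VBState.res_of_lt h, ← mul_assoc, mul_comm (Real.sqrt _),
      VBState.tau_mul_sqrt_xi hξ, one_mul]
  · rw [VBState.res_of_le h, VBState.zHat, VBState.zLaw, if_neg h,
      integral_id_truncNormal _ hξ, VBState.tau, div_eq_inv_mul]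
    ring

lemma VBState.zHat_le [Fintype κ] {q : VBState κ} (hξ : 0 < q.xi) {X : Matrix (Fin n) κ ℝ} {yL : ℝ}
    {y : Fin n → ℝ} {i : Fin n} (h : ¬ yL < y i) : q.zHat X yL y i ≤ yL := by
  have h1 := VBState.zHat_sub_loc hξ X yL y i
  rw [VBState.res_of_le h] at h1
  have h2 := mul_nonneg (Real.sqrt_nonneg q.xi) (add_mills_nonneg (q.tau * (yL - q.loc X i)))
  have h3 := VBState.tau_mul_sqrt_xi hξ
  have h4 : Real.sqrt q.xi * (q.tau * (yL - q.loc X i)) = yL - q.loc X i := by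
    rw [← mul_assoc, mul_comm (Real.sqrt _), h3, one_mul]
  linarith

/-- The variational second moment of `z_i - μ_i`. -/
lemma VBState.sq_add_zVar [Fintype κ] {q : VBState κ} (hξ : 0 < q.xi) {X : Matrix (Fin n) κ ℝ}
    {yL : ℝ}
    {y : Fin n → ℝ} (hy : ∀ i, yL ≤ y i) (i : Fin n) :
    (q.zHat X yL y i - q.loc X i) ^ 2 + q.zVar X yL y i =
      q.xi * (1 - (if yL < y i then 1 else 0) +
        q.tau * q.res X yL y i * y i - q.res X yL y i * (q.tau * q.loc X i)) := by
  rw [VBState.zHat_sub_loc hξ, mul_pow, Real.sq_sqrt hξ.le]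
  by_cases h : yL < y i
  · rw [VBState.zVar, VBState.zLaw, if_pos h, variance_eq_integral (by fun_prop)]
    simp only [integral_dirac, sub_self, if_pos h]
    rw [VBState.res_of_lt h]
    ring
  · have hyi : y i = yL := le_antisymm (not_lt.1 h) (hy i)
    rw [VBState.zVar, VBState.zLaw, if_neg h, variance_truncNormal _ hξ, VBState.res_of_le h,
      if_neg h, hyi, VBState.tau, div_eq_inv_mul]
    ring

lemma sum_mulVec_eq_zero [Fintype κ] {X : Matrix (Fin n) κ ℝ} (hX : ∀ j, ∑ i, X i j = 0)
    (d : κ → ℝ) :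
    ∑ i, (X *ᵥ d) i = 0 := by
  simp only [mulVec, dotProduct]
  rw [Finset.sum_comm]
  simp [← Finset.sum_mul, hX]

lemma transpose_mulVec_const {X : Matrix (Fin n) κ ℝ} (hX : ∀ j, ∑ i, X i j = 0) (c : ℝ) :
    Xᵀ *ᵥ (fun _ => c) = 0 := by
  ext j
  simp [mulVec, dotProduct, ← Finset.sum_mul, hX]

lemma sum_loc [Fintype κ] {X : Matrix (Fin n) κ ℝ} (hX : ∀ j, ∑ i, X i j = 0) (q : VBState κ) :
    ∑ i, q.loc X i = n * q.muAlpha := by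
  simp [VBState.loc, Finset.sum_add_distrib, sum_mulVec_eq_zero hX]

lemma muAlpha_eq_iff [Fintype κ] (hn : 0 < n) {X : Matrix (Fin n) κ ℝ} (hX : ∀ j, ∑ i, X i j = 0)
    {q : VBState κ} (hξ : 0 < q.xi) (yL : ℝ) (y : Fin n → ℝ) :
    q.muAlpha = (∑ i, q.zHat X yL y i) / n ↔ ∑ i, q.res X yL y i = 0 := by
  have hn' : (n : ℝ) ≠ 0 := by positivity
  have h : ∑ i, q.zHat X yL y i - n * q.muAlpha = Real.sqrt q.xi * ∑ i, q.res X yL y i := by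
    rw [← sum_loc hX q, ← Finset.sum_sub_distrib, Finset.mul_sum]
    exact Finset.sum_congr rfl fun i _ => VBState.zHat_sub_loc hξ X yL y i
  have hs : Real.sqrt q.xi ≠ 0 := (Real.sqrt_pos.2 hξ).ne'
  rw [eq_div_iff hn']
  constructor
  · intro h1
    have : Real.sqrt q.xi * ∑ i, q.res X yL y i = 0 := by rw [← h, ← h1]; ring
    exact (mul_eq_zero.1 this).resolve_left hs
  · intro h1
    rw [h1, mul_zero] at h
    linarith

/-- Substituting the truncated means `m_i = μ_i + √ξ ρ_i`, with `ρ` the generalized residuals, into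
the update of `μ_β` gives the score equation of the slopes. -/
lemma muBeta_eq_iff [Fintype κ] [DecidableEq κ] {X : Matrix (Fin n) κ ℝ} (hX : ∀ j, ∑ i, X i j = 0)
    (hdet : IsUnit (Xᵀ * X).det) {g : ℝ} (hg : 0 < g)
    {q : VBState κ} (hξ : 0 < q.xi) (yL : ℝ) (y : Fin n → ℝ) :
    q.muBeta = (g / (1 + g)) • ((Xᵀ * X)⁻¹ *ᵥ (Xᵀ *ᵥ q.zHat X yL y)) ↔
      Xᵀ *ᵥ q.res X yL y = (1 / g) • ((Xᵀ * X) *ᵥ (q.tau • q.muBeta)) := by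
  have hs : Real.sqrt q.xi ≠ 0 := (Real.sqrt_pos.2 hξ).ne'
  have hz : q.zHat X yL y = (fun _ => q.muAlpha) + X *ᵥ q.muBeta +
      Real.sqrt q.xi • q.res X yL y := by
    ext i
    have := VBState.zHat_sub_loc hξ X yL y i
    simp only [VBState.loc] at this
    simp only [Pi.add_apply, Pi.smul_apply, smul_eq_mul]
    linarith
  have h1 : Xᵀ *ᵥ q.zHat X yL y =
      (Xᵀ * X) *ᵥ q.muBeta + Real.sqrt q.xi • (Xᵀ *ᵥ q.res X yL y) := by
    rw [hz, mulVec_add, mulVec_add, transpose_mulVec_const hX, mulVec_mulVec, mulVec_smul,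
      zero_add]
  have h1g : (1 + g) ≠ 0 := by positivity
  constructor
  · intro h
    have h2 : (Xᵀ * X) *ᵥ q.muBeta = (g / (1 + g)) • (Xᵀ *ᵥ q.zHat X yL y) := by
      conv_lhs => rw [h]
      rw [mulVec_smul, mulVec_mulVec, mul_nonsing_inv _ hdet, one_mulVec]
    rw [h1] at h2
    ext j
    have h3 := congrFun h2 j
    simp only [Pi.add_apply, Pi.smul_apply, smul_eq_mul, mulVec_smul] at h3 ⊢
    rw [VBState.tau]
    field_simp at h3 ⊢
    linarith
  · intro h
    have h2 : (Xᵀ * X) *ᵥ q.muBeta = (g / (1 + g)) • (Xᵀ *ᵥ q.zHat X yL y) := by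
      rw [h1, h]
      ext j
      simp only [Pi.add_apply, Pi.smul_apply, smul_eq_mul, mulVec_smul, VBState.tau]
      field_simp
      ring
    rw [← mulVec_smul, ← h2, mulVec_mulVec, nonsing_inv_mul _ hdet, one_mulVec]

/-- Given the other updates, the update of `b` is the score equation of the scale: the trace of
`Ω_β` contributes `p_k ξ` and cancels the `p_k` in `2 a = n + p_k`, whereas `n ω_α = ξ` is the
origin of the `- 1`. -/
lemma b_eq_iff [Fintype κ] [DecidableEq κ] (hn : 0 < n) {X : Matrix (Fin n) κ ℝ}
    (hdet : IsUnit (Xᵀ * X).det) {g : ℝ} (hg : 0 < g)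
    {q : VBState κ} (hξ : 0 < q.xi) {yL : ℝ} {y : Fin n → ℝ} (hy : ∀ i, yL ≤ y i)
    (ha : q.a = ((n : ℝ) + Fintype.card κ) / 2) (hω : q.omegaAlpha = q.b / (n * q.a))
    (hΩ : q.OmegaBeta = (g / (1 + g) * (q.b / q.a)) • (Xᵀ * X)⁻¹)
    (h0 : ∑ i, q.res X yL y i = 0)
    (h1 : Xᵀ *ᵥ q.res X yL y = (1 / g) • ((Xᵀ * X) *ᵥ (q.tau • q.muBeta))) :
    q.b = 1 / 2 *
      (∑ i, (q.zHat X yL y i - q.loc X i) ^ 2 + ∑ i, q.zVar X yL y i + n * q.omegaAlpha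
        + 1 / g * (q.muBeta ⬝ᵥ ((Xᵀ * X) *ᵥ q.muBeta))
        + (1 + 1 / g) * (Xᵀ * X * q.OmegaBeta).trace) ↔
      q.tau * ∑ i, q.res X yL y i * y i = numUncensored yL y - 1 := by
  have hn' : (n : ℝ) ≠ 0 := by positivity
  have ha0 : 0 < q.a := by rw [ha]; positivity
  have hb : q.b = q.a * q.xi := by rw [VBState.xi]; field_simp
  have hω' : n * q.omegaAlpha = q.xi := by rw [hω, VBState.xi]; field_simp
  have htr : (1 + 1 / g) * (Xᵀ * X * q.OmegaBeta).trace = Fintype.card κ * q.xi := by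
    rw [hΩ, Matrix.mul_smul, mul_nonsing_inv _ hdet, trace_smul, trace_one, ← VBState.xi,
      smul_eq_mul]
    field_simp
    ring
  have hτ := VBState.tau_sq_mul_xi hξ
  have hpen : ∑ i, q.res X yL y i * (q.tau * q.loc X i) =
      1 / g * (q.tau ^ 2 * (q.muBeta ⬝ᵥ ((Xᵀ * X) *ᵥ q.muBeta))) := by
    have : ∑ i, q.res X yL y i * (q.tau * q.loc X i) = q.tau * q.muAlpha * ∑ i, q.res X yL y i +
        ∑ i, q.res X yL y i * (X *ᵥ (q.tau • q.muBeta)) i := by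
      rw [Finset.mul_sum, ← Finset.sum_add_distrib]
      refine Finset.sum_congr rfl fun i _ => ?_
      simp only [VBState.loc, mulVec_smul, Pi.smul_apply, smul_eq_mul]
      ring
    rw [this, h0, sum_mul_mulVec, h1]
    simp only [mulVec_smul, dotProduct_smul, smul_dotProduct, smul_eq_mul]
    ring
  have hsum : ∑ i, (q.zHat X yL y i - q.loc X i) ^ 2 + ∑ i, q.zVar X yL y i =
      q.xi * (n - numUncensored yL y + q.tau * ∑ i, q.res X yL y i * y i) -
        1 / g * (q.muBeta ⬝ᵥ ((Xᵀ * X) *ᵥ q.muBeta)) := by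
    rw [← Finset.sum_add_distrib, Finset.sum_congr rfl fun i _ => VBState.sq_add_zVar hξ hy i,
      ← Finset.mul_sum, Finset.sum_sub_distrib, hpen, Finset.sum_add_distrib,
      Finset.sum_sub_distrib, numUncensored, Finset.mul_sum]
    simp only [mul_assoc, Finset.sum_const, Finset.card_univ, Fintype.card_fin, nsmul_eq_mul,
      mul_one]
    linear_combination (-(1 / g * (q.muBeta ⬝ᵥ ((Xᵀ * X) *ᵥ q.muBeta)))) * hτ
  rw [hsum, hω', htr, hb, ha]
  constructor
  · intro h
    have h2 : q.xi * (q.tau * ∑ i, q.res X yL y i * y i) = q.xi * (numUncensored yL y - 1) := by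
      linarith
    exact mul_left_cancel₀ hξ.ne' h2
  · intro h
    rw [h]
    ring

lemma IsVB.a_pos [Fintype κ] [DecidableEq κ] {q : VBState κ} {X : Matrix (Fin n) κ ℝ} {yL : ℝ}
    {y : Fin n → ℝ} {g : ℝ}
    (h : IsVB q X yL y g) (hn : 0 < n) : 0 < q.a := by
  rw [h.a_eq]; positivity

lemma IsVB.xi_pos [Fintype κ] [DecidableEq κ] {q : VBState κ} {X : Matrix (Fin n) κ ℝ} {yL : ℝ}
    {y : Fin n → ℝ} {g : ℝ}
    (h : IsVB q X yL y g) (hn : 0 < n) : 0 < q.xi :=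
  div_pos h.b_pos (h.a_pos hn)

/-- A variational posterior solves the score equations. -/
lemma IsVB.scoreEq [Fintype κ] [DecidableEq κ] {q : VBState κ} {X : Matrix (Fin n) κ ℝ} {yL : ℝ}
    {y : Fin n → ℝ} {g : ℝ}
    (h : IsVB q X yL y g) (hn : 0 < n) (hX : ∀ j, ∑ i, X i j = 0)
    (hdet : IsUnit (Xᵀ * X).det) (hg : 0 < g) (hy : ∀ i, yL ≤ y i) :
    ScoreEq X yL y g q.tau (q.tau * q.muAlpha) (q.tau • q.muBeta) := by
  have hξ := h.xi_pos hn
  have h0 := (muAlpha_eq_iff hn hX hξ yL y).1 h.muAlpha_eq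
  have h1 := (muBeta_eq_iff hX hdet hg hξ yL y).1 h.muBeta_eq
  exact ⟨h0, h1, (b_eq_iff hn hdet hg hξ hy h.a_eq h.omegaAlpha_eq h.OmegaBeta_eq h0 h1).1 h.b_eq⟩

/-- Every solution of the score equations comes from a variational posterior. -/
lemma ScoreEq.exists_isVB [Fintype κ] [DecidableEq κ] {X : Matrix (Fin n) κ ℝ} {yL : ℝ}
    {y : Fin n → ℝ} {g τ d₀ : ℝ}
    {d : κ → ℝ} (h : ScoreEq X yL y g τ d₀ d) (hτ : 0 < τ) (hn : 0 < n)
    (hX : ∀ j, ∑ i, X i j = 0) (hdet : IsUnit (Xᵀ * X).det) (hg : 0 < g)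
    (hy : ∀ i, yL ≤ y i) : ∃ q : VBState κ, IsVB q X yL y g := by
  set a : ℝ := ((n : ℝ) + Fintype.card κ) / 2 with ha
  have ha0 : 0 < a := by positivity
  set b : ℝ := a * (τ⁻¹) ^ 2 with hb
  have hb0 : 0 < b := by positivity
  let q : VBState κ :=
    { muAlpha := τ⁻¹ * d₀
      omegaAlpha := b / (n * a)
      muBeta := τ⁻¹ • d
      OmegaBeta := (g / (1 + g) * (b / a)) • (Xᵀ * X)⁻¹
      a := a
      b := b }
  have hqξ : q.xi = (τ⁻¹) ^ 2 := by
    change b / a = _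
    rw [hb]; field_simp
  have hξ : 0 < q.xi := by rw [hqξ]; positivity
  have hqτ : q.tau = τ := by
    rw [VBState.tau, hqξ, Real.sqrt_sq (by positivity), inv_inv]
  have e0 : q.tau * q.muAlpha = d₀ := by
    rw [hqτ]; change τ * (τ⁻¹ * d₀) = d₀; field_simp
  have e1 : q.tau • q.muBeta = d := by
    rw [hqτ]; change τ • (τ⁻¹ • d) = d; rw [smul_smul, mul_inv_cancel₀ hτ.ne', one_smul]
  have er : q.res X yL y = resid X yL y τ d₀ d := by
    rw [VBState.res, e0, e1, hqτ]
  have h0 : ∑ i, q.res X yL y i = 0 := by rw [er]; exact h.intercept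
  have h1 : Xᵀ *ᵥ q.res X yL y = (1 / g) • ((Xᵀ * X) *ᵥ (q.tau • q.muBeta)) := by
    rw [er, e1]; exact h.slope
  have h2 : q.tau * ∑ i, q.res X yL y i * y i = numUncensored yL y - 1 := by
    rw [er, hqτ]; exact h.scale
  exact ⟨q, hb0, (muAlpha_eq_iff hn hX hξ yL y).2 h0, rfl,
    (muBeta_eq_iff hX hdet hg hξ yL y).2 h1, rfl, rfl,
    (b_eq_iff hn hdet hg hξ hy rfl rfl rfl h0 h1).2 h2⟩

end TobitVB

/-! ### Inverse gamma mean and Stirling's formula at half-integers -/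

namespace TobitVB

/-- The mean of the inverse gamma distribution `IG(a, b)`. -/
lemma integral_mul_invGammaPDF {a b : ℝ} (ha : 1 < a) (hb : 0 < b) :
    ∫ x in Set.Ioi (0 : ℝ), x * invGammaPDF a b x = b / (a - 1) := by
  have ha1 : 0 < a - 1 := by linarith
  have h1 := integral_comp_rpow_Ioi
    (fun y : ℝ => b ^ a / Real.Gamma a * (y ^ (a - 1 - 1) * Real.exp (-(b * y))))
    (p := -1) (by norm_num)
  rw [integral_const_mul, Real.integral_rpow_mul_exp_neg_mul_Ioi ha1 hb] at h1
  have h2 : ∫ x in Set.Ioi (0 : ℝ), x * invGammaPDF a b x = b ^ a / Real.Gamma a *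
      ((1 / b) ^ (a - 1) * Real.Gamma (a - 1)) := by
    rw [← h1]
    refine setIntegral_congr_fun measurableSet_Ioi fun x hx => ?_
    have hx : 0 < x := hx
    have e1 : x * x ^ (-a - 1) = x ^ ((-1 : ℝ) - 1) * (x ^ (-1 : ℝ)) ^ (a - 1 - 1) := by
      rw [← Real.rpow_mul hx.le, ← Real.rpow_add hx, ← Real.rpow_one_add' hx.le (by linarith)]
      congr 1; ring
    have e2 : b * x ^ (-1 : ℝ) = b / x := by rw [Real.rpow_neg_one]; rfl
    simp only [invGammaPDF, smul_eq_mul, abs_neg, abs_one, one_mul]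
    rw [e2, neg_div]
    calc x * (b ^ a / Real.Gamma a * x ^ (-a - 1) * Real.exp (-(b / x)))
        = b ^ a / Real.Gamma a * (x * x ^ (-a - 1)) * Real.exp (-(b / x)) := by ring
      _ = _ := by rw [e1]; ring
  rw [h2]
  have hG : Real.Gamma a = (a - 1) * Real.Gamma (a - 1) := by
    have := Real.Gamma_add_one ha1.ne'
    rwa [sub_add_cancel] at this
  have hG1 := (Real.Gamma_pos_of_pos ha1).ne'
  have hb1 : b ^ a = b ^ (a - 1) * b := by
    rw [← Real.rpow_add_one hb.ne']; congr 1; ring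
  have hb2 : b ^ (a - 1) ≠ 0 := (Real.rpow_pos_of_pos hb _).ne'
  rw [hG, hb1, one_div, Real.inv_rpow hb.le]
  field_simp

/-- The remainder in Stirling's formula for `log Γ`, up to its limit. -/
noncomputable def stirlingRem (x : ℝ) : ℝ :=
  Real.log (Real.Gamma x) - ((x - 1 / 2) * Real.log x - x)

lemma abs_stirlingRem_nat_le (m : ℕ) (hm : 1 ≤ m) : |stirlingRem m| ≤ 3 := by
  obtain ⟨k, rfl⟩ : ∃ k, m = k + 1 := ⟨m - 1, by omega⟩
  have hpos : (0 : ℝ) < (k + 1 : ℕ) := by positivity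
  have hf : Real.log (Real.Gamma ((k + 1 : ℕ) : ℝ)) =
      Real.log ((k + 1).factorial : ℝ) - Real.log ((k + 1 : ℕ) : ℝ) := by
    have h := Real.Gamma_add_one hpos.ne'
    rw [← Real.Gamma_nat_eq_factorial, h, Real.log_mul hpos.ne' (Real.Gamma_pos_of_pos hpos).ne']
    ring
  have hs : Real.log ((k + 1).factorial : ℝ) = Real.log (Stirling.stirlingSeq (k + 1)) +
      1 / 2 * Real.log (2 * ((k + 1 : ℕ) : ℝ)) +
        ((k + 1 : ℕ) : ℝ) * Real.log (((k + 1 : ℕ) : ℝ) / Real.exp 1) := by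
    rw [Stirling.log_stirlingSeq_formula]; ring
  have hup : Real.log (Stirling.stirlingSeq (k + 1)) ≤ Real.log (Stirling.stirlingSeq 1) :=
    Stirling.log_stirlingSeq'_antitone (Nat.zero_le k)
  have hlow := Stirling.log_stirlingSeq_bounded_by_constant k
  have h1 : Real.log (Stirling.stirlingSeq 1) = 1 - Real.log 2 / 2 := by
    rw [Stirling.stirlingSeq_one, Real.log_div (by positivity) (by positivity), Real.log_exp,
      Real.log_sqrt (by norm_num)]
  have hl2 : 0 ≤ Real.log 2 := Real.log_nonneg (by norm_num)
  have hl2' : Real.log 2 ≤ 1 := by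
    have := Real.log_le_sub_one_of_pos (show (0 : ℝ) < 2 by norm_num); linarith
  rw [Real.log_mul (by norm_num) hpos.ne', Real.log_div hpos.ne' (Real.exp_pos _).ne',
    Real.log_exp] at hs
  rw [stirlingRem, hf, hs, abs_le]
  constructor <;> linarith

lemma abs_stirlingRem_nat_add_half_le (m : ℕ) (hm : 1 ≤ m) : |stirlingRem (m + 1 / 2)| ≤ 5 := by
  have hm0 : (1 : ℝ) ≤ m := by exact_mod_cast hm
  have hpos : (0 : ℝ) < m := by linarith
  have hc := Real.convexOn_log_Gamma
  have hG := Real.Gamma_add_one hpos.ne'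
  have hG2 := Real.Gamma_add_one (show (m : ℝ) + 1 / 2 ≠ 0 by positivity)
  have hl : Real.log (Real.Gamma (m + 1)) = Real.log m + Real.log (Real.Gamma m) := by
    rw [hG, Real.log_mul hpos.ne' (Real.Gamma_pos_of_pos hpos).ne']
  have hl2 : Real.log (Real.Gamma (m + 1 / 2 + 1)) =
      Real.log ((m : ℝ) + 1 / 2) + Real.log (Real.Gamma (m + 1 / 2)) := by
    rw [hG2, Real.log_mul (by positivity) (Real.Gamma_pos_of_pos (by positivity)).ne']
  -- log-convexity pins `Γ(m + 1/2)` between neighbouring values on both sides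
  have h1 := hc.2 (Set.mem_Ioi.2 hpos) (Set.mem_Ioi.2 (show (0 : ℝ) < m + 1 by positivity))
    (show (0 : ℝ) ≤ 1 / 2 by norm_num) (show (0 : ℝ) ≤ 1 / 2 by norm_num) (by norm_num)
  have h2 := hc.2 (Set.mem_Ioi.2 (show (0 : ℝ) < m + 1 / 2 by positivity))
    (Set.mem_Ioi.2 (show (0 : ℝ) < m + 1 / 2 + 1 by positivity))
    (show (0 : ℝ) ≤ 1 / 2 by norm_num) (show (0 : ℝ) ≤ 1 / 2 by norm_num) (by norm_num)
  simp only [Function.comp, smul_eq_mul] at h1 h2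
  rw [show 1 / 2 * (m : ℝ) + 1 / 2 * (m + 1) = m + 1 / 2 by ring] at h1
  rw [show 1 / 2 * ((m : ℝ) + 1 / 2) + 1 / 2 * (m + 1 / 2 + 1) = m + 1 by ring] at h2
  rw [hl] at h1 h2
  rw [hl2] at h2
  have hr := abs_le.1 (abs_stirlingRem_nat_le m hm)
  have hlog1 : Real.log m ≤ Real.log ((m : ℝ) + 1 / 2) := Real.log_le_log hpos (by linarith)
  have hlog2 : m * (Real.log ((m : ℝ) + 1 / 2) - Real.log m) ≤ 1 / 2 := by
    rw [← Real.log_div (by positivity) hpos.ne']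
    have := Real.log_le_sub_one_of_pos (show 0 < ((m : ℝ) + 1 / 2) / m by positivity)
    calc m * Real.log (((m : ℝ) + 1 / 2) / m) ≤ m * (((m : ℝ) + 1 / 2) / m - 1) := by gcongr
      _ = 1 / 2 := by field_simp; ring
  have hlog3 : Real.log ((m : ℝ) + 1 / 2) - Real.log m ≤ 1 / 2 := by nlinarith
  simp only [stirlingRem] at hr ⊢
  rw [abs_le]
  constructor <;> nlinarith

lemma abs_stirlingRem_half_le (N : ℕ) (hN : 2 ≤ N) : |stirlingRem ((N : ℝ) / 2)| ≤ 5 := by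
  rcases Nat.even_or_odd' N with ⟨m, rfl | rfl⟩
  · rw [show ((2 * m : ℕ) : ℝ) / 2 = m by push_cast; ring]
    exact (abs_stirlingRem_nat_le m (by omega)).trans (by norm_num)
  · rw [show ((2 * m + 1 : ℕ) : ℝ) / 2 = m + 1 / 2 by push_cast; ring]
    exact abs_stirlingRem_nat_add_half_le m (by omega)

end TobitVB

/-! ### Plug-in estimates: the variance and the latent responses -/

namespace TobitVB

lemma one_sub_mul_mills_nonneg (u : ℝ) : 0 ≤ 1 - u * mills u := by
  nlinarith [mills_sq_add_le u, sq_nonneg (mills u)]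

lemma one_sub_mul_mills_le (u : ℝ) : 1 - u * mills u ≤ 2 + u ^ 2 := by
  nlinarith [mills_sq_le u, sq_nonneg (u + mills u)]

/-- Effect of a small change of scale on a log-probability. -/
lemma abs_log_stdCDF_sub_le {c : ℝ} (hc : 1 / 2 ≤ c) (hc1 : c ≤ 1) (u : ℝ) :
    |Real.log (stdCDF u) - Real.log (stdCDF (c * u))| ≤ (1 - c) * (2 + (1 - u * mills u)) := by
  have h1 := log_stdCDF_le_tangent u (c * u)
  have h2 := log_stdCDF_le_tangent (c * u) u
  have hmono : ∀ a b : ℝ, a ≤ b → Real.log (stdCDF a) ≤ Real.log (stdCDF b) := fun a b hab =>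
    Real.log_le_log (stdCDF_pos a) (measureReal_mono (Set.Iic_subset_Iic.2 hab))
  have hV := one_sub_mul_mills_nonneg u
  rcases le_total 0 u with hu | hu
  · have h3 := hmono (c * u) u (by nlinarith)
    rw [abs_of_nonneg (by linarith)]
    have h4 := one_sub_mul_mills_nonneg (c * u)
    -- `(c u) mills (c u) ≤ 1`, so the tangent at `c u` has a bounded increment
    have h5 : mills (c * u) * u ≤ 2 := by
      have hm := mul_nonneg (mills_pos (c * u)).le hu
      nlinarith
    nlinarith
  · have h3 := hmono u (c * u) (by nlinarith)
    rw [abs_of_nonpos (by linarith)]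
    nlinarith

variable {n : ℕ} {κ : Type*}

/-- Truncated second moments of the censored responses, on the standardized scale. -/
noncomputable def VBState.censMoment [Fintype κ] (q : VBState κ) (X : Matrix (Fin n) κ ℝ)
    (yL : ℝ) (i : Fin n) : ℝ :=
  1 - q.tau * (yL - q.loc X i) * mills (q.tau * (yL - q.loc X i))

/-- By the score equation of the scale, the truncated second moments add up to at most `n`, so that
discrepancies of size `1 / n` times a truncated second moment have a bounded sum. -/
lemma ScoreEq.sum_censMoment_le [Fintype κ] {q : VBState κ} {X : Matrix (Fin n) κ ℝ} {yL : ℝ}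
    {y : Fin n → ℝ} {g : ℝ} (hy : ∀ i, yL ≤ y i) (hg : 0 < g)
    (h : ScoreEq X yL y g q.tau (q.tau * q.muAlpha) (q.tau • q.muBeta)) :
    ∑ i, (if yL < y i then 0 else q.censMoment X yL i) ≤ n := by
  have h1 : ∀ i, (if yL < y i then 0 else q.censMoment X yL i) ≤
      1 - (if yL < y i then 1 else 0) + q.tau * (q.res X yL y i * y i) -
        q.res X yL y i * (q.tau * q.loc X i) := by
    intro i
    by_cases hi : yL < y i
    · simp only [if_pos hi]
      rw [VBState.res_of_lt hi]
      nlinarith [sq_nonneg (q.tau * (y i - q.loc X i))]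
    · have hyi : y i = yL := le_antisymm (not_lt.1 hi) (hy i)
      simp only [if_neg hi]
      rw [VBState.res_of_le hi, hyi, VBState.censMoment]
      apply le_of_eq
      ring
  refine (Finset.sum_le_sum fun i _ => h1 i).trans ?_
  have hpen : ∑ i, q.res X yL y i * (q.tau * q.loc X i) =
      1 / g * ((X *ᵥ (q.tau • q.muBeta)) ⬝ᵥ (X *ᵥ (q.tau • q.muBeta))) := by
    have : ∑ i, q.res X yL y i * (q.tau * q.loc X i) = q.tau * q.muAlpha * ∑ i, q.res X yL y i +
        ∑ i, q.res X yL y i * (X *ᵥ (q.tau • q.muBeta)) i := by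
      rw [Finset.mul_sum, ← Finset.sum_add_distrib]
      refine Finset.sum_congr rfl fun i _ => ?_
      simp only [VBState.loc, mulVec_smul, Pi.smul_apply, smul_eq_mul]
      ring
    have h0 : ∑ i, q.res X yL y i = 0 := h.intercept
    have h2 : Xᵀ *ᵥ q.res X yL y = _ := h.slope
    rw [this, h0, sum_mul_mulVec, h2, dotProduct_smul, dotProduct_gram_mulVec]
    simp
  have hsc : q.tau * ∑ i, q.res X yL y i * y i = numUncensored yL y - 1 := h.scale
  have hnn : 0 ≤ (X *ᵥ (q.tau • q.muBeta)) ⬝ᵥ (X *ᵥ (q.tau • q.muBeta)) := by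
    simpa using dotProduct_star_self_nonneg (X *ᵥ (q.tau • q.muBeta))
  have := mul_nonneg (by positivity : 0 ≤ 1 / g) hnn
  rw [Finset.sum_sub_distrib, Finset.sum_add_distrib, Finset.sum_sub_distrib, hpen,
    ← Finset.mul_sum, hsc]
  simp only [numUncensored, Finset.sum_const, Finset.card_univ, Fintype.card_fin, nsmul_eq_mul,
    mul_one]
  linarith

/-- The ratio of the scales `√(b / a)` and `√(b / (a - 1))`. -/
noncomputable def VBState.shrink (q : VBState κ) : ℝ := Real.sqrt ((q.a - 1) / q.a)

lemma VBState.shrink_sq {q : VBState κ} (ha : 2 ≤ q.a) : q.shrink ^ 2 = 1 - 1 / q.a := by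
  rw [VBState.shrink, Real.sq_sqrt (div_nonneg (by linarith) (by linarith))]
  field_simp

lemma VBState.half_le_shrink {q : VBState κ} (ha : 2 ≤ q.a) : 1 / 2 ≤ q.shrink := by
  apply Real.le_sqrt_of_sq_le
  rw [le_div_iff₀ (by linarith)]
  linarith

lemma VBState.shrink_le_one {q : VBState κ} (ha : 2 ≤ q.a) : q.shrink ≤ 1 := by
  apply Real.sqrt_le_one.2
  rw [div_le_one (by linarith)]
  linarith

lemma VBState.one_sub_shrink_le {q : VBState κ} (ha : 2 ≤ q.a) : 1 - q.shrink ≤ 1 / q.a := by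
  nlinarith [VBState.shrink_sq ha, VBState.half_le_shrink ha, VBState.shrink_le_one ha]

lemma VBState.neg_log_shrink_le {q : VBState κ} (ha : 2 ≤ q.a) :
    -Real.log q.shrink ≤ 1 / q.a := by
  have hpos : 0 < (q.a - 1) / q.a := div_pos (by linarith) (by linarith)
  rw [VBState.shrink, Real.log_sqrt hpos.le]
  have h := Real.one_sub_inv_le_log_of_pos hpos
  have e : ((q.a - 1) / q.a)⁻¹ = 1 + 1 / (q.a - 1) := by
    have : q.a - 1 ≠ 0 := by linarith
    field_simp
    ring
  have h2 : 1 / (q.a - 1) ≤ 2 * (1 / q.a) := by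
    rw [mul_one_div, div_le_div_iff₀ (by linarith) (by linarith)]
    linarith
  rw [e] at h
  linarith

section VB
variable [Fintype κ] [DecidableEq κ] {q : VBState κ} {X : Matrix (Fin n) κ ℝ} {yL : ℝ}
  {y : Fin n → ℝ} {g : ℝ}

lemma IsVB.sigmaSqHat_eq (h : IsVB q X yL y g) (ha : 1 < q.a) :
    q.sigmaSqHat = q.b / (q.a - 1) :=
  integral_mul_invGammaPDF ha h.b_pos

lemma IsVB.sigmaSqHat_pos (h : IsVB q X yL y g) (ha : 1 < q.a) : 0 < q.sigmaSqHat := by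
  rw [h.sigmaSqHat_eq ha]; exact div_pos h.b_pos (by linarith)

lemma IsVB.inv_sqrt_sigmaSqHat (h : IsVB q X yL y g) (ha : 2 ≤ q.a) :
    (Real.sqrt q.sigmaSqHat)⁻¹ = q.shrink * q.tau := by
  rw [h.sigmaSqHat_eq (by linarith), VBState.tau, VBState.xi, VBState.shrink, ← Real.sqrt_inv,
    ← Real.sqrt_inv, ← Real.sqrt_mul (div_nonneg (by linarith) (by linarith))]
  congr 1
  have := h.b_pos.ne'
  have : q.a ≠ 0 := by linarith
  field_simp

lemma IsVB.normalCDF_sigmaSqHat (h : IsVB q X yL y g) (ha : 2 ≤ q.a) (i : Fin n) :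
    normalCDF (q.loc X i) q.sigmaSqHat yL =
      stdCDF (q.shrink * (q.tau * (yL - q.loc X i))) := by
  rw [normalCDF_eq _ (h.sigmaSqHat_pos (by linarith)), div_eq_inv_mul, h.inv_sqrt_sigmaSqHat ha,
    mul_assoc]

lemma IsVB.tobitAt_pos (h : IsVB q X yL y g) (ha : 2 ≤ q.a) (i : Fin n) :
    0 < q.tobitAt X yL y i := by
  unfold VBState.tobitAt
  split_ifs
  · exact normalPDF_pos _ (h.sigmaSqHat_pos (by linarith)) _
  · rw [h.normalCDF_sigmaSqHat ha]; exact stdCDF_pos _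

lemma log_sigmaSqHat_eq (h : IsVB q X yL y g) (ha : 2 ≤ q.a) :
    1 / 2 * Real.log q.sigmaSqHat = -Real.log (q.shrink * q.tau) := by
  rw [← h.inv_sqrt_sigmaSqHat ha, Real.log_inv, Real.log_sqrt (h.sigmaSqHat_pos (by linarith)).le]
  ring

/-- The Tobit likelihood at the variational expectations, in Olsen's parameterization. -/
lemma IsVB.log_tobitAt (h : IsVB q X yL y g) (ha : 2 ≤ q.a) (i : Fin n) :
    Real.log (q.tobitAt X yL y i) = obsLogLik yL (q.shrink * q.tau) (y i)
      (q.shrink * q.tau * q.loc X i) := by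
  unfold VBState.tobitAt obsLogLik
  have hs := h.sigmaSqHat_pos (by linarith)
  split_ifs
  · rw [log_normalPDF _ hs, log_sigmaSqHat_eq h ha]
    have : (q.shrink * q.tau) ^ 2 = (q.sigmaSqHat)⁻¹ := by
      rw [← h.inv_sqrt_sigmaSqHat ha, inv_pow, Real.sq_sqrt hs.le]
    have e : (y i - q.loc X i) ^ 2 / (2 * q.sigmaSqHat) =
        1 / 2 * ((q.sigmaSqHat)⁻¹ * (y i - q.loc X i) ^ 2) := by field_simp
    rw [e, ← this]
    ring
  · rw [h.normalCDF_sigmaSqHat ha]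
    congr 2
    ring

lemma IsVB.log_tobitLik (h : IsVB q X yL y g) (ha : 2 ≤ q.a) :
    Real.log (q.tobitLik X yL y) = logLik yL y (q.shrink * q.tau)
      (fun i => q.shrink * q.tau * q.loc X i) := by
  rw [VBState.tobitLik, Real.log_prod fun i _ => (h.tobitAt_pos ha i).ne', logLik]
  exact Finset.sum_congr rfl fun i _ => h.log_tobitAt ha i

/-- Replacing `b / a` by `b / (a - 1)` costs a bounded amount of log-likelihood. -/
lemma IsVB.le_log_tobitLik (h : IsVB q X yL y g) (ha : 2 ≤ q.a) (hn : 0 < n)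
    (hX : ∀ j, ∑ i, X i j = 0) (hdet : IsUnit (Xᵀ * X).det) (hg : 0 < g)
    (hy : ∀ i, yL ≤ y i) :
    logLik yL y q.tau (linPred X (q.tau * q.muAlpha) (q.tau • q.muBeta)) - 6 ≤
      Real.log (q.tobitLik X yL y) := by
  have hξ := h.xi_pos hn
  have hτ := VBState.tau_pos hξ
  have hc := VBState.half_le_shrink ha
  have hc1 := VBState.shrink_le_one ha
  have hsum := (h.scoreEq hn hX hdet hg hy).sum_censMoment_le hy hg
  have hterm : ∀ i, obsLogLik yL q.tau (y i) (linPred X (q.tau * q.muAlpha) (q.tau • q.muBeta) i) ≤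
      obsLogLik yL (q.shrink * q.tau) (y i) (q.shrink * q.tau * q.loc X i) +
        1 / q.a * (2 + if yL < y i then 0 else q.censMoment X yL i) := by
    intro i
    have ha' : 0 < 1 / q.a := one_div_pos.2 (by linarith)
    rw [q.linPred_tau]
    unfold obsLogLik
    split_ifs with hi
    · rw [Real.log_mul (by linarith) hτ.ne']
      have h1 := VBState.neg_log_shrink_le ha
      have h2 : (q.shrink * q.tau * y i - q.shrink * q.tau * q.loc X i) ^ 2 ≤
          (q.tau * y i - q.tau * q.loc X i) ^ 2 := by
        have : (q.shrink * q.tau * y i - q.shrink * q.tau * q.loc X i) ^ 2 =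
          q.shrink ^ 2 * (q.tau * y i - q.tau * q.loc X i) ^ 2 := by ring
        rw [this, VBState.shrink_sq ha]
        nlinarith [sq_nonneg (q.tau * y i - q.tau * q.loc X i)]
      linarith
    · have h1 := (abs_le.1 (abs_log_stdCDF_sub_le hc hc1 (q.tau * (yL - q.loc X i)))).2
      have h2 := VBState.one_sub_shrink_le ha
      have h3 := one_sub_mul_mills_nonneg (q.tau * (yL - q.loc X i))
      have h4 := mul_le_mul_of_nonneg_right h2 (by linarith :
        0 ≤ 2 + (1 - q.tau * (yL - q.loc X i) * mills (q.tau * (yL - q.loc X i))))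
      rw [← mul_sub, show q.shrink * q.tau * yL - q.shrink * q.tau * q.loc X i =
        q.shrink * (q.tau * (yL - q.loc X i)) by ring]
      unfold VBState.censMoment
      linarith
  rw [h.log_tobitLik ha, logLik, logLik]
  have hs := Finset.sum_le_sum fun i (_ : i ∈ Finset.univ) => hterm i
  rw [Finset.sum_add_distrib, ← Finset.mul_sum, Finset.sum_add_distrib] at hs
  simp only [Finset.sum_const, Finset.card_univ, Fintype.card_fin, nsmul_eq_mul] at hs
  have han : (n : ℝ) ≤ 2 * q.a := by
    rw [h.a_eq]
    have : (0 : ℝ) ≤ Fintype.card κ := by positivity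
    linarith
  have h5 : 1 / q.a * ((n : ℝ) * 2 + n) ≤ 6 := by
    rw [one_div_mul_eq_div, div_le_iff₀ (by linarith)]
    linarith
  have h6 : 1 / q.a * ((n : ℝ) * 2 + ∑ i, if yL < y i then 0 else q.censMoment X yL i) ≤
      1 / q.a * ((n : ℝ) * 2 + n) := by
    have : 0 < q.a := by linarith
    gcongr
  linarith

lemma IsVB.linkAt_eq (h : IsVB q X yL y g) (hn : 0 < n) (hy : ∀ i, yL ≤ y i) (i : Fin n) :
    q.linkAt X yL y i = 1 := by
  rw [VBState.linkAt, if_pos]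
  by_cases hi : yL < y i
  · rw [q.zHat_of_lt hi, max_eq_right hi.le]
  · rw [max_eq_left (VBState.zHat_le (h.xi_pos hn) hi)]
    exact le_antisymm (not_lt.1 hi) (hy i)

lemma IsVB.latentAt_pos (h : IsVB q X yL y g) (ha : 2 ≤ q.a) (i : Fin n) :
    0 < q.latentAt X yL y i :=
  normalPDF_pos _ (h.sigmaSqHat_pos (by linarith)) _

lemma IsVB.zFactorAt_eq (h : IsVB q X yL y g) (hn : 0 < n) {i : Fin n} (hi : ¬ yL < y i) :
    q.zFactorAt X yL y i = normalPDF (q.loc X i) q.xi (q.zHat X yL y i) /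
      stdCDF (q.tau * (yL - q.loc X i)) := by
  rw [VBState.zFactorAt, if_neg hi, truncNormalPDF, if_pos (VBState.zHat_le (h.xi_pos hn) hi),
    normalCDF_eq _ (h.xi_pos hn), div_eq_inv_mul (yL - q.loc X i), VBState.tau]

lemma IsVB.zFactorAt_pos (h : IsVB q X yL y g) (hn : 0 < n) (i : Fin n) :
    0 < q.zFactorAt X yL y i := by
  by_cases hi : yL < y i
  · simp [VBState.zFactorAt, hi]
  · rw [h.zFactorAt_eq hn hi]
    exact div_pos (normalPDF_pos _ (h.xi_pos hn) _) (stdCDF_pos _)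

lemma IsVB.obsGap_of_lt (h : IsVB q X yL y g) (hn : 0 < n) (hy : ∀ i, yL ≤ y i)
    {i : Fin n} (hi : yL < y i) : q.obsGap X yL y i = 0 := by
  rw [VBState.obsGap, h.linkAt_eq hn hy, VBState.zFactorAt, if_pos hi, VBState.tobitAt, if_pos hi,
    VBState.latentAt, q.zHat_of_lt hi]
  simp

/-- The discrepancy of a censored observation comes only from the two scales `√(b / a)` and
`√(b / (a - 1))`: with equal scales the identity is exact. -/
lemma IsVB.obsGap_of_le (h : IsVB q X yL y g) (ha : 2 ≤ q.a) (hn : 0 < n) (hy : ∀ i, yL ≤ y i)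
    {i : Fin n} (hi : ¬ yL < y i) : q.obsGap X yL y i =
      Real.log q.shrink + mills (q.tau * (yL - q.loc X i)) ^ 2 / (2 * q.a) +
        (Real.log (stdCDF (q.tau * (yL - q.loc X i))) -
          Real.log (stdCDF (q.shrink * (q.tau * (yL - q.loc X i))))) := by
  have hξ := h.xi_pos hn
  have hs := h.sigmaSqHat_pos (by linarith)
  have hτ := VBState.tau_pos hξ
  have hc := VBState.half_le_shrink ha
  rw [VBState.obsGap, h.linkAt_eq hn hy, one_mul, h.zFactorAt_eq hn hi, VBState.tobitAt, if_neg hi,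
    h.normalCDF_sigmaSqHat ha, Real.log_div (h.latentAt_pos ha i).ne'
      (div_pos (normalPDF_pos _ hξ _) (stdCDF_pos _)).ne',
    Real.log_div (normalPDF_pos _ hξ _).ne' (stdCDF_pos _).ne', VBState.latentAt,
    log_normalPDF _ hs, log_normalPDF _ hξ, log_sigmaSqHat_eq h ha,
    VBState.zHat_sub_loc hξ, VBState.res_of_le hi,
    Real.log_mul (by linarith) hτ.ne']
  have e1 : 1 / 2 * Real.log q.xi = -Real.log q.tau := by
    rw [VBState.tau, Real.log_inv, Real.log_sqrt hξ.le]; ring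
  have e2 : (Real.sqrt q.xi * -mills (q.tau * (yL - q.loc X i))) ^ 2 =
      q.xi * mills (q.tau * (yL - q.loc X i)) ^ 2 := by
    rw [mul_pow, Real.sq_sqrt hξ.le]; ring
  have e3 : q.sigmaSqHat = q.xi * (q.a / (q.a - 1)) := by
    rw [h.sigmaSqHat_eq (by linarith), VBState.xi]
    have : q.a ≠ 0 := by linarith
    field_simp
  rw [e1, e2, e3]
  have h1 : q.a - 1 ≠ 0 := by linarith
  have h2 : q.a ≠ 0 := by linarith
  have e4 : q.xi * mills (q.tau * (yL - q.loc X i)) ^ 2 / (2 * (q.xi * (q.a / (q.a - 1)))) =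
      mills (q.tau * (yL - q.loc X i)) ^ 2 / 2 -
        mills (q.tau * (yL - q.loc X i)) ^ 2 / (2 * q.a) := by
    field_simp
  have e5 : q.xi * mills (q.tau * (yL - q.loc X i)) ^ 2 / (2 * q.xi) =
      mills (q.tau * (yL - q.loc X i)) ^ 2 / 2 := by field_simp
  rw [e4, e5]
  ring

lemma IsVB.abs_obsGap_le (h : IsVB q X yL y g) (ha : 2 ≤ q.a) (hn : 0 < n) (hy : ∀ i, yL ≤ y i)
    (i : Fin n) : |q.obsGap X yL y i| ≤
      1 / q.a * (3 + 2 * if yL < y i then 0 else q.censMoment X yL i) := by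
  have ha0 : 0 < q.a := by linarith
  by_cases hi : yL < y i
  · rw [h.obsGap_of_lt hn hy hi, abs_zero, if_pos hi]
    positivity
  · rw [h.obsGap_of_le ha hn hy hi, if_neg hi]
    have hc := VBState.half_le_shrink ha
    have hc1 := VBState.shrink_le_one ha
    have h1 := VBState.neg_log_shrink_le ha
    have h1' : Real.log q.shrink ≤ 0 := Real.log_nonpos (by linarith) hc1
    have h2 := abs_log_stdCDF_sub_le hc hc1 (q.tau * (yL - q.loc X i))
    have h3 := one_sub_mul_mills_nonneg (q.tau * (yL - q.loc X i))
    have h4 := mul_le_mul_of_nonneg_right (VBState.one_sub_shrink_le ha) (by linarith :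
        0 ≤ 2 + (1 - q.tau * (yL - q.loc X i) * mills (q.tau * (yL - q.loc X i))))
    have h5 := mills_sq_add_le (q.tau * (yL - q.loc X i))
    have h6 : mills (q.tau * (yL - q.loc X i)) ^ 2 / (2 * q.a) ≤ 1 / q.a * (1 -
        q.tau * (yL - q.loc X i) * mills (q.tau * (yL - q.loc X i))) := by
      rw [one_div_mul_eq_div, div_le_div_iff₀ (by positivity) ha0]
      nlinarith
    have h7 : 0 ≤ mills (q.tau * (yL - q.loc X i)) ^ 2 / (2 * q.a) := by positivity
    have h8 : 0 < 1 / q.a := by positivity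
    have h9 := abs_le.1 h2
    have h10 : 0 ≤ 1 / q.a * (1 -
        q.tau * (yL - q.loc X i) * mills (q.tau * (yL - q.loc X i))) := by positivity
    unfold VBState.censMoment
    rw [abs_le]
    constructor <;> linarith

lemma IsVB.gap_eq_sum (h : IsVB q X yL y g) (ha : 2 ≤ q.a) (hn : 0 < n) (hy : ∀ i, yL ≤ y i) :
    q.gap X yL y = ∑ i, q.obsGap X yL y i := by
  rw [VBState.gap, VBState.tobitLik, Real.log_prod fun i _ => (h.tobitAt_pos ha i).ne',
    ← Finset.prod_mul_distrib, ← Finset.prod_div_distrib, Real.log_prod, ← Finset.sum_sub_distrib]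
  · rfl
  · intro i _
    rw [h.linkAt_eq hn hy, one_mul]
    exact (div_pos (h.latentAt_pos ha i) (h.zFactorAt_pos hn i)).ne'

/-- The plug-in identity for the latent responses holds up to a universal constant. -/
lemma IsVB.abs_gap_le (h : IsVB q X yL y g) (ha : 2 ≤ q.a) (hn : 0 < n)
    (hX : ∀ j, ∑ i, X i j = 0) (hdet : IsUnit (Xᵀ * X).det) (hg : 0 < g)
    (hy : ∀ i, yL ≤ y i) : |q.gap X yL y| ≤ 10 := by
  have hsum := (h.scoreEq hn hX hdet hg hy).sum_censMoment_le hy hg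
  have ha0 : 0 < q.a := by linarith
  rw [h.gap_eq_sum ha hn hy]
  refine (Finset.abs_sum_le_sum_abs _ _).trans
    ((Finset.sum_le_sum fun i _ => h.abs_obsGap_le ha hn hy i).trans ?_)
  rw [← Finset.mul_sum, Finset.sum_add_distrib, ← Finset.mul_sum]
  simp only [Finset.sum_const, Finset.card_univ, Fintype.card_fin, nsmul_eq_mul]
  have han : (n : ℝ) ≤ 2 * q.a := by
    rw [h.a_eq]
    have : (0 : ℝ) ≤ Fintype.card κ := by positivity
    linarith
  rw [one_div_mul_eq_div, div_le_iff₀ ha0]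
  linarith

end VB

end TobitVB

/-! ### The BIC form of the criterion -/

namespace TobitVB

variable {n : ℕ} {κ : Type*} [Fintype κ] [DecidableEq κ] {q : VBState κ}
  {X : Matrix (Fin n) κ ℝ} {yL : ℝ} {y : Fin n → ℝ} {g : ℝ}

lemma log_mvNormalPDF_smul (m x : κ → ℝ) {S : Matrix κ κ ℝ} (hS : 0 < S.det) {c : ℝ}
    (hc : 0 < c) :
    Real.log (mvNormalPDF m (c • S) x) =
      -(1 / 2) * (Fintype.card κ * Real.log (2 * Real.pi) + Fintype.card κ * Real.log c +
        Real.log S.det) - 1 / (2 * c) * ((x - m) ⬝ᵥ (S⁻¹ *ᵥ (x - m))) := by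
  have hp : 0 < 2 * Real.pi := by positivity
  have : Invertible c := invertibleOfNonzero hc.ne'
  have hinv : (c • S)⁻¹ = c⁻¹ • S⁻¹ := by
    rw [Matrix.inv_smul S c (isUnit_iff_ne_zero.2 hS.ne'), invOf_eq_inv]
  rw [mvNormalPDF, det_smul, hinv, smul_mulVec, dotProduct_smul, smul_eq_mul,
    Real.log_mul (by positivity) (Real.exp_pos _).ne', Real.log_inv, Real.log_exp,
    Real.log_sqrt (by positivity), Real.log_mul (by positivity) (by positivity),
    Real.log_mul (by positivity) hS.ne', Real.log_pow, Real.log_pow]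
  field_simp
  ring

lemma mvNormalPDF_pos (m x : κ → ℝ) {S : Matrix κ κ ℝ} (hS : 0 < S.det) :
    0 < mvNormalPDF m S x := by
  unfold mvNormalPDF
  positivity

lemma log_invGammaPDF {a b x : ℝ} (ha : 0 < a) (hb : 0 < b) (hx : 0 < x) :
    Real.log (invGammaPDF a b x) =
      a * Real.log b - Real.log (Real.Gamma a) - (a + 1) * Real.log x - b / x := by
  have h1 := Real.rpow_pos_of_pos hb a
  have h2 := Real.Gamma_pos_of_pos ha
  have h3 := Real.rpow_pos_of_pos hx (-a - 1)
  rw [invGammaPDF, Real.log_mul (by positivity) (Real.exp_pos _).ne',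
    Real.log_mul (by positivity) h3.ne', Real.log_div h1.ne' h2.ne', Real.log_exp,
    Real.log_rpow hb, Real.log_rpow hx]
  ring

lemma invGammaPDF_pos {a b x : ℝ} (ha : 0 < a) (hb : 0 < b) (hx : 0 < x) :
    0 < invGammaPDF a b x := by
  have h1 := Real.rpow_pos_of_pos hb a
  have h2 := Real.Gamma_pos_of_pos ha
  have h3 := Real.rpow_pos_of_pos hx (-a - 1)
  unfold invGammaPDF
  positivity

lemma IsVB.priorAt_pos (h : IsVB q X yL y g) (ha : 2 ≤ q.a) (hg : 0 < g)
    (hdet : 0 < (Xᵀ * X).det) : 0 < q.priorAt X g := by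
  have hs := h.sigmaSqHat_pos (by linarith)
  refine mul_pos (by positivity) (mvNormalPDF_pos _ _ ?_)
  rw [det_smul, det_nonsing_inv, Ring.inverse_eq_inv']
  positivity

lemma IsVB.thetaFactorAt_pos (h : IsVB q X yL y g) (ha : 2 ≤ q.a) (hg : 0 < g) (hn : 0 < n)
    (hdet : 0 < (Xᵀ * X).det) : 0 < q.thetaFactorAt := by
  have hs := h.sigmaSqHat_pos (by linarith)
  have ha0 : 0 < q.a := by linarith
  have hb := h.b_pos
  refine mul_pos (mul_pos (normalPDF_pos _ ?_ _) (mvNormalPDF_pos _ _ ?_))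
    (invGammaPDF_pos ha0 hb hs)
  · rw [h.omegaAlpha_eq]
    positivity
  · rw [h.OmegaBeta_eq, det_smul, det_nonsing_inv, Ring.inverse_eq_inv']
    positivity

lemma IsVB.log_pVBC (h : IsVB q X yL y g) (ha : 2 ≤ q.a) (hg : 0 < g) (hn : 0 < n)
    (hdet : 0 < (Xᵀ * X).det) (hy : ∀ i, yL ≤ y i) :
    Real.log (q.pVBC X yL y g) = q.gap X yL y + Real.log (q.tobitLik X yL y) +
      (Real.log (q.priorAt X g) - Real.log q.thetaFactorAt) := by
  have h1 : 0 < (∏ i, q.linkAt X yL y i) * (∏ i, q.latentAt X yL y i) := by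
    refine mul_pos (Finset.prod_pos fun i _ => ?_) (Finset.prod_pos fun i _ => h.latentAt_pos ha i)
    rw [h.linkAt_eq hn hy]; exact one_pos
  have h2 : 0 < ∏ i, q.zFactorAt X yL y i := Finset.prod_pos fun i _ => h.zFactorAt_pos hn i
  have h3 := h.priorAt_pos ha hg hdet
  have h4 := h.thetaFactorAt_pos ha hg hn hdet
  rw [VBState.pVBC, VBState.gap, Real.log_div (by positivity) (by positivity),
    Real.log_mul h1.ne' h3.ne', Real.log_mul h2.ne' h4.ne', Real.log_div h1.ne' h2.ne']
  ring

/-- The prior and variational densities of the parameters at the variational expectations: after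
the terms of order `n` cancel, only Stirling's remainder and bounded terms stay next to the
dimension penalty. -/
lemma IsVB.log_priorAt_sub (h : IsVB q X yL y g) (ha : 2 ≤ q.a) (hg : 0 < g) (hn : 0 < n)
    (hdet : 0 < (Xᵀ * X).det) :
    Real.log (q.priorAt X g) - Real.log q.thetaFactorAt =
      -(1 / 2) * Fintype.card κ * (Real.log (1 + g) - 2 * Real.log q.shrink)
      - 1 / (2 * (g * q.sigmaSqHat)) * ((X *ᵥ q.muBeta) ⬝ᵥ (X *ᵥ q.muBeta))
      + 1 / 2 * Real.log (2 * Real.pi) + 1 / 2 * Real.log q.xi - 1 / 2 * Real.log n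
      - 1 / 2 * Real.log q.a + stirlingRem q.a - 2 * q.a * Real.log q.shrink - 1 := by
  have hs := h.sigmaSqHat_pos (by linarith)
  have ha0 : 0 < q.a := by linarith
  have hb := h.b_pos
  have hξ := h.xi_pos hn
  have hn' : (0 : ℝ) < n := by positivity
  have hc : 0 < q.shrink := by linarith [VBState.half_le_shrink ha]
  have hS : 0 < ((Xᵀ * X)⁻¹).det := by
    rw [det_nonsing_inv, Ring.inverse_eq_inv']; positivity
  have hSS : ((Xᵀ * X)⁻¹)⁻¹ = Xᵀ * X := nonsing_inv_nonsing_inv _ (isUnit_iff_ne_zero.2 hdet.ne')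
  have h1g : 0 < 1 + g := by positivity
  have hω : q.omegaAlpha = q.xi / n := by rw [h.omegaAlpha_eq, VBState.xi]; field_simp
  have hω0 : 0 < q.omegaAlpha := by rw [hω]; positivity
  have hΩc : 0 < g / (1 + g) * (q.b / q.a) := by positivity
  have hls : Real.log q.sigmaSqHat = Real.log q.xi - 2 * Real.log q.shrink := by
    have h1 := log_sigmaSqHat_eq h ha
    rw [Real.log_mul hc.ne' (VBState.tau_pos hξ).ne', VBState.tau, Real.log_inv,
      Real.log_sqrt hξ.le] at h1
    linarith
  have hlb : Real.log q.b = Real.log q.xi + Real.log q.a := by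
    rw [VBState.xi, Real.log_div hb.ne' ha0.ne']; ring
  have hlω : Real.log q.omegaAlpha = Real.log q.xi - Real.log n := by
    rw [hω, Real.log_div hξ.ne' hn'.ne']
  have hbs : q.b / q.sigmaSqHat = q.a - 1 := by
    rw [h.sigmaSqHat_eq (by linarith)]
    have : q.a - 1 ≠ 0 := by linarith
    field_simp
  have hpr : Real.log (q.priorAt X g) = -Real.log q.sigmaSqHat +
      Real.log (mvNormalPDF 0 ((g * q.sigmaSqHat) • (Xᵀ * X)⁻¹) q.muBeta) := by
    rw [VBState.priorAt, Real.log_mul (by positivity)]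
    · simp
    · refine (mvNormalPDF_pos _ _ ?_).ne'
      rw [det_smul]; positivity
  have hth : Real.log q.thetaFactorAt = Real.log (normalPDF q.muAlpha q.omegaAlpha q.muAlpha) +
      Real.log (mvNormalPDF q.muBeta q.OmegaBeta q.muBeta) +
      Real.log (invGammaPDF q.a q.b q.sigmaSqHat) := by
    have hd : 0 < q.OmegaBeta.det := by rw [h.OmegaBeta_eq, det_smul]; positivity
    rw [VBState.thetaFactorAt, Real.log_mul (mul_pos (normalPDF_pos _ hω0 _)
      (mvNormalPDF_pos _ _ hd)).ne' (invGammaPDF_pos ha0 hb hs).ne',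
      Real.log_mul (normalPDF_pos _ hω0 _).ne' (mvNormalPDF_pos _ _ hd).ne']
  have hlΩ : Real.log (g / (1 + g) * (q.b / q.a)) =
      Real.log g - Real.log (1 + g) + Real.log q.xi := by
    rw [Real.log_mul (by positivity) (by positivity), Real.log_div hg.ne' h1g.ne', VBState.xi]
  rw [hpr, hth, h.OmegaBeta_eq, log_mvNormalPDF_smul _ _ hS (by positivity),
    log_mvNormalPDF_smul _ _ hS hΩc, log_normalPDF _ hω0, log_invGammaPDF ha0 hb hs, hSS,
    sub_zero, dotProduct_gram_mulVec, hlΩ, hlω, hbs, hlb, Real.log_mul hg.ne' hs.ne', hls,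
    stirlingRem]
  simp only [sub_self, mulVec_zero, dotProduct_zero, mul_zero]
  ring

/-- The BIC form of the criterion, with an explicit remainder. -/
lemma IsVB.abs_log_pVBC_sub_le {q : VBState κ} (h : IsVB q X yL y n) (hn : 4 ≤ n)
    (hκ : Fintype.card κ ≤ n)
    (hX : ∀ j, ∑ i, X i j = 0) (hdet : 0 < (Xᵀ * X).det) (hy : ∀ i, yL ≤ y i) :
    |Real.log (q.pVBC X yL y n) - (Real.log (q.tobitLik X yL y) -
      ((Fintype.card κ : ℝ) + 2) / 2 * Real.log n)| ≤
      22 + 2 * Fintype.card κ + 1 / 2 * |Real.log q.xi| +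
        1 / n * (q.tau ^ 2 * ((X *ᵥ q.muBeta) ⬝ᵥ (X *ᵥ q.muBeta))) := by
  have hn0 : 0 < n := by omega
  have hn4 : (4 : ℝ) ≤ n := by exact_mod_cast hn
  have hg : (0 : ℝ) < n := by positivity
  have ha : 2 ≤ q.a := by
    rw [h.a_eq]
    have : (0 : ℝ) ≤ Fintype.card κ := by positivity
    linarith
  have ha0 : 0 < q.a := by linarith
  have hκ' : (Fintype.card κ : ℝ) ≤ n := by exact_mod_cast hκ
  have hξ := h.xi_pos hn0
  have hs := h.sigmaSqHat_pos (by linarith)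
  have hgap := h.abs_gap_le ha hn0 hX (isUnit_iff_ne_zero.2 hdet.ne') hg hy
  have hlsh := VBState.neg_log_shrink_le ha
  have hlsh' : Real.log q.shrink ≤ 0 :=
    Real.log_nonpos (by linarith [VBState.half_le_shrink ha]) (VBState.shrink_le_one ha)
  have hst : |stirlingRem q.a| ≤ 5 := by
    rw [h.a_eq]
    have := abs_stirlingRem_half_le (n + Fintype.card κ) (by omega)
    push_cast at this
    exact this
  have hinv : 1 / q.a ≤ 1 / 2 := one_div_le_one_div_of_le (by norm_num) ha
  have h1 : 0 ≤ -(2 * q.a * Real.log q.shrink) := by nlinarith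
  have h1' : -(2 * q.a * Real.log q.shrink) ≤ 2 := by
    have : q.a * (-Real.log q.shrink) ≤ q.a * (1 / q.a) := by gcongr
    rw [mul_one_div, div_self ha0.ne'] at this
    linarith
  have hl2 : Real.log 2 ≤ 1 := by
    have := Real.log_le_sub_one_of_pos (show (0 : ℝ) < 2 by norm_num); linarith
  have h2 : Real.log q.a ≤ Real.log n := Real.log_le_log ha0 (by rw [h.a_eq]; linarith)
  have h2' : Real.log n - 1 ≤ Real.log q.a := by
    have : Real.log (n / 2) ≤ Real.log q.a := Real.log_le_log (by positivity) (by
      rw [h.a_eq]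
      have : (0 : ℝ) ≤ Fintype.card κ := by positivity
      linarith)
    rw [Real.log_div hg.ne' (by norm_num)] at this
    linarith
  have h3 : Real.log n ≤ Real.log (1 + n) := Real.log_le_log hg (by linarith)
  have h3' : Real.log (1 + n) ≤ Real.log n + 1 := by
    have : Real.log (1 + n) ≤ Real.log (n * 2) := Real.log_le_log (by positivity) (by linarith)
    rw [Real.log_mul hg.ne' (by norm_num)] at this
    linarith
  have hpi : 0 ≤ Real.log (2 * Real.pi) := Real.log_nonneg (by nlinarith [Real.pi_gt_three])
  have hpi' : Real.log (2 * Real.pi) ≤ 7 := by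
    have := Real.log_le_sub_one_of_pos (show 0 < 2 * Real.pi by positivity)
    linarith [Real.pi_lt_four]
  have hQ : 0 ≤ (X *ᵥ q.muBeta) ⬝ᵥ (X *ᵥ q.muBeta) := by
    simpa using dotProduct_star_self_nonneg (X *ᵥ q.muBeta)
  have hτs : 1 / q.sigmaSqHat ≤ q.tau ^ 2 := by
    have e : q.tau ^ 2 = 1 / q.xi := by
      rw [eq_div_iff hξ.ne', VBState.tau_sq_mul_xi hξ]
    rw [e]
    refine one_div_le_one_div_of_le hξ ?_
    rw [h.sigmaSqHat_eq (by linarith), VBState.xi]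
    exact div_le_div_of_nonneg_left h.b_pos.le (by linarith) (by linarith)
  have h4 : 0 ≤ 1 / (2 * (n * q.sigmaSqHat)) * ((X *ᵥ q.muBeta) ⬝ᵥ (X *ᵥ q.muBeta)) := by
    positivity
  have h4' : 1 / (2 * (n * q.sigmaSqHat)) * ((X *ᵥ q.muBeta) ⬝ᵥ (X *ᵥ q.muBeta)) ≤
      1 / n * (q.tau ^ 2 * ((X *ᵥ q.muBeta) ⬝ᵥ (X *ᵥ q.muBeta))) := by
    have : 1 / (2 * (n * q.sigmaSqHat)) * ((X *ᵥ q.muBeta) ⬝ᵥ (X *ᵥ q.muBeta)) =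
        1 / 2 * (1 / n * (1 / q.sigmaSqHat * ((X *ᵥ q.muBeta) ⬝ᵥ (X *ᵥ q.muBeta)))) := by
      field_simp
    rw [this]
    have h5 : 1 / (n : ℝ) * (1 / q.sigmaSqHat * ((X *ᵥ q.muBeta) ⬝ᵥ (X *ᵥ q.muBeta))) ≤
        1 / n * (q.tau ^ 2 * ((X *ᵥ q.muBeta) ⬝ᵥ (X *ᵥ q.muBeta))) := by gcongr
    have h6 : 0 ≤ 1 / (n : ℝ) * (1 / q.sigmaSqHat * ((X *ᵥ q.muBeta) ⬝ᵥ (X *ᵥ q.muBeta))) := by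
      positivity
    linarith
  have h7 : 0 ≤ (Fintype.card κ : ℝ) *
      (Real.log (1 + n) - 2 * Real.log q.shrink - Real.log n) := by
    apply mul_nonneg (by positivity); linarith
  have h7' : (Fintype.card κ : ℝ) * (Real.log (1 + n) - 2 * Real.log q.shrink - Real.log n) ≤
      Fintype.card κ * 2 := by
    apply mul_le_mul_of_nonneg_left _ (by positivity); linarith
  rw [h.log_pVBC ha hg hn0 hdet hy, h.log_priorAt_sub ha hg hn0 hdet]
  have hg' := abs_le.1 hgap
  have hst' := abs_le.1 hst
  have hξ' := abs_le.1 (le_refl |Real.log q.xi|)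
  have hD : (0 : ℝ) ≤ Fintype.card κ := by positivity
  rw [abs_le]
  constructor <;> nlinarith

end TobitVB

/-! ### Likelihood expansion around the true parameters -/

namespace TobitVB

variable {p : ℕ}

/-- Truncation point of the standardized error of observation `i`. -/
noncomputable def threshold (w : ℕ → Fin p → ℝ) (yL α₀ σ₀ : ℝ) (β₀ : Fin p → ℝ) (i : ℕ) : ℝ :=
  (yL - α₀ - w i ⬝ᵥ β₀) / σ₀

/-- Left-censored responses with standardized errors `e`. -/
noncomputable def censResp (w : ℕ → Fin p → ℝ) (yL α₀ σ₀ : ℝ) (β₀ : Fin p → ℝ) (e : ℕ → ℝ) (n : ℕ)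
    (i : Fin n) : ℝ :=
  max yL (α₀ + w i ⬝ᵥ β₀ + σ₀ * e i)

/-- The sample properties on which all deterministic arguments rest: curvature of the
log-likelihood from the uncensored terms, control of the score at the true parameters, and
bounded mean squares of the errors. The errors `e` are standardized, and the scores are those
with respect to the intercept, the slopes and the inverse scale. -/
structure GoodSample (w : ℕ → Fin p → ℝ) (yL α₀ σ₀ : ℝ) (β₀ : Fin p → ℝ) (e : ℕ → ℝ) (n : ℕ)
    (c B D : ℝ) : Prop where
  curvature : ∀ (s a : ℝ) (b : Fin p → ℝ), c * n * (s ^ 2 + a ^ 2 + b ⬝ᵥ b) ≤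
    ∑ i : Fin n, if threshold w yL α₀ σ₀ β₀ i < e i then (s * e i - a - w i ⬝ᵥ b) ^ 2 else 0
  scoreIntercept : (∑ i : Fin n, censorProj (fun x => x) (threshold w yL α₀ σ₀ β₀ i) (e i)) ^ 2 ≤ D
  scoreSlope : ∀ j, (∑ i : Fin n,
    censorProj (fun x => x) (threshold w yL α₀ σ₀ β₀ i) (e i) * w i j) ^ 2 ≤ D
  scoreScale : (∑ i : Fin n,
    censorProj (fun x => 1 - x ^ 2) (threshold w yL α₀ σ₀ β₀ i) (e i)) ^ 2 ≤ D
  errors : ∑ i : Fin n, e i ^ 2 ≤ B * n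

section
variable {w : ℕ → Fin p → ℝ} {yL α₀ σ₀ : ℝ} {β₀ : Fin p → ℝ} {e : ℕ → ℝ} {n : ℕ} {c B D : ℝ}

lemma yL_le_censResp (i : Fin n) : yL ≤ censResp w yL α₀ σ₀ β₀ e n i := le_max_left _ _

lemma yL_lt_censResp_iff (hσ : 0 < σ₀) (i : Fin n) :
    yL < censResp w yL α₀ σ₀ β₀ e n i ↔ threshold w yL α₀ σ₀ β₀ i < e i := by
  rw [censResp, lt_max_iff, threshold, div_lt_iff₀ hσ]
  constructor
  · rintro (h | h)
    · exact absurd h (lt_irrefl _)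
    · linarith
  · intro h; right; linarith

lemma censResp_of_lt {i : Fin n}
    (h : yL < censResp w yL α₀ σ₀ β₀ e n i) :
    censResp w yL α₀ σ₀ β₀ e n i = α₀ + w i ⬝ᵥ β₀ + σ₀ * e i := by
  rw [censResp, lt_max_iff] at h
  rcases h with h | h
  · exact absurd h (lt_irrefl _)
  · exact max_eq_right h.le

lemma censResp_of_not_lt {i : Fin n} (h : ¬ yL < censResp w yL α₀ σ₀ β₀ e n i) :
    censResp w yL α₀ σ₀ β₀ e n i = yL :=
  le_antisymm (not_lt.1 h) (yL_le_censResp i)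

lemma censorProj_id_of_not_lt {u x : ℝ} (h : ¬ u < x) :
    censorProj (fun x => x) u x = -mills u := by
  rw [censorProj, if_neg h, setIntegral_id_stdGaussian, neg_div, mills]

lemma censorProj_one_sub_sq_of_not_lt {u x : ℝ} (h : ¬ u < x) :
    censorProj (fun x => 1 - x ^ 2) u x = u * mills u := by
  rw [censorProj, if_neg h, integral_sub (integrable_const _)
    (integrable_pow_gaussian 2).integrableOn, setIntegral_const_stdGaussian,
    setIntegral_sq_stdGaussian, mills]
  ring

/-- The log-likelihood at the true parameters. -/
noncomputable def trueLogLik (w : ℕ → Fin p → ℝ) (yL α₀ σ₀ : ℝ) (β₀ : Fin p → ℝ) (e : ℕ → ℝ)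
    (n : ℕ) : ℝ :=
  logLik yL (censResp w yL α₀ σ₀ β₀ e n) σ₀⁻¹ (fun i => σ₀⁻¹ * (α₀ + w i ⬝ᵥ β₀))

lemma GoodSample.numUncensored_ge (h : GoodSample w yL α₀ σ₀ β₀ e n c B D) (hσ : 0 < σ₀) :
    c * n ≤ numUncensored yL (censResp w yL α₀ σ₀ β₀ e n) := by
  have := h.curvature 0 1 0
  simp only [zero_mul, dotProduct_zero, zero_sub, sub_zero] at this
  simp only [numUncensored, yL_lt_censResp_iff hσ]
  simpa using this

/-- Quadratic upper bound of the log-likelihood around the true parameters. The predictor is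
written as a deviation `(a, b)` from the true one, rescaled by `τ`. -/
lemma logLik_le_true (hσ : 0 < σ₀) {τ : ℝ} (hτ : 0 < τ) (a : ℝ) (b : Fin p → ℝ)
    {f : Fin n → ℝ} (hf : ∀ i : Fin n, f i = τ * (α₀ + w i ⬝ᵥ β₀) + a + w i ⬝ᵥ b) :
    logLik yL (censResp w yL α₀ σ₀ β₀ e n) τ f ≤ trueLogLik w yL α₀ σ₀ β₀ e n +
      (τ * σ₀ - 1) * (∑ i : Fin n,
        censorProj (fun x => 1 - x ^ 2) (threshold w yL α₀ σ₀ β₀ i) (e i)) +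
      a * (∑ i : Fin n, censorProj (fun x => x) (threshold w yL α₀ σ₀ β₀ i) (e i)) +
      ∑ j, b j * (∑ i : Fin n,
        censorProj (fun x => x) (threshold w yL α₀ σ₀ β₀ i) (e i) * w i j) +
      numUncensored yL (censResp w yL α₀ σ₀ β₀ e n) * (Real.log (τ * σ₀) - (τ * σ₀ - 1)) -
      1 / 2 * ∑ i : Fin n, (if threshold w yL α₀ σ₀ β₀ i < e i then
        ((τ * σ₀ - 1) * e i - a - w i ⬝ᵥ b) ^ 2 else 0) := by
  have h := logLik_le (yL := yL) (y := censResp w yL α₀ σ₀ β₀ e n) yL_le_censResp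
    (inv_pos.2 hσ) hτ (fun i => σ₀⁻¹ * (α₀ + w i ⬝ᵥ β₀)) f
  have e1 : ∀ i : Fin n, genResid yL σ₀⁻¹ (censResp w yL α₀ σ₀ β₀ e n i)
      (σ₀⁻¹ * (α₀ + w i ⬝ᵥ β₀)) * ((f i - σ₀⁻¹ * (α₀ + w i ⬝ᵥ β₀)) -
        (τ - σ₀⁻¹) * censResp w yL α₀ σ₀ β₀ e n i) =
      (τ * σ₀ - 1) * censorProj (fun x => 1 - x ^ 2) (threshold w yL α₀ σ₀ β₀ i) (e i) +
      a * censorProj (fun x => x) (threshold w yL α₀ σ₀ β₀ i) (e i) +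
      ∑ j, b j * (censorProj (fun x => x) (threshold w yL α₀ σ₀ β₀ i) (e i) * w i j) -
      (τ * σ₀ - 1) * (if yL < censResp w yL α₀ σ₀ β₀ e n i then 1 else 0) := by
    intro i
    have hb : ∑ j, b j * (censorProj (fun x => x) (threshold w yL α₀ σ₀ β₀ i) (e i) * w i j) =
        censorProj (fun x => x) (threshold w yL α₀ σ₀ β₀ i) (e i) * (w i ⬝ᵥ b) := by
      rw [dotProduct, Finset.mul_sum]
      exact Finset.sum_congr rfl fun j _ => by ring
    rw [hb, hf, genResid]
    by_cases hi : yL < censResp w yL α₀ σ₀ β₀ e n i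
    · have hi' := (yL_lt_censResp_iff hσ i).1 hi
      rw [if_pos hi, if_pos hi, censResp_of_lt hi, censorProj, if_pos hi', censorProj, if_pos hi']
      field_simp
      ring
    · have hi' := fun h => hi ((yL_lt_censResp_iff hσ i).2 h)
      rw [if_neg hi, if_neg hi, censResp_of_not_lt hi, censorProj_id_of_not_lt hi',
        censorProj_one_sub_sq_of_not_lt hi', ← mul_sub]
      have ht : σ₀⁻¹ * (yL - (α₀ + w i ⬝ᵥ β₀)) = threshold w yL α₀ σ₀ β₀ i := by
        rw [threshold]; field_simp; ring
      have ht' : yL = α₀ + w i ⬝ᵥ β₀ + σ₀ * threshold w yL α₀ σ₀ β₀ i := by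
        rw [← ht]; field_simp; ring
      rw [ht]
      nth_rewrite 2 [ht']
      field_simp
      ring
  have e2 : ∀ i : Fin n, (if yL < censResp w yL α₀ σ₀ β₀ e n i then
      ((τ - σ₀⁻¹) * censResp w yL α₀ σ₀ β₀ e n i -
        (f i - σ₀⁻¹ * (α₀ + w i ⬝ᵥ β₀))) ^ 2 else 0) =
      if threshold w yL α₀ σ₀ β₀ i < e i then
        ((τ * σ₀ - 1) * e i - a - w i ⬝ᵥ b) ^ 2 else 0 := by
    intro i
    simp only [← yL_lt_censResp_iff (n := n) hσ i]
    by_cases hi : yL < censResp w yL α₀ σ₀ β₀ e n i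
    · rw [if_pos hi, if_pos hi, censResp_of_lt hi, hf]
      congr 1
      field_simp
      ring
    · rw [if_neg hi, if_neg hi]
  rw [Finset.sum_congr rfl fun i _ => e1 i, Finset.sum_congr rfl fun i _ => e2 i,
    Finset.sum_sub_distrib, Finset.sum_add_distrib, Finset.sum_add_distrib, ← Finset.mul_sum,
    ← Finset.mul_sum, ← Finset.mul_sum, Finset.sum_comm, div_inv_eq_mul] at h
  simp only [← Finset.mul_sum] at h
  change _ ≤ trueLogLik w yL α₀ σ₀ β₀ e n + _ + _ - _ at h
  have hnum : ∑ i : Fin n, (if yL < censResp w yL α₀ σ₀ β₀ e n i then (1 : ℝ) else 0) =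
    numUncensored yL (censResp w yL α₀ σ₀ β₀ e n) := rfl
  rw [hnum] at h
  linarith

lemma mul_le_of_sq_le {m x S D : ℝ} (hm : 0 < m) (hS : S ^ 2 ≤ D) :
    x * S ≤ m / 4 * x ^ 2 + D / m := by
  have h1 : x * S ≤ m / 4 * x ^ 2 + S ^ 2 / m := by
    have : 0 ≤ (m / 2 * x - S) ^ 2 / m := by positivity
    have e : (m / 2 * x - S) ^ 2 / m = m / 4 * x ^ 2 + S ^ 2 / m - x * S := by
      field_simp; ring
    linarith
  have : S ^ 2 / m ≤ D / m := by gcongr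
  linarith

/-- On a good sample the log-likelihood decreases quadratically away from the truth. -/
lemma GoodSample.logLik_le (h : GoodSample w yL α₀ σ₀ β₀ e n c B D) (hσ : 0 < σ₀) (hc : 0 < c)
    (hn : 0 < n) {τ : ℝ} (hτ : 0 < τ) (a : ℝ) (b : Fin p → ℝ)
    {f : Fin n → ℝ} (hf : ∀ i : Fin n, f i = τ * (α₀ + w i ⬝ᵥ β₀) + a + w i ⬝ᵥ b) :
    logLik yL (censResp w yL α₀ σ₀ β₀ e n) τ f ≤ trueLogLik w yL α₀ σ₀ β₀ e n +
      (p + 2) * (D / (c * n)) - c * n / 4 * ((τ * σ₀ - 1) ^ 2 + a ^ 2 + b ⬝ᵥ b) +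
      numUncensored yL (censResp w yL α₀ σ₀ β₀ e n) * (Real.log (τ * σ₀) - (τ * σ₀ - 1)) := by
  have hcn : 0 < c * n := by positivity
  have h1 := logLik_le_true (yL := yL) (e := e) hσ hτ a b hf
  have h2 := h.curvature (τ * σ₀ - 1) a b
  have h3 := mul_le_of_sq_le (x := τ * σ₀ - 1) hcn h.scoreScale
  have h4 := mul_le_of_sq_le (x := a) hcn h.scoreIntercept
  have h5 := Finset.sum_le_sum fun j (_ : j ∈ Finset.univ) =>
    mul_le_of_sq_le (x := b j) hcn (h.scoreSlope j)
  rw [Finset.sum_add_distrib, ← Finset.mul_sum] at h5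
  simp only [Finset.sum_const, Finset.card_univ, Fintype.card_fin, nsmul_eq_mul] at h5
  have hbb : ∑ j, b j ^ 2 = b ⬝ᵥ b := by
    rw [dotProduct]; exact Finset.sum_congr rfl fun j _ => by ring
  rw [hbb] at h5
  nlinarith

lemma trueLogLik_le :
    trueLogLik w yL α₀ σ₀ β₀ e n ≤ |Real.log σ₀| * n := by
  have hterm : ∀ i : Fin n, obsLogLik yL σ₀⁻¹ (censResp w yL α₀ σ₀ β₀ e n i)
      (σ₀⁻¹ * (α₀ + w i ⬝ᵥ β₀)) ≤ |Real.log σ₀| := by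
    intro i
    unfold obsLogLik
    have hpi : 0 ≤ Real.log (2 * Real.pi) := Real.log_nonneg (by nlinarith [Real.pi_gt_three])
    split_ifs
    · rw [Real.log_inv]
      have := neg_abs_le (Real.log σ₀)
      nlinarith [sq_nonneg (σ₀⁻¹ * censResp w yL α₀ σ₀ β₀ e n i - σ₀⁻¹ * (α₀ + w i ⬝ᵥ β₀))]
    · exact (log_stdCDF_nonpos _).trans (abs_nonneg _)
  unfold trueLogLik logLik
  refine (Finset.sum_le_sum fun i _ => hterm i).trans ?_
  simp [mul_comm]

/-- Cauchy–Schwarz for the regressors. -/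
lemma dotProduct_sq_le (x b : Fin p → ℝ) : (x ⬝ᵥ b) ^ 2 ≤ (∑ j, x j ^ 2) * (b ⬝ᵥ b) := by
  have := Finset.sum_mul_sq_le_sq_mul_sq Finset.univ x b
  simpa [dotProduct, sq] using this

lemma sum_dotProduct_sq_le (hw : ∀ j, ∑ i : Fin n, w i j ^ 2 ≤ B * n) (b : Fin p → ℝ) :
    ∑ i : Fin n, (w i ⬝ᵥ b) ^ 2 ≤ p * B * n * (b ⬝ᵥ b) := by
  have hbb : 0 ≤ b ⬝ᵥ b := by simpa using dotProduct_star_self_nonneg b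
  calc ∑ i : Fin n, (w i ⬝ᵥ b) ^ 2 ≤ ∑ i : Fin n, (∑ j, w i j ^ 2) * (b ⬝ᵥ b) :=
        Finset.sum_le_sum fun i _ => dotProduct_sq_le _ _
    _ = (∑ j, ∑ i : Fin n, w i j ^ 2) * (b ⬝ᵥ b) := by
        rw [← Finset.sum_mul, Finset.sum_comm]
    _ ≤ (∑ _j : Fin p, B * n) * (b ⬝ᵥ b) := by
        gcongr with j; exact hw j
    _ = p * B * n * (b ⬝ᵥ b) := by
        rw [Finset.sum_const, Finset.card_univ, Fintype.card_fin, nsmul_eq_mul]; ring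

/-- Lower bound, per observation, of the log-likelihood at zero predictor. -/
noncomputable def nullBound (p : ℕ) (yL α₀ σ₀ : ℝ) (β₀ : Fin p → ℝ) (B : ℝ) : ℝ :=
  |Real.log σ₀| + 1 / 2 * Real.log (2 * Real.pi) +
    3 / (2 * σ₀ ^ 2) * (α₀ ^ 2 + p * B * (β₀ ⬝ᵥ β₀) + σ₀ ^ 2 * B) - Real.log (stdCDF (σ₀⁻¹ * yL))

lemma abs_log_le_nullBound (hB : 0 ≤ B) : |Real.log σ₀| ≤ nullBound p yL α₀ σ₀ β₀ B := by
  have hpi : 0 ≤ Real.log (2 * Real.pi) := Real.log_nonneg (by nlinarith [Real.pi_gt_three])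
  have h1 := log_stdCDF_nonpos (σ₀⁻¹ * yL)
  have hbb : 0 ≤ β₀ ⬝ᵥ β₀ := by simpa using dotProduct_star_self_nonneg β₀
  have : 0 ≤ 3 / (2 * σ₀ ^ 2) * (α₀ ^ 2 + p * B * (β₀ ⬝ᵥ β₀) + σ₀ ^ 2 * B) := by positivity
  unfold nullBound
  linarith

lemma GoodSample.null_logLik_ge (h : GoodSample w yL α₀ σ₀ β₀ e n c B D) (hσ : 0 < σ₀)
    (hw : ∀ j, ∑ i : Fin n, w i j ^ 2 ≤ B * n) :
    -(nullBound p yL α₀ σ₀ β₀ B * n) ≤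
      logLik yL (censResp w yL α₀ σ₀ β₀ e n) σ₀⁻¹ (fun _ => 0) := by
  have hterm : ∀ i : Fin n, -(|Real.log σ₀| + 1 / 2 * Real.log (2 * Real.pi) -
      Real.log (stdCDF (σ₀⁻¹ * yL)) +
      3 / (2 * σ₀ ^ 2) * (α₀ ^ 2 + (w i ⬝ᵥ β₀) ^ 2 + σ₀ ^ 2 * e i ^ 2)) ≤
      obsLogLik yL σ₀⁻¹ (censResp w yL α₀ σ₀ β₀ e n i) 0 := by
    intro i
    have hpi : 0 ≤ Real.log (2 * Real.pi) := Real.log_nonneg (by nlinarith [Real.pi_gt_three])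
    have h1 := log_stdCDF_nonpos (σ₀⁻¹ * yL)
    have h2 : 0 ≤ 3 / (2 * σ₀ ^ 2) * (α₀ ^ 2 + (w i ⬝ᵥ β₀) ^ 2 + σ₀ ^ 2 * e i ^ 2) := by
      positivity
    unfold obsLogLik
    split_ifs with hi
    · rw [censResp_of_lt hi, Real.log_inv, sub_zero]
      have h3 := le_abs_self (Real.log σ₀)
      have h4 : (α₀ + w i ⬝ᵥ β₀ + σ₀ * e i) ^ 2 ≤
          3 * (α₀ ^ 2 + (w i ⬝ᵥ β₀) ^ 2 + σ₀ ^ 2 * e i ^ 2) := by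
        nlinarith [sq_nonneg (α₀ - w i ⬝ᵥ β₀), sq_nonneg (α₀ - σ₀ * e i),
          sq_nonneg (w i ⬝ᵥ β₀ - σ₀ * e i)]
      have h5 : 1 / 2 * (σ₀⁻¹ * (α₀ + w i ⬝ᵥ β₀ + σ₀ * e i)) ^ 2 ≤
          3 / (2 * σ₀ ^ 2) * (α₀ ^ 2 + (w i ⬝ᵥ β₀) ^ 2 + σ₀ ^ 2 * e i ^ 2) := by
        calc 1 / 2 * (σ₀⁻¹ * (α₀ + w i ⬝ᵥ β₀ + σ₀ * e i)) ^ 2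
            = 1 / (2 * σ₀ ^ 2) * (α₀ + w i ⬝ᵥ β₀ + σ₀ * e i) ^ 2 := by field_simp
          _ ≤ 1 / (2 * σ₀ ^ 2) * (3 * (α₀ ^ 2 + (w i ⬝ᵥ β₀) ^ 2 + σ₀ ^ 2 * e i ^ 2)) := by gcongr
          _ = _ := by ring
      linarith
    · have h3 := abs_nonneg (Real.log σ₀)
      rw [sub_zero]
      linarith
  refine le_trans ?_ (Finset.sum_le_sum fun i _ => hterm i)
  rw [Finset.sum_neg_distrib, Finset.sum_add_distrib, ← Finset.mul_sum, Finset.sum_add_distrib,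
    Finset.sum_add_distrib, ← Finset.mul_sum (f := fun i : Fin n => e i ^ 2)]
  simp only [Finset.sum_const, Finset.card_univ, Fintype.card_fin, nsmul_eq_mul]
  have h6 := sum_dotProduct_sq_le hw β₀
  have h7 : σ₀ ^ 2 * ∑ i : Fin n, e i ^ 2 ≤ σ₀ ^ 2 * (B * n) := by
    gcongr; exact h.errors
  have h8 : 3 / (2 * σ₀ ^ 2) * (n * α₀ ^ 2 + ∑ i : Fin n, (w i ⬝ᵥ β₀) ^ 2 +
      σ₀ ^ 2 * ∑ i : Fin n, e i ^ 2) ≤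
      3 / (2 * σ₀ ^ 2) * (n * α₀ ^ 2 + p * B * n * (β₀ ⬝ᵥ β₀) + σ₀ ^ 2 * (B * n)) := by
    gcongr
  unfold nullBound
  nlinarith

/-- Radius that contains all parameters at least as good as the zero predictor. -/
noncomputable def locRadius (p : ℕ) (yL α₀ σ₀ : ℝ) (β₀ : Fin p → ℝ) (c B : ℝ) : ℝ :=
  1 + 4 * (3 * nullBound p yL α₀ σ₀ β₀ B + 2 + |Real.log σ₀|) / c

/-- Localization: parameters at least as good as the zero predictor stay in a fixed neighbourhood
of the truth, and their scale stays away from zero. -/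
lemma GoodSample.localize (h : GoodSample w yL α₀ σ₀ β₀ e n c B D) (hσ : 0 < σ₀) (hc : 0 < c)
    (hB : 0 ≤ B) (hn : 2 ≤ c * n) (hD : (p + 2) * (D / (c * n)) ≤ n)
    (hn1 : 0 < n)
    (hw : ∀ j, ∑ i : Fin n, w i j ^ 2 ≤ B * n) {τ : ℝ} (hτ : 0 < τ) {a : ℝ} {b : Fin p → ℝ}
    {f : Fin n → ℝ} (hf : ∀ i : Fin n, f i = τ * (α₀ + w i ⬝ᵥ β₀) + a + w i ⬝ᵥ b)
    (hge : logLik yL (censResp w yL α₀ σ₀ β₀ e n) σ₀⁻¹ (fun _ => 0) - Real.log σ₀⁻¹ ≤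
      logLik yL (censResp w yL α₀ σ₀ β₀ e n) τ f - Real.log τ) :
    (τ * σ₀ - 1) ^ 2 + a ^ 2 + b ⬝ᵥ b ≤ locRadius p yL α₀ σ₀ β₀ c B ∧
      -locRadius p yL α₀ σ₀ β₀ c B ≤ Real.log (τ * σ₀) := by
  have h1 := h.logLik_le hσ hc hn1 hτ a b hf
  have h2 := h.null_logLik_ge hσ hw
  have h3 := trueLogLik_le (w := w) (yL := yL) (α₀ := α₀) (β₀ := β₀) (σ₀ := σ₀) (e := e) (n := n)
  have h4 := h.numUncensored_ge hσ
  have h5 := abs_log_le_nullBound (yL := yL) (α₀ := α₀) (σ₀ := σ₀) (β₀ := β₀) hB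
  have hn1' : (1 : ℝ) ≤ n := by exact_mod_cast hn1
  have hlog : Real.log τ = Real.log (τ * σ₀) - Real.log σ₀ := by
    rw [Real.log_mul hτ.ne' hσ.ne']; ring
  have hs : 0 < τ * σ₀ := by positivity
  have h6 : Real.log (τ * σ₀) - (τ * σ₀ - 1) ≤ 0 := by
    linarith [Real.log_le_sub_one_of_pos hs]
  rw [Real.log_inv, hlog] at hge
  set N := numUncensored yL (censResp w yL α₀ σ₀ β₀ e n)
  set K := nullBound p yL α₀ σ₀ β₀ B
  set s := τ * σ₀
  set l := |Real.log σ₀|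
  have hl : 0 ≤ l := abs_nonneg _
  have hKn : l * n ≤ K * n := by gcongr
  have hl1 := abs_le.1 (le_refl |Real.log σ₀|)
  have hln : l ≤ l * n := by nlinarith
  -- `(N - 1) * ((s - 1) - log s)` stays in the bound because it excludes scales `s` close to zero
  have h7 : c * n / 4 * ((s - 1) ^ 2 + a ^ 2 + b ⬝ᵥ b) + (N - 1) * ((s - 1) - Real.log s) ≤
      (3 * K + 2 + l) * n := by nlinarith
  have hbb : 0 ≤ b ⬝ᵥ b := by simpa using dotProduct_star_self_nonneg b
  have h8 : 0 ≤ (N - 1) * ((s - 1) - Real.log s) := mul_nonneg (by linarith) (by linarith)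
  have hq : 0 ≤ (s - 1) ^ 2 + a ^ 2 + b ⬝ᵥ b := by positivity
  have h9 : 0 ≤ c * n / 4 * ((s - 1) ^ 2 + a ^ 2 + b ⬝ᵥ b) := by positivity
  have hn0 : (0 : ℝ) < n := by linarith
  unfold locRadius
  constructor
  · have : (s - 1) ^ 2 + a ^ 2 + b ⬝ᵥ b ≤ 4 * (3 * K + 2 + l) / c := by
      rw [le_div_iff₀ hc]
      have : c / 4 * ((s - 1) ^ 2 + a ^ 2 + b ⬝ᵥ b) * n ≤ (3 * K + 2 + l) * n := by linarith
      linarith [le_of_mul_le_mul_right this hn0]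
    linarith
  · have h10 : c * n / 2 * ((s - 1) - Real.log s) ≤ (3 * K + 2 + l) * n := by
      have : c * n / 2 * ((s - 1) - Real.log s) ≤ (N - 1) * ((s - 1) - Real.log s) :=
        mul_le_mul_of_nonneg_right (by linarith) (by linarith)
      linarith
    have h11 : (s - 1) - Real.log s ≤ 4 * (3 * K + 2 + l) / c := by
      rw [le_div_iff₀ hc]
      have h12 : c / 2 * ((s - 1) - Real.log s) * n ≤ (3 * K + 2 + l) * n := by linarith
      have h13 := le_of_mul_le_mul_right h12 hn0
      have : 0 ≤ 3 * K + 2 + l := by linarith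
      linarith
    linarith

end

end TobitVB

/-! ### Existence of variational posteriors on regular samples -/

namespace TobitVB

variable {p : ℕ}

/-- Coefficients of the model `k`, extended by zero to all regressors. -/
def extendCoef (k : Finset (Fin p)) (d : k → ℝ) (j : Fin p) : ℝ :=
  if h : j ∈ k then d ⟨j, h⟩ else 0

lemma sum_mul_extendCoef (k : Finset (Fin p)) (d : k → ℝ) (x : Fin p → ℝ) :
    ∑ j : k, x j * d j = x ⬝ᵥ extendCoef k d := by
  rw [dotProduct, ← Finset.sum_subset (Finset.subset_univ k), ← Finset.sum_coe_sort k]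
  · refine Finset.sum_congr rfl fun j _ => ?_
    simp [extendCoef]
  · intro j _ hj
    simp [extendCoef, hj]

section
variable {w : ℕ → Fin p → ℝ} {n : ℕ}

lemma subDesign_mulVec (k : Finset (Fin p)) (d : k → ℝ) :
    subDesign w n k *ᵥ d = design w n *ᵥ extendCoef k d := by
  ext i
  exact sum_mul_extendCoef k d (design w n i)

lemma design_mulVec (v : Fin p → ℝ) (i : Fin n) :
    (design w n *ᵥ v) i = w i ⬝ᵥ v - colMean w n ⬝ᵥ v := by
  rw [← sub_dotProduct]
  rfl

lemma sum_subDesign (hn : 0 < n) (k : Finset (Fin p)) (j : k) : ∑ i, subDesign w n k i j = 0 := by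
  have hn' : (n : ℝ) ≠ 0 := by positivity
  simp only [subDesign, design, submatrix_apply, of_apply, id, Finset.sum_sub_distrib,
    Finset.sum_const, Finset.card_univ, Fintype.card_fin, nsmul_eq_mul, colMean]
  field_simp
  ring

lemma extendCoef_injective (k : Finset (Fin p)) : Function.Injective (extendCoef k) := by
  intro d d' h
  ext j
  have := congrFun h j
  simpa [extendCoef] using this

lemma det_subDesign_pos (hinj : ∀ v, design w n *ᵥ v = 0 → v = 0) (k : Finset (Fin p)) :
    0 < ((subDesign w n k)ᵀ * subDesign w n k).det := by
  have h : ((subDesign w n k)ᴴ * subDesign w n k).PosDef := by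
    apply PosDef.conjTranspose_mul_self
    intro d d' hd
    have h1 : design w n *ᵥ (extendCoef k d - extendCoef k d') = 0 := by
      rw [mulVec_sub, ← subDesign_mulVec, ← subDesign_mulVec]
      exact sub_eq_zero.2 hd
    exact extendCoef_injective k (sub_eq_zero.1 (hinj _ h1))
  rw [conjTranspose_eq_transpose_of_trivial] at h
  exact h.det_pos

lemma sum_dotProduct_eq_mul_colMean (hn : 0 < n) (v : Fin p → ℝ) :
    ∑ i : Fin n, w i ⬝ᵥ v = n * (colMean w n ⬝ᵥ v) := by
  have hn' : (0 : ℝ) < n := by positivity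
  simp only [dotProduct, colMean]
  rw [Finset.sum_comm, Finset.mul_sum]
  refine Finset.sum_congr rfl fun j _ => ?_
  rw [← Finset.sum_mul]
  field_simp

/-- Centering decreases the sum of squares. -/
lemma design_mulVec_sq_le (hn : 0 < n) (v : Fin p → ℝ) :
    (design w n *ᵥ v) ⬝ᵥ (design w n *ᵥ v) ≤ ∑ i : Fin n, (w i ⬝ᵥ v) ^ 2 := by
  have hn' : (0 : ℝ) < n := by positivity
  set m := colMean w n ⬝ᵥ v
  have hm : ∑ i : Fin n, w i ⬝ᵥ v = n * m := sum_dotProduct_eq_mul_colMean hn v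
  have h1 : (design w n *ᵥ v) ⬝ᵥ (design w n *ᵥ v) =
      ∑ i : Fin n, ((w i ⬝ᵥ v) ^ 2 - 2 * m * (w i ⬝ᵥ v) + m ^ 2) := by
    rw [dotProduct]
    refine Finset.sum_congr rfl fun i _ => ?_
    rw [design_mulVec]
    ring
  rw [h1, Finset.sum_add_distrib, Finset.sum_sub_distrib, ← Finset.mul_sum, hm]
  simp only [Finset.sum_const, Finset.card_univ, Fintype.card_fin, nsmul_eq_mul]
  nlinarith [sq_nonneg m]

/-- The predictor of a model as a deviation from the true predictor scaled by `τ`, in terms of the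
uncentered regressors. -/
lemma linPred_subDesign (α₀ τ d₀ : ℝ) (β₀ : Fin p → ℝ) (k : Finset (Fin p)) (d : k → ℝ)
    (i : Fin n) :
    linPred (subDesign w n k) d₀ d i = τ * (α₀ + w i ⬝ᵥ β₀) +
      (d₀ - colMean w n ⬝ᵥ extendCoef k d - τ * α₀) + w i ⬝ᵥ (extendCoef k d - τ • β₀) := by
  rw [linPred, subDesign_mulVec, design_mulVec, dotProduct_sub, dotProduct_smul, smul_eq_mul]
  ring

end

section existence
variable {n : ℕ} {κ : Type*} [Fintype κ]

lemma continuousOn_penLogLik (X : Matrix (Fin n) κ ℝ) (yL : ℝ) (y : Fin n → ℝ) (g : ℝ) :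
    ContinuousOn (fun x : ℝ × ℝ × (κ → ℝ) => penLogLik X yL y g x.1 x.2.1 x.2.2)
      {x | 0 < x.1} := by
  have hlog : ContinuousOn (fun x : ℝ × ℝ × (κ → ℝ) => Real.log x.1) {x | 0 < x.1} :=
    ContinuousOn.log (by fun_prop) fun x hx => (ne_of_gt hx)
  have hmul : Continuous fun x : ℝ × ℝ × (κ → ℝ) => X *ᵥ x.2.2 :=
    Continuous.matrix_mulVec continuous_const (by fun_prop)
  have hlin : ∀ i, Continuous fun x : ℝ × ℝ × (κ → ℝ) => linPred X x.2.1 x.2.2 i := fun i =>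
    (by fun_prop : Continuous fun x : ℝ × ℝ × (κ → ℝ) => x.2.1).add
      ((continuous_apply i).comp hmul)
  have hobs : ∀ i, ContinuousOn (fun x : ℝ × ℝ × (κ → ℝ) =>
      obsLogLik yL x.1 (y i) (linPred X x.2.1 x.2.2 i)) {x | 0 < x.1} := by
    intro i
    have := hlin i
    unfold obsLogLik
    split_ifs
    · exact (hlog.sub continuousOn_const).sub (by fun_prop)
    · refine ContinuousOn.log ?_ fun x _ => (stdCDF_pos _).ne'
      exact (continuous_stdCDF.comp (by fun_prop)).continuousOn
  unfold penLogLik logLik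
  refine ((continuousOn_finsetSum _ fun i _ => hobs i).sub hlog).sub ?_
  exact (continuous_const.mul (hmul.dotProduct hmul)).continuousOn

/-- The objective attains its maximum if its superlevel set is bounded and stays away from the
boundary `τ = 0`. -/
lemma exists_max_penLogLik {X : Matrix (Fin n) κ ℝ} {yL : ℝ} {y : Fin n → ℝ} {g τ₀ lo R : ℝ}
    (hτ₀ : 0 < τ₀) (hlo : 0 < lo)
    (hb : ∀ τ d₀ d, 0 < τ → penLogLik X yL y g τ₀ 0 0 ≤ penLogLik X yL y g τ d₀ d →
      lo ≤ τ ∧ τ ≤ R ∧ |d₀| ≤ R ∧ ∀ j, |d j| ≤ R) :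
    ∃ τ d₀ d, 0 < τ ∧ ∀ τ' d₀' d', 0 < τ' →
      penLogLik X yL y g τ' d₀' d' ≤ penLogLik X yL y g τ d₀ d := by
  let S : Set (ℝ × ℝ × (κ → ℝ)) :=
    Set.Icc lo R ×ˢ Set.Icc (-R) R ×ˢ Set.Icc (fun _ => -R) (fun _ => R)
  have hmem : ∀ τ d₀ d, 0 < τ → penLogLik X yL y g τ₀ 0 0 ≤ penLogLik X yL y g τ d₀ d →
      (τ, d₀, d) ∈ S := by
    intro τ d₀ d hτ h
    obtain ⟨h1, h2, h3, h4⟩ := hb τ d₀ d hτ h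
    exact Set.mk_mem_prod (Set.mem_Icc.2 ⟨h1, h2⟩) (Set.mk_mem_prod (Set.mem_Icc.2 (abs_le.1 h3))
      (Set.mem_Icc.2 ⟨fun j => (abs_le.1 (h4 j)).1, fun j => (abs_le.1 (h4 j)).2⟩))
  have hpos : ∀ x ∈ S, 0 < x.1 := fun x hx => lt_of_lt_of_le hlo (Set.mem_Icc.1 hx.1).1
  have hS : IsCompact S := isCompact_Icc.prod (isCompact_Icc.prod isCompact_Icc)
  obtain ⟨⟨τ, d₀, d⟩, hx, hmax⟩ := hS.exists_isMaxOn ⟨(τ₀, 0, 0), hmem τ₀ 0 0 hτ₀ le_rfl⟩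
    ((continuousOn_penLogLik X yL y g).mono hpos)
  replace hmax : ∀ x ∈ S, penLogLik X yL y g x.1 x.2.1 x.2.2 ≤ penLogLik X yL y g τ d₀ d := hmax
  refine ⟨τ, d₀, d, hpos _ hx, fun τ' d₀' d' hτ' => ?_⟩
  rcases le_total (penLogLik X yL y g τ₀ 0 0) (penLogLik X yL y g τ' d₀' d') with h | h
  · exact hmax (τ', d₀', d') (hmem τ' d₀' d' hτ' h)
  · exact h.trans (hmax (τ₀, 0, 0) (hmem τ₀ 0 0 hτ₀ le_rfl))

end existence

/-- A good sample together with the conditions on the regressors and the sample size. The bound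
`score_small` keeps the likelihood gain of superfluous regressors within half of the dimension
penalty `(log n) / 2` of a single one. -/
structure RegularSample (w : ℕ → Fin p → ℝ) (yL α₀ σ₀ : ℝ) (β₀ : Fin p → ℝ) (e : ℕ → ℝ) (n : ℕ)
    (c B D : ℝ) : Prop extends GoodSample w yL α₀ σ₀ β₀ e n c B D where
  scale_pos : 0 < σ₀
  c_pos : 0 < c
  B_nonneg : 0 ≤ B
  two_le : 2 ≤ c * n
  four_le : 4 ≤ n
  dim_le : p ≤ n
  score_small : (p + 2) * (D / (c * n)) ≤ 1 / 4 * Real.log n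
  regressors : ∀ j, ∑ i : Fin n, w i j ^ 2 ≤ B * n
  injective : ∀ v, design w n *ᵥ v = 0 → v = 0

section
variable {w : ℕ → Fin p → ℝ} {yL α₀ σ₀ : ℝ} {β₀ : Fin p → ℝ} {e : ℕ → ℝ} {n : ℕ} {c B D : ℝ}

lemma RegularSample.n_pos (h : RegularSample w yL α₀ σ₀ β₀ e n c B D) : 0 < n := by
  have := h.four_le; omega

lemma RegularSample.one_le_numUncensored (h : RegularSample w yL α₀ σ₀ β₀ e n c B D) :
    1 ≤ numUncensored yL (censResp w yL α₀ σ₀ β₀ e n) := by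
  have := h.numUncensored_ge h.scale_pos
  linarith [h.two_le]

lemma RegularSample.localize_model (h : RegularSample w yL α₀ σ₀ β₀ e n c B D)
    (k : Finset (Fin p)) {τ d₀ : ℝ} {d : k → ℝ} (hτ : 0 < τ)
    (hge : penLogLik (subDesign w n k) yL (censResp w yL α₀ σ₀ β₀ e n) n σ₀⁻¹ 0 0 ≤
      penLogLik (subDesign w n k) yL (censResp w yL α₀ σ₀ β₀ e n) n τ d₀ d) :
    (τ * σ₀ - 1) ^ 2 + (d₀ - colMean w n ⬝ᵥ extendCoef k d - τ * α₀) ^ 2 +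
      (extendCoef k d - τ • β₀) ⬝ᵥ (extendCoef k d - τ • β₀) ≤ locRadius p yL α₀ σ₀ β₀ c B ∧
      -locRadius p yL α₀ σ₀ β₀ c B ≤ Real.log (τ * σ₀) := by
  have hn1 : (0 : ℝ) < n := by have := h.n_pos; positivity
  refine h.localize h.scale_pos h.c_pos h.B_nonneg h.two_le ?_ h.n_pos h.regressors hτ
    (linPred_subDesign α₀ τ d₀ β₀ k d) ?_
  · have := Real.log_le_sub_one_of_pos hn1
    linarith [h.score_small]
  · unfold penLogLik at hge
    have h1 : linPred (subDesign w n k) 0 0 = fun _ => (0 : ℝ) := by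
      ext i; simp [linPred]
    have h2 : 0 ≤ 1 / (2 * (n : ℝ)) * ((subDesign w n k *ᵥ d) ⬝ᵥ (subDesign w n k *ᵥ d)) := by
      have : 0 ≤ (subDesign w n k *ᵥ d) ⬝ᵥ (subDesign w n k *ᵥ d) := by
        simpa using dotProduct_star_self_nonneg (subDesign w n k *ᵥ d)
      positivity
    rw [h1] at hge
    simp only [mulVec_zero, dotProduct_zero, mul_zero, sub_zero] at hge
    linarith

lemma abs_le_one_add_of_sq_le {x R : ℝ} (h : x ^ 2 ≤ R) : |x| ≤ 1 + R := by
  rw [abs_le]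
  constructor <;> nlinarith [sq_nonneg (x - 1), sq_nonneg (x + 1)]

lemma sq_le_dotProduct_self (b : Fin p → ℝ) (j : Fin p) : b j ^ 2 ≤ b ⬝ᵥ b := by
  rw [dotProduct, sq]
  exact Finset.single_le_sum (f := fun j => b j * b j) (fun i _ => mul_self_nonneg _)
    (Finset.mem_univ j)

lemma dotProduct_self_nonneg' (b : Fin p → ℝ) : 0 ≤ b ⬝ᵥ b := by
  simpa using dotProduct_star_self_nonneg b

/-- On a regular sample every model has a variational posterior. -/
lemma RegularSample.exists_isVB (h : RegularSample w yL α₀ σ₀ β₀ e n c B D)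
    (k : Finset (Fin p)) :
    ∃ q : VBState k, IsVB q (subDesign w n k) yL (censResp w yL α₀ σ₀ β₀ e n) n := by
  have hσ := h.scale_pos
  have hn := h.n_pos
  have hg : (0 : ℝ) < n := by positivity
  set R := locRadius p yL α₀ σ₀ β₀ c B
  set M := ∑ j, |colMean w n j| with hM
  have hM0 : 0 ≤ M := Finset.sum_nonneg fun j _ => abs_nonneg _
  set T := (2 + R) / σ₀ with hT
  set V := 1 + R + ∑ j, T * |β₀ j| with hV
  set Q := T + V + (1 + R + M * V + T * |α₀|) with hQ
  have hb : ∀ τ d₀ (d : k → ℝ), 0 < τ →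
      penLogLik (subDesign w n k) yL (censResp w yL α₀ σ₀ β₀ e n) n σ₀⁻¹ 0 0 ≤
        penLogLik (subDesign w n k) yL (censResp w yL α₀ σ₀ β₀ e n) n τ d₀ d →
      Real.exp (-R) / σ₀ ≤ τ ∧ τ ≤ Q ∧ |d₀| ≤ Q ∧ ∀ j, |d j| ≤ Q := by
    intro τ d₀ d hτ hge
    obtain ⟨h1, h2⟩ := h.localize_model k hτ hge
    have hs : 0 < τ * σ₀ := by positivity
    have hbb := dotProduct_self_nonneg' (extendCoef k d - τ • β₀)
    have hR : 0 ≤ R := by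
      nlinarith [sq_nonneg (τ * σ₀ - 1), sq_nonneg (d₀ - colMean w n ⬝ᵥ extendCoef k d - τ * α₀)]
    have h3 := abs_le_one_add_of_sq_le (x := τ * σ₀ - 1) (R := R) (by
      nlinarith [sq_nonneg (d₀ - colMean w n ⬝ᵥ extendCoef k d - τ * α₀)])
    have h4 := abs_le_one_add_of_sq_le
      (x := d₀ - colMean w n ⬝ᵥ extendCoef k d - τ * α₀) (R := R) (by
      nlinarith [sq_nonneg (τ * σ₀ - 1)])
    have hτT : τ ≤ T := by
      rw [hT, le_div_iff₀ hσ]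
      linarith [(abs_le.1 h3).2]
    have hT0 : 0 ≤ T := hτ.le.trans hτT
    have hV0 : 0 ≤ V := by positivity
    have h5 : ∀ j, |extendCoef k d j| ≤ V := by
      intro j
      have h6 := abs_le_one_add_of_sq_le (x := (extendCoef k d - τ • β₀) j) (R := R) (by
        nlinarith [sq_nonneg (τ * σ₀ - 1), sq_le_dotProduct_self (extendCoef k d - τ • β₀) j,
          sq_nonneg (d₀ - colMean w n ⬝ᵥ extendCoef k d - τ * α₀)])
      have h7 : |τ * β₀ j| ≤ ∑ j, T * |β₀ j| := by
        rw [abs_mul, abs_of_pos hτ]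
        refine (mul_le_mul_of_nonneg_right hτT (abs_nonneg _)).trans ?_
        exact Finset.single_le_sum (f := fun j => T * |β₀ j|) (fun i _ => by positivity)
          (Finset.mem_univ j)
      have h8 : extendCoef k d j = (extendCoef k d - τ • β₀) j + τ * β₀ j := by
        simp
      rw [h8]
      exact (abs_add_le _ _).trans (by linarith)
    have h9 : |colMean w n ⬝ᵥ extendCoef k d| ≤ M * V := by
      rw [dotProduct, hM, Finset.sum_mul]
      refine (Finset.abs_sum_le_sum_abs _ _).trans (Finset.sum_le_sum fun j _ => ?_)
      rw [abs_mul]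
      exact mul_le_mul_of_nonneg_left (h5 j) (abs_nonneg _)
    have h10 : |τ * α₀| ≤ T * |α₀| := by
      rw [abs_mul, abs_of_pos hτ]
      exact mul_le_mul_of_nonneg_right hτT (abs_nonneg _)
    have hMV : 0 ≤ M * V := by positivity
    have hTα : 0 ≤ T * |α₀| := by positivity
    refine ⟨?_, ?_, ?_, ?_⟩
    · rw [div_le_iff₀ hσ]
      exact (Real.le_log_iff_exp_le hs).1 h2
    · linarith
    · have := abs_le.1 h4
      have := abs_le.1 h9
      have := abs_le.1 h10
      rw [abs_le]
      constructor <;> linarith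
    · intro j
      have := h5 j
      simp only [extendCoef, Finset.coe_mem, dite_true, Subtype.coe_eta] at this
      linarith
  obtain ⟨τ, d₀, d, hτ, hmax⟩ := exists_max_penLogLik (inv_pos.2 hσ) (by positivity) hb
  exact (scoreEq_of_isMax hg yL_le_censResp hτ hmax).exists_isVB hτ hn (sum_subDesign hn k)
    (isUnit_iff_ne_zero.2 (det_subDesign_pos h.injective k).ne') hg yL_le_censResp

/-- Variational posteriors maximize the penalized log-likelihood of their model. -/
lemma RegularSample.penLogLik_le (h : RegularSample w yL α₀ σ₀ β₀ e n c B D)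
    {k : Finset (Fin p)} {q : VBState k}
    (hq : IsVB q (subDesign w n k) yL (censResp w yL α₀ σ₀ β₀ e n) n)
    {τ : ℝ} (hτ : 0 < τ) (d₀ : ℝ) (d : k → ℝ) :
    penLogLik (subDesign w n k) yL (censResp w yL α₀ σ₀ β₀ e n) n τ d₀ d ≤
      penLogLik (subDesign w n k) yL (censResp w yL α₀ σ₀ β₀ e n) n q.tau (q.tau * q.muAlpha)
        (q.tau • q.muBeta) := by
  have hn := h.n_pos
  have hg : (0 : ℝ) < n := by positivity
  exact (hq.scoreEq hn (sum_subDesign hn k)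
    (isUnit_iff_ne_zero.2 (det_subDesign_pos h.injective k).ne') hg yL_le_censResp).penLogLik_le hg
    yL_le_censResp (VBState.tau_pos (hq.xi_pos hn)) h.one_le_numUncensored hτ d₀ d

end

end TobitVB

/-! ### Model comparison on regular samples -/

namespace TobitVB

variable {p : ℕ}

lemma sub_sub_sq_le (x a z : ℝ) : (x - a - z) ^ 2 ≤ 3 * (x ^ 2 + a ^ 2 + z ^ 2) := by
  nlinarith [sq_nonneg (x + a), sq_nonneg (x + z), sq_nonneg (a - z)]

lemma three_mul_add_le {P R Q W : ℝ} (hP : 0 ≤ P) (hR : 0 ≤ R) (hQ : 0 ≤ Q) (hW : 0 ≤ W) :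
    3 * (P + R + W * Q) ≤ 3 * (P + R + Q) * (1 + W) := by
  nlinarith [mul_nonneg hP hW, mul_nonneg hR hW]

/-- Variational posteriors on regular samples stay in a compact set of parameters. -/
lemma exists_posterior_bounds (p : ℕ) (yL α₀ σ₀ : ℝ) (β₀ : Fin p → ℝ) (c B : ℝ) :
    ∃ K : ℝ, 0 ≤ K ∧ ∀ (w : ℕ → Fin p → ℝ) (e : ℕ → ℝ) (n : ℕ) (D : ℝ),
      RegularSample w yL α₀ σ₀ β₀ e n c B D → ∀ (k : Finset (Fin p)) (q : VBState k),
        IsVB q (subDesign w n k) yL (censResp w yL α₀ σ₀ β₀ e n) n →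
        |Real.log q.xi| ≤ K ∧
        1 / n * (q.tau ^ 2 * ((subDesign w n k *ᵥ q.muBeta) ⬝ᵥ (subDesign w n k *ᵥ q.muBeta)))
          ≤ K ∧
        (∀ i, (q.tau * (yL - q.loc (subDesign w n k) i)) ^ 2 ≤ K * (1 + ∑ j, w i j ^ 2)) ∧
        -K ≤ Real.log (q.tau * σ₀) := by
  set R := locRadius p yL α₀ σ₀ β₀ c B
  set T := (2 + R) / σ₀ with hT
  set Q := 2 * R + 2 * T ^ 2 * (β₀ ⬝ᵥ β₀) with hQ
  set K1 := 2 * (1 + R + |Real.log σ₀|)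
  set K3 := 3 * (T ^ 2 * (yL - α₀) ^ 2 + R + Q)
  refine ⟨|K1| + |p * B * Q| + |K3| + |R|, by positivity, fun w e n D h k q hq => ?_⟩
  have hn := h.n_pos
  have hn' : (0 : ℝ) < n := by positivity
  have hσ := h.scale_pos
  have hξ := hq.xi_pos hn
  have hτ := VBState.tau_pos hξ
  obtain ⟨h1, h2⟩ := h.localize_model k hτ (h.penLogLik_le hq (inv_pos.2 hσ) 0 0)
  set a := q.tau * q.muAlpha - colMean w n ⬝ᵥ extendCoef k (q.tau • q.muBeta) - q.tau * α₀
    with ha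
  set b := extendCoef k (q.tau • q.muBeta) - q.tau • β₀ with hb
  change _ ≤ R at h1
  change -R ≤ _ at h2
  have hs : 0 < q.tau * σ₀ := by positivity
  have hbb := dotProduct_self_nonneg' b
  have hR : 0 ≤ R := by nlinarith [sq_nonneg (q.tau * σ₀ - 1), sq_nonneg a]
  have h3 := abs_le.1 (abs_le_one_add_of_sq_le (x := q.tau * σ₀ - 1) (R := R)
    (by nlinarith [sq_nonneg a]))
  have hτT : q.tau ≤ T := by
    rw [hT, le_div_iff₀ hσ]; linarith
  have hτT2 : q.tau ^ 2 ≤ T ^ 2 := by gcongr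
  have hQe : extendCoef k (q.tau • q.muBeta) ⬝ᵥ extendCoef k (q.tau • q.muBeta) ≤ Q := by
    have e1 : extendCoef k (q.tau • q.muBeta) = b + q.tau • β₀ := by rw [hb]; abel
    have h4 := dotProduct_self_nonneg' (b - q.tau • β₀)
    have h5 : q.tau ^ 2 * (β₀ ⬝ᵥ β₀) ≤ T ^ 2 * (β₀ ⬝ᵥ β₀) :=
      mul_le_mul_of_nonneg_right hτT2 (dotProduct_self_nonneg' β₀)
    rw [e1]
    simp only [sub_dotProduct, dotProduct_sub, add_dotProduct, dotProduct_add, smul_dotProduct,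
      dotProduct_smul, smul_eq_mul] at h4 ⊢
    nlinarith [sq_nonneg a, sq_nonneg (q.tau * σ₀ - 1)]
  have hQ0 : 0 ≤ Q := (dotProduct_self_nonneg' _).trans hQe
  have hK3 : 0 ≤ K3 := by positivity
  have hlogτ : Real.log q.xi = -2 * (Real.log (q.tau * σ₀) - Real.log σ₀) := by
    rw [Real.log_mul hτ.ne' hσ.ne', VBState.tau, Real.log_inv, Real.log_sqrt hξ.le]
    ring
  have hK1 := le_abs_self K1
  have hKp := le_abs_self (p * B * Q)
  have hKR := le_abs_self R
  have a1 := abs_nonneg K1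
  have a2 := abs_nonneg (p * B * Q)
  have a3 := abs_nonneg K3
  have a4 := abs_nonneg R
  refine ⟨?_, ?_, fun i => ?_, by linarith⟩
  · have h4 := Real.log_le_sub_one_of_pos hs
    have h5 := abs_le.1 (le_refl |Real.log σ₀|)
    have : |Real.log q.xi| ≤ K1 := by
      rw [hlogτ, abs_le]
      constructor <;> simp only [K1] <;> linarith
    linarith
  · have e1 : q.tau ^ 2 *
        ((subDesign w n k *ᵥ q.muBeta) ⬝ᵥ (subDesign w n k *ᵥ q.muBeta)) =
        (design w n *ᵥ extendCoef k (q.tau • q.muBeta)) ⬝ᵥ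
          (design w n *ᵥ extendCoef k (q.tau • q.muBeta)) := by
      rw [← subDesign_mulVec, mulVec_smul, smul_dotProduct, dotProduct_smul, smul_eq_mul,
        smul_eq_mul]
      ring
    have h4 := (design_mulVec_sq_le (w := w) hn (extendCoef k (q.tau • q.muBeta))).trans
      (sum_dotProduct_sq_le h.regressors _)
    have hB := h.B_nonneg
    have h5 : p * B * n * (extendCoef k (q.tau • q.muBeta) ⬝ᵥ extendCoef k (q.tau • q.muBeta)) ≤
      p * B * n * Q := by gcongr
    rw [e1, one_div_mul_eq_div, div_le_iff₀ hn']
    have h6 : p * B * Q * n ≤ (|K1| + |p * B * Q| + |K3| + |R|) * n := by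
      gcongr; linarith
    linarith
  · have e1 : q.tau * (yL - q.loc (subDesign w n k) i) =
        q.tau * (yL - α₀) - a - w i ⬝ᵥ extendCoef k (q.tau • q.muBeta) := by
      have := linPred_subDesign (w := w) α₀ q.tau (q.tau * q.muAlpha) β₀ k (q.tau • q.muBeta) i
      rw [q.linPred_tau] at this
      rw [mul_sub, this, ha]
      simp only [dotProduct_sub, dotProduct_smul, smul_eq_mul]
      ring
    have h4 : (w i ⬝ᵥ extendCoef k (q.tau • q.muBeta)) ^ 2 ≤ (∑ j, w i j ^ 2) * Q :=
      (dotProduct_sq_le _ _).trans (by gcongr)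
    have h5 : q.tau ^ 2 * (yL - α₀) ^ 2 ≤ T ^ 2 * (yL - α₀) ^ 2 := by gcongr
    have h6 : a ^ 2 ≤ R := by nlinarith [sq_nonneg (q.tau * σ₀ - 1)]
    have hW : 0 ≤ ∑ j, w i j ^ 2 := Finset.sum_nonneg fun j _ => sq_nonneg _
    set W := ∑ j, w i j ^ 2
    set z := w i ⬝ᵥ extendCoef k (q.tau • q.muBeta)
    have h7 := sub_sub_sq_le (q.tau * (yL - α₀)) a z
    rw [mul_pow] at h7
    have h8 : 3 * (T ^ 2 * (yL - α₀) ^ 2 + R + W * Q) ≤ K3 * (1 + W) :=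
      three_mul_add_le (by positivity) hR hQ0 hW
    have h9 : K3 * (1 + W) ≤ (|K1| + |p * B * Q| + |K3| + |R|) * (1 + W) := by
      have := le_abs_self K3
      gcongr
      linarith
    rw [e1]
    linarith

section
variable {w : ℕ → Fin p → ℝ} {yL α₀ σ₀ : ℝ} {β₀ : Fin p → ℝ} {e : ℕ → ℝ} {n : ℕ} {c B D : ℝ}

lemma two_le_a {k : Finset (Fin p)} {q : VBState k} {X : Matrix (Fin n) k ℝ} {y : Fin n → ℝ}
    {g : ℝ} (hq : IsVB q X yL y g) (hn : 4 ≤ n) : 2 ≤ q.a := by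
  have hn4 : (4 : ℝ) ≤ n := by exact_mod_cast hn
  rw [hq.a_eq]
  have : (0 : ℝ) ≤ Fintype.card k := by positivity
  linarith

/-- Upper bound of the likelihood of any model by the likelihood at the truth; a parameter that
keeps its distance `r` from the truth loses a term of order `n`. -/
lemma RegularSample.log_tobitLik_le (h : RegularSample w yL α₀ σ₀ β₀ e n c B D)
    {k : Finset (Fin p)} {q : VBState k}
    (hq : IsVB q (subDesign w n k) yL (censResp w yL α₀ σ₀ β₀ e n) n) {r : ℝ}
    (hr : ∀ τ : ℝ, ∀ d : k → ℝ, r ≤ (τ * σ₀ - 1) ^ 2 +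
      (extendCoef k d - τ • β₀) ⬝ᵥ (extendCoef k d - τ • β₀)) :
    Real.log (q.tobitLik (subDesign w n k) yL (censResp w yL α₀ σ₀ β₀ e n)) ≤
      trueLogLik w yL α₀ σ₀ β₀ e n + 1 / 4 * Real.log n - c * n / 4 * r := by
  have hn := h.n_pos
  have hn' : (0 : ℝ) < n := by positivity
  have ha := two_le_a hq h.four_le
  have hσ := h.scale_pos
  -- the plug-in variance `b / (a - 1)` corresponds to the inverse scale `shrink * tau`
  have hτ : 0 < q.shrink * q.tau :=
    mul_pos (by linarith [VBState.half_le_shrink ha]) (VBState.tau_pos (hq.xi_pos hn))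
  have hs : 0 < q.shrink * q.tau * σ₀ := by positivity
  rw [hq.log_tobitLik ha]
  have hf : ∀ i : Fin n, q.shrink * q.tau * q.loc (subDesign w n k) i =
      linPred (subDesign w n k) (q.shrink * q.tau * q.muAlpha)
        ((q.shrink * q.tau) • q.muBeta) i := by
    intro i
    simp only [linPred, VBState.loc, mulVec_smul, Pi.smul_apply, smul_eq_mul]
    ring
  have h1 := h.toGoodSample.logLik_le hσ h.c_pos hn hτ _ _
    (fun i => (hf i).trans (linPred_subDesign α₀ (q.shrink * q.tau) _ β₀ k _ i))
  have h2 := hr (q.shrink * q.tau) ((q.shrink * q.tau) • q.muBeta)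
  have h3 := h.score_small
  have h4 : numUncensored yL (censResp w yL α₀ σ₀ β₀ e n) *
      (Real.log (q.shrink * q.tau * σ₀) - (q.shrink * q.tau * σ₀ - 1)) ≤ 0 :=
    mul_nonpos_of_nonneg_of_nonpos (by linarith [h.one_le_numUncensored])
      (by linarith [Real.log_le_sub_one_of_pos hs])
  have hc := h.c_pos
  have h5 : c * n / 4 * r ≤ c * n / 4 * ((q.shrink * q.tau * σ₀ - 1) ^ 2 +
      (q.shrink * q.tau * q.muAlpha - colMean w n ⬝ᵥ
        extendCoef k ((q.shrink * q.tau) • q.muBeta) - q.shrink * q.tau * α₀) ^ 2 +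
      (extendCoef k ((q.shrink * q.tau) • q.muBeta) - (q.shrink * q.tau) • β₀) ⬝ᵥ
        (extendCoef k ((q.shrink * q.tau) • q.muBeta) - (q.shrink * q.tau) • β₀)) := by
    gcongr
    nlinarith [sq_nonneg (q.shrink * q.tau * q.muAlpha - colMean w n ⬝ᵥ
        extendCoef k ((q.shrink * q.tau) • q.muBeta) - q.shrink * q.tau * α₀)]
  linarith

/-- A model that misses a relevant regressor keeps its distance from the truth. -/
lemma distance_of_missing (hσ : 0 < σ₀) {k : Finset (Fin p)} {j : Fin p} (hj : j ∉ k) (τ : ℝ)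
    (d : k → ℝ) :
    β₀ j ^ 2 / (σ₀ ^ 2 + β₀ j ^ 2) ≤ (τ * σ₀ - 1) ^ 2 +
      (extendCoef k d - τ • β₀) ⬝ᵥ (extendCoef k d - τ • β₀) := by
  have h1 := sq_le_dotProduct_self (extendCoef k d - τ • β₀) j
  have h2 : (extendCoef k d - τ • β₀) j = -(τ * β₀ j) := by simp [extendCoef, hj]
  rw [h2] at h1
  -- the minimum of the right-hand side over `τ`, at `τ = σ₀ / (σ₀² + β₀ⱼ²)`
  have h3 : β₀ j ^ 2 / (σ₀ ^ 2 + β₀ j ^ 2) ≤ (τ * σ₀ - 1) ^ 2 + (τ * β₀ j) ^ 2 := by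
    rw [div_le_iff₀ (by positivity)]
    nlinarith [sq_nonneg ((σ₀ ^ 2 + β₀ j ^ 2) * τ - σ₀)]
  nlinarith

/-- The likelihood attained by the true model is within a constant of the one at the truth. -/
lemma RegularSample.le_log_tobitLik_true (h : RegularSample w yL α₀ σ₀ β₀ e n c B D)
    {q : VBState (trueModel β₀)}
    (hq : IsVB q (subDesign w n (trueModel β₀)) yL (censResp w yL α₀ σ₀ β₀ e n) n) :
    trueLogLik w yL α₀ σ₀ β₀ e n + Real.log (q.tau * σ₀) - p * B * (β₀ ⬝ᵥ β₀) / σ₀ ^ 2 - 6 ≤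
      Real.log (q.tobitLik (subDesign w n (trueModel β₀)) yL (censResp w yL α₀ σ₀ β₀ e n)) := by
  have hn := h.n_pos
  have hn' : (0 : ℝ) < n := by positivity
  have ha := two_le_a hq h.four_le
  have hσ := h.scale_pos
  have hB := h.B_nonneg
  have hτ := VBState.tau_pos (hq.xi_pos hn)
  have h1 := hq.le_log_tobitLik ha hn (sum_subDesign hn _)
    (isUnit_iff_ne_zero.2 (det_subDesign_pos h.injective _).ne') hn' yL_le_censResp
  have hext : extendCoef (trueModel β₀) (fun j => σ₀⁻¹ * β₀ j) = σ₀⁻¹ • β₀ := by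
    ext j
    by_cases hj : β₀ j = 0 <;> simp [extendCoef, trueModel, hj]
  have h2 := h.penLogLik_le hq (inv_pos.2 hσ) (σ₀⁻¹ * (α₀ + colMean w n ⬝ᵥ β₀))
    (fun j => σ₀⁻¹ * β₀ j)
  have hlin : linPred (subDesign w n (trueModel β₀)) (σ₀⁻¹ * (α₀ + colMean w n ⬝ᵥ β₀))
      (fun j => σ₀⁻¹ * β₀ j) = fun i : Fin n => σ₀⁻¹ * (α₀ + w i ⬝ᵥ β₀) := by
    ext i
    rw [linPred_subDesign α₀ σ₀⁻¹ _ β₀, hext, dotProduct_smul, sub_self, dotProduct_zero,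
      smul_eq_mul]
    ring
  have hquad : (subDesign w n (trueModel β₀) *ᵥ fun j => σ₀⁻¹ * β₀ j) ⬝ᵥ
      (subDesign w n (trueModel β₀) *ᵥ fun j => σ₀⁻¹ * β₀ j) ≤
        p * B * n * (β₀ ⬝ᵥ β₀) / σ₀ ^ 2 := by
    rw [subDesign_mulVec, hext]
    refine ((design_mulVec_sq_le (w := w) hn _).trans
      (sum_dotProduct_sq_le h.regressors _)).trans (le_of_eq ?_)
    rw [smul_dotProduct, dotProduct_smul, smul_eq_mul, smul_eq_mul]
    field_simp
  have hquad' : 1 / (2 * (n : ℝ)) * ((subDesign w n (trueModel β₀) *ᵥ fun j => σ₀⁻¹ * β₀ j) ⬝ᵥ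
      (subDesign w n (trueModel β₀) *ᵥ fun j => σ₀⁻¹ * β₀ j)) ≤
        p * B * (β₀ ⬝ᵥ β₀) / σ₀ ^ 2 := by
    have h3 : 1 / (2 * (n : ℝ)) * (p * B * n * (β₀ ⬝ᵥ β₀) / σ₀ ^ 2) =
        1 / 2 * (p * B * (β₀ ⬝ᵥ β₀) / σ₀ ^ 2) := by field_simp
    have h4 : 0 ≤ p * B * (β₀ ⬝ᵥ β₀) / σ₀ ^ 2 := by
      have := dotProduct_self_nonneg' β₀
      positivity
    calc _ ≤ 1 / (2 * (n : ℝ)) * (p * B * n * (β₀ ⬝ᵥ β₀) / σ₀ ^ 2) := by gcongr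
      _ ≤ _ := by rw [h3]; linarith
  have hpen : 0 ≤ 1 / (2 * (n : ℝ)) *
      ((subDesign w n (trueModel β₀) *ᵥ (q.tau • q.muBeta)) ⬝ᵥ
        (subDesign w n (trueModel β₀) *ᵥ (q.tau • q.muBeta))) := by
    have := dotProduct_self_nonneg' (p := n)
      (subDesign w n (trueModel β₀) *ᵥ (q.tau • q.muBeta))
    positivity
  unfold penLogLik at h2
  rw [hlin, Real.log_inv] at h2
  change trueLogLik w yL α₀ σ₀ β₀ e n - _ - _ ≤ _ at h2
  rw [Real.log_mul hτ.ne' hσ.ne']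
  linarith

end

lemma exists_separation (σ₀ : ℝ) (β₀ : Fin p → ℝ) (hσ : 0 < σ₀) :
    ∃ r : ℝ, 0 < r ∧ ∀ j ∈ trueModel β₀, r ≤ β₀ j ^ 2 / (σ₀ ^ 2 + β₀ j ^ 2) := by
  rcases (trueModel β₀).eq_empty_or_nonempty with h | h
  · exact ⟨1, one_pos, by simp [h]⟩
  · obtain ⟨j, hj, hmin⟩ := Finset.exists_min_image _
      (fun j => β₀ j ^ 2 / (σ₀ ^ 2 + β₀ j ^ 2)) h
    refine ⟨_, ?_, hmin⟩
    have : β₀ j ≠ 0 := by simpa [trueModel] using hj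
    positivity

/-- All claims of the theorem on a single regular sample, with constants that do not depend on
the sample. -/
lemma exists_regularSample_constants (p : ℕ) (yL α₀ σ₀ : ℝ) (β₀ : Fin p → ℝ) (c B : ℝ)
    (hσ : 0 < σ₀) :
    ∃ K r : ℝ, 0 < r ∧ ∀ (w : ℕ → Fin p → ℝ) (e : ℕ → ℝ) (n : ℕ) (D : ℝ),
      RegularSample w yL α₀ σ₀ β₀ e n c B D →
      (∀ (k : Finset (Fin p)) (q : VBState k),
        IsVB q (subDesign w n k) yL (censResp w yL α₀ σ₀ β₀ e n) n →
        (q.sigmaSqHat = q.b / (q.a - 1) ∧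
          |q.sigmaSqHat - q.b / q.a| ≤ K / n ∧
          |q.gap (subDesign w n k) yL (censResp w yL α₀ σ₀ β₀ e n)| ≤ K ∧
          |Real.log (q.pVBC (subDesign w n k) yL (censResp w yL α₀ σ₀ β₀ e n) n) -
            (Real.log (q.tobitLik (subDesign w n k) yL (censResp w yL α₀ σ₀ β₀ e n)) -
              ((k.card : ℝ) + 2) / 2 * Real.log n)| ≤ K) ∧
          ∀ i, |q.obsGap (subDesign w n k) yL (censResp w yL α₀ σ₀ β₀ e n) i| ≤
            K / n * (1 + ∑ j, w i j ^ 2)) ∧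
      (K < 1 / 4 * Real.log n → K + (p / 2 + 1) * Real.log n < c * n / 4 * r →
        ∀ q : (k : Finset (Fin p)) → VBState k,
          (∀ k, IsVB (q k) (subDesign w n k) yL (censResp w yL α₀ σ₀ β₀ e n) n) →
          argminSet (fun k =>
            (q k).VBC (subDesign w n k) yL (censResp w yL α₀ σ₀ β₀ e n) n) = {trueModel β₀}) := by
  obtain ⟨K₀, hK₀, hb⟩ := exists_posterior_bounds p yL α₀ σ₀ β₀ c B
  obtain ⟨r, hr, hsep⟩ := exists_separation σ₀ β₀ hσ
  set K₁ := 22 + 2 * p + 1 / 2 * K₀ + K₀ with hK₁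
  set K₂ := K₀ + |p * B * (β₀ ⬝ᵥ β₀) / σ₀ ^ 2| + 6 with hK₂
  set K := 4 * Real.exp K₀ + 2 * K₁ + K₂ + (14 + 8 * K₀) with hK
  have hexp := Real.exp_pos K₀
  have hK₁0 : 0 ≤ K₁ := by positivity
  have hK₂0 : 0 ≤ K₂ := by positivity
  refine ⟨K, r, hr, fun w e n D h => ?_⟩
  have hn := h.n_pos
  have hn' : (0 : ℝ) < n := by positivity
  have hn4 : (4 : ℝ) ≤ n := by exact_mod_cast h.four_le
  have hbic : ∀ (k : Finset (Fin p)) (q : VBState k),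
      IsVB q (subDesign w n k) yL (censResp w yL α₀ σ₀ β₀ e n) n →
      |Real.log (q.pVBC (subDesign w n k) yL (censResp w yL α₀ σ₀ β₀ e n) n) -
        (Real.log (q.tobitLik (subDesign w n k) yL (censResp w yL α₀ σ₀ β₀ e n)) -
          ((k.card : ℝ) + 2) / 2 * Real.log n)| ≤ K₁ := by
    intro k q hq
    obtain ⟨h1, h2, -, -⟩ := hb w e n D h k q hq
    have hcard : k.card ≤ p := by simpa using k.card_le_univ
    have h3 := hq.abs_log_pVBC_sub_le h.four_le
      (by rw [Fintype.card_coe]; exact hcard.trans h.dim_le) (sum_subDesign hn k)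
      (det_subDesign_pos h.injective k) yL_le_censResp
    rw [Fintype.card_coe] at h3
    have : (k.card : ℝ) ≤ p := by exact_mod_cast hcard
    refine h3.trans ?_
    rw [hK₁]
    linarith
  refine ⟨fun k q hq => ?_, fun hlog hlin q hq => ?_⟩
  · obtain ⟨h1, h2, h3, h4⟩ := hb w e n D h k q hq
    have ha := two_le_a hq h.four_le
    have hξ := hq.xi_pos hn
    have hτ := VBState.tau_pos hξ
    have ha0 : 0 < q.a := by linarith
    have han : (n : ℝ) ≤ 2 * q.a := by
      rw [hq.a_eq]
      have : (0 : ℝ) ≤ Fintype.card k := by positivity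
      linarith
    refine ⟨⟨hq.sigmaSqHat_eq (by linarith), ?_, ?_, ?_⟩, fun i => ?_⟩
    · rw [hq.sigmaSqHat_eq (by linarith)]
      have ha1 : 0 < q.a - 1 := by linarith
      have e1 : q.b / (q.a - 1) - q.b / q.a = q.xi / (q.a - 1) := by
        rw [VBState.xi]; field_simp; ring
      have h5 : q.xi ≤ Real.exp K₀ := by
        rw [← Real.log_le_iff_le_exp hξ]
        exact (le_abs_self _).trans h1
      rw [e1, abs_of_pos (by positivity), div_le_div_iff₀ ha1 hn']
      have h6 : (n : ℝ) ≤ 4 * (q.a - 1) := by linarith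
      calc q.xi * n ≤ Real.exp K₀ * (4 * (q.a - 1)) := by gcongr
        _ = 4 * Real.exp K₀ * (q.a - 1) := by ring
        _ ≤ K * (q.a - 1) := by
          gcongr
          rw [hK]; linarith
    · have := hq.abs_gap_le ha hn (sum_subDesign hn k)
        (isUnit_iff_ne_zero.2 (det_subDesign_pos h.injective k).ne') hn' yL_le_censResp
      refine this.trans ?_
      rw [hK]; linarith
    · refine (hbic k q hq).trans ?_
      rw [hK]; linarith
    · have hW : 0 ≤ ∑ j, w i j ^ 2 := Finset.sum_nonneg fun j _ => sq_nonneg _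
      have h5 := hq.abs_obsGap_le ha hn yL_le_censResp i
      have h6 : (if yL < censResp w yL α₀ σ₀ β₀ e n i then 0
          else q.censMoment (subDesign w n k) yL i) ≤ 2 + K₀ * (1 + ∑ j, w i j ^ 2) := by
        split_ifs
        · positivity
        · exact (one_sub_mul_mills_le _).trans (by linarith [h3 i])
      have h7 : 3 + 2 * (if yL < censResp w yL α₀ σ₀ β₀ e n i then 0
          else q.censMoment (subDesign w n k) yL i) ≤
            (7 + 4 * K₀) * (1 + ∑ j, w i j ^ 2) := by nlinarith
      have h8 : 1 / q.a ≤ 2 / n := by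
        rw [div_le_div_iff₀ ha0 hn']; linarith
      calc |q.obsGap (subDesign w n k) yL (censResp w yL α₀ σ₀ β₀ e n) i|
          ≤ 1 / q.a * ((7 + 4 * K₀) * (1 + ∑ j, w i j ^ 2)) := h5.trans (by gcongr)
        _ ≤ 2 / n * ((7 + 4 * K₀) * (1 + ∑ j, w i j ^ 2)) := by gcongr
        _ = (14 + 8 * K₀) / n * (1 + ∑ j, w i j ^ 2) := by ring
        _ ≤ K / n * (1 + ∑ j, w i j ^ 2) := by
          gcongr
          rw [hK]; linarith
  · have hln : 0 ≤ Real.log n := Real.log_nonneg (by linarith)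
    have htrue := h.le_log_tobitLik_true (hq (trueModel β₀))
    obtain ⟨-, -, -, hs⟩ := hb w e n D h _ _ (hq (trueModel β₀))
    have hbt := (abs_le.1 (hbic _ _ (hq (trueModel β₀)))).1
    have hpB := le_abs_self (p * B * (β₀ ⬝ᵥ β₀) / σ₀ ^ 2)
    -- the true model beats every other one: misspecified models lose a term of order `n` in the
    -- likelihood, larger models pay at least `log n / 2` and gain at most `log n / 4`
    have hlt : ∀ k, k ≠ trueModel β₀ →
        (q (trueModel β₀)).VBC (subDesign w n (trueModel β₀)) yL
          (censResp w yL α₀ σ₀ β₀ e n) n <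
        (q k).VBC (subDesign w n k) yL (censResp w yL α₀ σ₀ β₀ e n) n := by
      intro k hk
      have hbk := (abs_le.1 (hbic _ _ (hq k))).2
      unfold VBState.VBC
      by_cases hsub : trueModel β₀ ⊆ k
      · have hcard : (trueModel β₀).card < k.card :=
          Finset.card_lt_card (hsub.ssubset_of_ne hk.symm)
        have hcard' : ((trueModel β₀).card : ℝ) + 1 ≤ k.card := by exact_mod_cast hcard
        have hup := h.log_tobitLik_le (hq k) (r := 0)
          (fun τ d => add_nonneg (sq_nonneg _) (dotProduct_self_nonneg' _))
        have h5 : (((trueModel β₀).card : ℝ) + 2) / 2 * Real.log n + 1 / 2 * Real.log n ≤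
            ((k.card : ℝ) + 2) / 2 * Real.log n := by nlinarith
        linarith
      · obtain ⟨j, hj, hjk⟩ := Finset.not_subset.1 hsub
        have hup := h.log_tobitLik_le (hq k) (r := r)
          (fun τ d => (hsep j hj).trans (distance_of_missing hσ hjk τ d))
        have hcard : ((trueModel β₀).card : ℝ) ≤ p := by
          exact_mod_cast (by simpa using (trueModel β₀).card_le_univ)
        have h5 : (((trueModel β₀).card : ℝ) + 2) / 2 * Real.log n ≤
            ((p : ℝ) + 2) / 2 * Real.log n := by gcongr
        have h6 : Real.log n ≤ ((k.card : ℝ) + 2) / 2 * Real.log n := by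
          have : (0 : ℝ) ≤ k.card := by positivity
          nlinarith
        linarith
    ext k
    simp only [argminSet, Set.mem_ofPred_eq, Set.mem_singleton_iff]
    constructor
    · intro hmin
      by_contra hk
      exact absurd (hmin (trueModel β₀)) (not_le.2 (hlt k hk))
    · rintro rfl j
      by_cases hj : j = trueModel β₀
      · rw [hj]
      · exact (hlt j hj).le

end TobitVB

/-! ### Chebyshev's inequality and random quadratic forms -/

namespace TobitVB

section events
variable {Ω : Type*} [MeasurableSpace Ω] {P : Measure Ω}

/-- The outer probability that `E n` fails tends to zero. Unlike `WithProbTendingToOne` this needs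
no measurable witnesses, so it is convenient for events defined from merely almost everywhere
measurable errors. -/
def FailureVanishes (P : Measure Ω) (E : ℕ → Set Ω) : Prop :=
  Tendsto (fun n => P (E n)ᶜ) atTop (𝓝 0)

lemma FailureVanishes.withProb [IsProbabilityMeasure P] {E : ℕ → Set Ω}
    (h : FailureVanishes P E) : WithProbTendingToOne P E := by
  refine ⟨fun n => (toMeasurable P (E n)ᶜ)ᶜ, fun n => (measurableSet_toMeasurable _ _).compl,
    fun n => Set.compl_subset_comm.1 (subset_toMeasurable P (E n)ᶜ), ?_⟩
  have h1 : ∀ n, P (toMeasurable P (E n)ᶜ)ᶜ = 1 - P (E n)ᶜ := fun n => by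
    rw [prob_compl_eq_one_sub (measurableSet_toMeasurable _ _), measure_toMeasurable]
  simp only [h1]
  have h2 := ENNReal.Tendsto.sub (tendsto_const_nhds (x := (1 : ENNReal)) (f := atTop (α := ℕ)))
    h (Or.inl ENNReal.one_ne_top)
  simpa using h2

lemma FailureVanishes.mono {E F : ℕ → Set Ω} (h : FailureVanishes P E)
    (hEF : ∀ᶠ n in atTop, E n ⊆ F n) : FailureVanishes P F := by
  refine tendsto_of_tendsto_of_tendsto_of_le_of_le' tendsto_const_nhds h
    (Eventually.of_forall fun _ => zero_le) ?_
  filter_upwards [hEF] with n hn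
  exact measure_mono (Set.compl_subset_compl.2 hn)

lemma FailureVanishes.inter {E F : ℕ → Set Ω} (hE : FailureVanishes P E)
    (hF : FailureVanishes P F) : FailureVanishes P (fun n => E n ∩ F n) := by
  have h := hE.add hF
  rw [add_zero] at h
  refine tendsto_of_tendsto_of_tendsto_of_le_of_le tendsto_const_nhds h
    (fun _ => zero_le) fun n => ?_
  simp only [Set.compl_inter]
  exact measure_union_le _ _

lemma FailureVanishes.forall {ι : Type*} [Fintype ι] {E : ι → ℕ → Set Ω}
    (hE : ∀ i, FailureVanishes P (E i)) : FailureVanishes P (fun n => ⋂ i, E i n) := by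
  have h : Tendsto (fun n => ∑ i, P (E i n)ᶜ) atTop (𝓝 (∑ _i : ι, 0)) :=
    tendsto_finsetSum _ fun i _ => hE i
  rw [Finset.sum_const_zero] at h
  refine tendsto_of_tendsto_of_tendsto_of_le_of_le tendsto_const_nhds h
    (fun _ => zero_le) fun n => ?_
  simp only [Set.compl_iInter]
  exact measure_iUnion_fintype_le P _

end events

section chebyshev
variable {Ω : Type*} [MeasurableSpace Ω] {P : Measure Ω} [IsProbabilityMeasure P]
  {e : ℕ → Ω → ℝ}

/-- Chebyshev's inequality for a sum of functions of independent standard normal errors. -/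
lemma failureVanishes_sum_sq_le (hindep : iIndepFun e P)
    (hlaw : ∀ i, HasLaw (e i) (gaussianReal 0 1) P) {ψ : ℕ → ℝ → ℝ}
    (hmeas : ∀ i, Measurable (ψ i)) (hint : ∀ i, Integrable (fun x => ψ i x ^ 2) (gaussianReal 0 1))
    (hmean : ∀ i, ∫ x, ψ i x ∂(gaussianReal 0 1) = 0) (V : ℝ)
    (hV : ∀ n : ℕ, ∑ i : Fin n, ∫ x, ψ i x ^ 2 ∂(gaussianReal 0 1) ≤ V * n) {s : ℕ → ℝ}
    (hs : ∀ᶠ n in atTop, 0 < s n) (hlim : Tendsto (fun n : ℕ => (n : ℝ) / s n) atTop (𝓝 0)) :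
    FailureVanishes P (fun n => {ω | (∑ i : Fin n, ψ i (e i ω)) ^ 2 ≤ s n}) := by
  have hmem0 : ∀ i, MemLp (ψ i) 2 (gaussianReal 0 1) := fun i =>
    (memLp_two_iff_integrable_sq (hmeas i).aestronglyMeasurable).2 (hint i)
  have hmem : ∀ i, MemLp (ψ i ∘ e i) 2 P := fun i => by
    have h := hmem0 i
    rw [← (hlaw i).map_eq] at h
    exact h.comp_of_map (hlaw i).aemeasurable
  have hexp : ∀ i, P[ψ i ∘ e i] = 0 := fun i => by
    rw [(hlaw i).integral_comp (hmeas i).aestronglyMeasurable, hmean]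
  have hvar : ∀ i, variance (ψ i ∘ e i) P ≤ ∫ x, ψ i x ^ 2 ∂(gaussianReal 0 1) := fun i => by
    refine (variance_le_expectation_sq (hmem i).aestronglyMeasurable).trans (le_of_eq ?_)
    exact (hlaw i).integral_comp ((hmeas i).pow_const 2).aestronglyMeasurable
  have hind : iIndepFun (fun i => ψ i ∘ e i) P := hindep.comp ψ hmeas
  have hbound : ∀ᶠ n in atTop, P {ω | (∑ i : Fin n, ψ i (e i ω)) ^ 2 ≤ s n}ᶜ ≤
      ENNReal.ofReal (V * (n / s n)) := by
    filter_upwards [hs] with n hn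
    set S : Ω → ℝ := ∑ i ∈ (Finset.univ : Finset (Fin n)), ψ i ∘ e i with hS
    have hSmem : MemLp S 2 P := memLp_finsetSum' _ fun i _ => hmem i
    have hSexp : P[S] = 0 := by
      have : ∀ ω, S ω = ∑ i : Fin n, (ψ i ∘ e i) ω := fun ω => by simp [hS]
      simp only [this]
      have h := integral_finsetSum (μ := P) (Finset.univ : Finset (Fin n))
        (f := fun i : Fin n => ψ i ∘ e i) fun i _ => (hmem i).integrable (by norm_num)
      exact h.trans (Finset.sum_eq_zero fun i _ => hexp i)
    have hSvar : variance S P ≤ V * n := by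
      rw [hS, IndepFun.variance_sum (X := fun i : Fin n => ψ i ∘ e i) (fun i _ => hmem i)
        (fun i _ j _ hij => hind.indepFun (fun h : (i : ℕ) = j => hij (Fin.ext h)))]
      exact (Finset.sum_le_sum fun (i : Fin n) _ => hvar i).trans (hV n)
    have hsq : 0 < Real.sqrt (s n) := Real.sqrt_pos.2 hn
    have hch := meas_ge_le_variance_div_sq hSmem hsq
    rw [hSexp, Real.sq_sqrt hn.le] at hch
    refine (measure_mono ?_).trans (hch.trans (ENNReal.ofReal_le_ofReal ?_))
    · intro ω hω
      have h1 : s n < (S ω) ^ 2 := by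
        have : ¬ (∑ i : Fin n, ψ i (e i ω)) ^ 2 ≤ s n := hω
        have e1 : S ω = ∑ i : Fin n, ψ i (e i ω) := by simp [hS]
        rw [e1]
        exact not_le.1 this
      change Real.sqrt (s n) ≤ |S ω - 0|
      rw [sub_zero, ← Real.sqrt_sq_eq_abs]
      exact Real.sqrt_le_sqrt h1.le
    · rw [← mul_div_assoc]
      gcongr
  have hlim' : Tendsto (fun n : ℕ => ENNReal.ofReal (V * (n / s n))) atTop (𝓝 0) := by
    have := ENNReal.tendsto_ofReal (hlim.const_mul V)
    simpa using this
  exact tendsto_of_tendsto_of_tendsto_of_le_of_le' tendsto_const_nhds hlim'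
    (Eventually.of_forall fun _ => zero_le) hbound

lemma tendsto_div_const_mul_sq {η : ℝ} (hη : η ≠ 0) :
    Tendsto (fun n : ℕ => (n : ℝ) / (η * n) ^ 2) atTop (𝓝 0) := by
  have h := (tendsto_inv_atTop_nhds_zero_nat (𝕜 := ℝ)).const_mul (η ^ 2)⁻¹
  rw [mul_zero] at h
  refine h.congr fun n => ?_
  rcases Nat.eq_zero_or_pos n with rfl | hn
  · simp
  · have : (n : ℝ) ≠ 0 := by positivity
    field_simp

/-- A law of large numbers for random quadratic forms: if the expected forms grow linearly, so do
the forms themselves, uniformly in direction. -/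
lemma failureVanishes_quadratic_form (hindep : iIndepFun e P)
    (hlaw : ∀ i, HasLaw (e i) (gaussianReal 0 1) P) {ι : Type*} [Fintype ι]
    {V : ℕ → ℝ → ι → ℝ} (hmeas : ∀ i a, Measurable fun x => V i x a) {M : ℝ}
    (hM : ∀ i x a, |V i x a| ≤ M) {c : ℝ} (hc : 0 < c)
    (hE : ∀ᶠ n : ℕ in atTop, ∀ v : ι → ℝ,
      c * n * (v ⬝ᵥ v) ≤ ∑ i : Fin n, ∫ x, (V i x ⬝ᵥ v) ^ 2 ∂(gaussianReal 0 1)) :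
    FailureVanishes P (fun n => {ω | ∀ v : ι → ℝ,
      c / 2 * n * (v ⬝ᵥ v) ≤ ∑ i : Fin n, (V i (e i ω) ⬝ᵥ v) ^ 2}) := by
  set η : ℝ := c / (2 * (Fintype.card ι + 1)) with hη
  have hη0 : 0 < η := by positivity
  let m : ι → ι → ℕ → ℝ := fun a b i => ∫ x, V i x a * V i x b ∂(gaussianReal 0 1)
  have hVV : ∀ i x a b, |V i x a * V i x b| ≤ M ^ 2 := fun i x a b => by
    rw [abs_mul, sq]
    exact mul_le_mul (hM i x a) (hM i x b) (abs_nonneg _) ((abs_nonneg _).trans (hM i x a))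
  have hVVm : ∀ i a b, Measurable fun x => V i x a * V i x b := fun i a b =>
    (hmeas i a).mul (hmeas i b)
  have hVVi : ∀ i a b, Integrable (fun x => V i x a * V i x b) (gaussianReal 0 1) :=
    fun i a b => Integrable.of_bound (hVVm i a b).aestronglyMeasurable (M ^ 2)
      (ae_of_all _ fun x => hVV i x a b)
  have hm : ∀ i a b, |m a b i| ≤ M ^ 2 := fun i a b => by
    have := norm_integral_le_of_norm_le_const (μ := gaussianReal 0 1)
      (f := fun x => V i x a * V i x b) (C := M ^ 2) (ae_of_all _ fun x => hVV i x a b)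
    simpa [m] using this
  have hdev : ∀ i x a b, |V i x a * V i x b - m a b i| ≤ 2 * M ^ 2 := fun i x a b =>
    (abs_sub _ _).trans (by linarith [hVV i x a b, hm i a b])
  have hdev2 : ∀ i x a b, (V i x a * V i x b - m a b i) ^ 2 ≤ (2 * M ^ 2) ^ 2 := fun i x a b =>
    sq_le_sq' (by linarith [(abs_le.1 (hdev i x a b)).1]) (abs_le.1 (hdev i x a b)).2
  have hdevi : ∀ i a b, Integrable (fun x => (V i x a * V i x b - m a b i) ^ 2)
      (gaussianReal 0 1) := fun i a b =>
    Integrable.of_bound (((hVVm i a b).sub_const _).pow_const 2).aestronglyMeasurable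
      ((2 * M ^ 2) ^ 2) (ae_of_all _ fun x => by
        rw [Real.norm_eq_abs, abs_of_nonneg (sq_nonneg _)]; exact hdev2 i x a b)
  have hab : ∀ ab : ι × ι, FailureVanishes P (fun n => {ω |
      (∑ i : Fin n, (V i (e i ω) ab.1 * V i (e i ω) ab.2 - m ab.1 ab.2 i)) ^ 2 ≤
        (η * n) ^ 2}) := by
    rintro ⟨a, b⟩
    refine failureVanishes_sum_sq_le hindep hlaw
      (ψ := fun i x => V i x a * V i x b - m a b i) (fun i => (hVVm i a b).sub_const _)
      (fun i => hdevi i a b) (fun i => ?_) ((2 * M ^ 2) ^ 2) (fun n => ?_) ?_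
      (tendsto_div_const_mul_sq hη0.ne')
    · rw [integral_sub (hVVi i a b) (integrable_const _)]
      simp [m]
    · have h1 : ∀ i : Fin n, ∫ x, (V i x a * V i x b - m a b i) ^ 2 ∂(gaussianReal 0 1) ≤
          (2 * M ^ 2) ^ 2 := fun i => by
        have := integral_mono (hdevi i a b) (integrable_const ((2 * M ^ 2) ^ 2))
          (fun x => hdev2 i x a b)
        simpa using this
      refine (Finset.sum_le_sum fun i _ => h1 i).trans (le_of_eq ?_)
      rw [Finset.sum_const, Finset.card_univ, Fintype.card_fin, nsmul_eq_mul, mul_comm]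
    · filter_upwards [eventually_gt_atTop 0] with n hn
      have : (0 : ℝ) < n := by positivity
      positivity
  refine (FailureVanishes.forall hab).mono ?_
  filter_upwards [hE] with n hEn ω hω v
  simp only [Set.mem_iInter, Set.mem_ofPred_eq] at hω
  have hn0 : (0 : ℝ) ≤ n := by positivity
  have hdevab : ∀ a b, |∑ i : Fin n, (V i (e i ω) a * V i (e i ω) b - m a b i)| ≤ η * n :=
    fun a b => abs_le_of_sq_le_sq (hω (a, b)) (by positivity)
  have hexpand : ∀ i x, (V i x ⬝ᵥ v) ^ 2 = ∑ a, ∑ b, v a * v b * (V i x a * V i x b) := by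
    intro i x
    rw [sq, dotProduct, Finset.sum_mul_sum]
    exact Finset.sum_congr rfl fun a _ => Finset.sum_congr rfl fun b _ => by ring
  have hint : ∀ i, ∫ x, (V i x ⬝ᵥ v) ^ 2 ∂(gaussianReal 0 1) =
      ∑ a, ∑ b, v a * v b * m a b i := by
    intro i
    simp only [hexpand]
    rw [integral_finsetSum _ fun a _ => integrable_finsetSum _ fun b _ =>
      (hVVi i a b).const_mul _]
    refine Finset.sum_congr rfl fun a _ => ?_
    rw [integral_finsetSum _ fun b _ => (hVVi i a b).const_mul _]
    exact Finset.sum_congr rfl fun b _ => integral_const_mul _ _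
  have hdiff : ∑ i : Fin n, (V i (e i ω) ⬝ᵥ v) ^ 2 -
      ∑ i : Fin n, ∫ x, (V i x ⬝ᵥ v) ^ 2 ∂(gaussianReal 0 1) =
      ∑ a, ∑ b, v a * v b * ∑ i : Fin n, (V i (e i ω) a * V i (e i ω) b - m a b i) := by
    rw [Finset.sum_congr rfl fun (i : Fin n) _ => hint i]
    simp only [hexpand, ← Finset.sum_sub_distrib, ← mul_sub]
    rw [Finset.sum_comm]
    refine Finset.sum_congr rfl fun a _ => ?_
    rw [Finset.sum_comm]
    exact Finset.sum_congr rfl fun b _ => by rw [Finset.mul_sum]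
  have hle : |∑ a, ∑ b, v a * v b *
      ∑ i : Fin n, (V i (e i ω) a * V i (e i ω) b - m a b i)| ≤
      η * n * (∑ a, |v a|) ^ 2 := by
    rw [sq, Finset.sum_mul_sum, Finset.mul_sum]
    refine (Finset.abs_sum_le_sum_abs _ _).trans (Finset.sum_le_sum fun a _ => ?_)
    rw [Finset.mul_sum]
    refine (Finset.abs_sum_le_sum_abs _ _).trans (Finset.sum_le_sum fun b _ => ?_)
    rw [abs_mul, abs_mul, mul_comm (η * n)]
    gcongr
    exact hdevab a b
  have hcs : (∑ a, |v a|) ^ 2 ≤ Fintype.card ι * (v ⬝ᵥ v) := by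
    have := sq_sum_le_card_mul_sum_sq (s := Finset.univ) (f := fun a => |v a|)
    simpa [dotProduct, sq] using this
  have hvv : 0 ≤ v ⬝ᵥ v := by simpa using dotProduct_star_self_nonneg v
  have hηc : η * n * (Fintype.card ι * (v ⬝ᵥ v)) ≤ c / 2 * n * (v ⬝ᵥ v) := by
    have h1 : η * Fintype.card ι ≤ c / 2 := by
      rw [hη, div_mul_eq_mul_div, div_le_div_iff₀ (by positivity) (by norm_num)]
      nlinarith
    calc η * n * (Fintype.card ι * (v ⬝ᵥ v)) = (η * Fintype.card ι) * (n * (v ⬝ᵥ v)) := by ring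
      _ ≤ c / 2 * (n * (v ⬝ᵥ v)) := by gcongr
      _ = _ := by ring
  have h2 := mul_le_mul_of_nonneg_left hcs (by positivity : 0 ≤ η * n)
  have h3 := (abs_le.1 hle).1
  have h4 := hEn v
  linarith

end chebyshev

end TobitVB

/-! ### Curvature from the uncensored observations -/

namespace TobitVB

variable {p : ℕ}

/-- The Gaussian second-moment form of `(x, -1)` restricted to a bounded window is positive
definite. -/
lemma exists_window_curvature {K : ℝ} (hK : 0 ≤ K) : ∃ κ : ℝ, 0 < κ ∧ ∀ s t : ℝ,
    κ * (s ^ 2 + t ^ 2) ≤ ∫ x in Set.Icc K (K + 1), (s * x - t) ^ 2 ∂(gaussianReal 0 1) := by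
  set φ := gaussianPDFReal 0 1 (K + 1) with hφ
  have hφ0 : 0 < φ := gaussianPDFReal_pos _ _ _ one_ne_zero
  have hL : 0 < 14 + 24 * (K + 1 / 2) ^ 2 := by positivity
  refine ⟨φ / (14 + 24 * (K + 1 / 2) ^ 2), by positivity, fun s t => ?_⟩
  have hcont : Continuous fun x : ℝ => (s * x - t) ^ 2 := by fun_prop
  have hdens : ∀ x ∈ Set.Icc K (K + 1), φ ≤ gaussianPDFReal 0 1 x := fun x hx => by
    rw [hφ, stdPDF_eq, stdPDF_eq]
    have : x ^ 2 ≤ (K + 1) ^ 2 := pow_le_pow_left₀ (hK.trans hx.1) hx.2 2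
    gcongr
  have h1 : ∫ x in Set.Icc K (K + 1), φ * (s * x - t) ^ 2 =
      φ * ((s * (K + 1 / 2) - t) ^ 2 + s ^ 2 / 12) := by
    rw [integral_const_mul, integral_Icc_eq_integral_Ioc,
      ← intervalIntegral.integral_of_le (by linarith)]
    congr 1
    have hd : ∀ x ∈ Set.uIcc K (K + 1), HasDerivAt
        (fun x : ℝ => s ^ 2 * x ^ 3 / 3 - s * t * x ^ 2 + t ^ 2 * x) ((s * x - t) ^ 2) x := by
      intro x _
      refine (((((hasDerivAt_pow 3 x).const_mul (s ^ 2)).div_const 3).fun_sub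
        ((hasDerivAt_pow 2 x).const_mul (s * t))).fun_add
        ((hasDerivAt_id' x).const_mul (t ^ 2))).congr_deriv ?_
      push_cast
      ring
    rw [intervalIntegral.integral_eq_sub_of_hasDerivAt hd (hcont.intervalIntegrable _ _)]
    ring
  rw [setIntegral_stdGaussian measurableSet_Icc]
  have h2 : ∫ x in Set.Icc K (K + 1), φ * (s * x - t) ^ 2 ≤
      ∫ x in Set.Icc K (K + 1), (s * x - t) ^ 2 * gaussianPDFReal 0 1 x := by
    refine setIntegral_mono_on (hcont.const_mul φ |>.integrableOn_Icc)
      ((hcont.mul continuous_stdPDF).integrableOn_Icc) measurableSet_Icc fun x hx => ?_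
    rw [mul_comm]
    exact mul_le_mul_of_nonneg_left (hdens x hx) (sq_nonneg _)
  refine le_trans ?_ h2
  rw [h1, div_mul_eq_mul_div, div_le_iff₀ hL, mul_assoc]
  refine mul_le_mul_of_nonneg_left ?_ hφ0.le
  nlinarith [sq_nonneg (s * (K + 1 / 2) - t), sq_nonneg (s * (K + 1 / 2) - t - s * (K + 1 / 2)),
    sq_nonneg (2 * (s * (K + 1 / 2)) - t), sq_nonneg s, sq_nonneg (K + 1 / 2),
    mul_nonneg (sq_nonneg (K + 1 / 2)) (sq_nonneg (s * (K + 1 / 2) - t))]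

lemma sq_le_rpow_of_lt {M r x : ℝ} (hM : 0 < M) (hr : 2 < r) (hx : M < |x|) :
    x ^ 2 ≤ M ^ (2 - r) * |x| ^ r := by
  have hx0 : 0 < |x| := hM.trans hx
  have h1 : |x| ^ (2 - r) ≤ M ^ (2 - r) :=
    Real.rpow_le_rpow_of_nonpos hM hx.le (by linarith)
  calc x ^ 2 = |x| ^ (2 - r) * |x| ^ r := by
        rw [← Real.rpow_add hx0, sub_add_cancel, Real.rpow_two, sq_abs]
    _ ≤ _ := by gcongr

lemma sq_le_sq_add_rpow {M r : ℝ} (hM : 0 < M) (hr : 2 < r) (x : ℝ) :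
    x ^ 2 ≤ M ^ 2 + M ^ (2 - r) * |x| ^ r := by
  rcases le_or_gt |x| M with h | h
  · have h1 : x ^ 2 ≤ M ^ 2 := by
      rw [← sq_abs]; exact pow_le_pow_left₀ (abs_nonneg x) h 2
    have : 0 ≤ M ^ (2 - r) * |x| ^ r := by positivity
    linarith
  · have := sq_le_rpow_of_lt hM hr h
    nlinarith [sq_nonneg M]

/-- Regressor vectors with a large entry have small total weight, by the moment bound of order
`r > 2`. -/
lemma one_add_sum_sq_le_rpow {M r : ℝ} (hM : 1 ≤ M) (hr : 2 < r) {x : Fin p → ℝ}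
    (hx : ¬ ∀ j, |x j| ≤ M) :
    1 + ∑ j, x j ^ 2 ≤ (p + 2) * (M ^ (2 - r) * ∑ j, |x j| ^ r) := by
  have hM0 : 0 < M := by linarith
  push Not at hx
  obtain ⟨j₀, hj₀⟩ := hx
  have hnn : ∀ j, 0 ≤ M ^ (2 - r) * |x j| ^ r := fun j => by positivity
  have h1 : M ^ 2 ≤ M ^ (2 - r) * ∑ j, |x j| ^ r := by
    have a1 : M ^ 2 ≤ x j₀ ^ 2 := by
      rw [← sq_abs (x j₀)]; exact pow_le_pow_left₀ hM0.le hj₀.le 2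
    rw [Finset.mul_sum]
    exact (a1.trans (sq_le_rpow_of_lt hM0 hr hj₀)).trans
      (Finset.single_le_sum (f := fun j => M ^ (2 - r) * |x j| ^ r) (fun j _ => hnn j)
        (Finset.mem_univ j₀))
  have h2 : ∑ j, x j ^ 2 ≤ p * M ^ 2 + M ^ (2 - r) * ∑ j, |x j| ^ r := by
    refine (Finset.sum_le_sum fun j _ => sq_le_sq_add_rpow hM0 hr (x j)).trans (le_of_eq ?_)
    rw [Finset.sum_add_distrib, Finset.mul_sum, Finset.sum_const, Finset.card_univ,
      Fintype.card_fin, nsmul_eq_mul]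
  have h3 : 1 ≤ M ^ 2 := one_le_pow₀ hM
  have hp : (0 : ℝ) ≤ p := by positivity
  nlinarith [mul_le_mul_of_nonneg_left h1 hp]

/-- The second-moment matrix of the uncentered regressors and the intercept is positive definite
if that of the centered regressors is. -/
lemma le_sum_intercept_add_sq {w : ℕ → Fin p → ℝ} {n : ℕ} (hn : 0 < n) {c₀ B : ℝ} (hc₀ : 0 < c₀)
    (hB : 0 ≤ B) (hw : ∀ j, ∑ i : Fin n, w i j ^ 2 ≤ B * n)
    (hdesign : ∀ v : Fin p → ℝ,
      c₀ * n * (v ⬝ᵥ v) ≤ (design w n *ᵥ v) ⬝ᵥ (design w n *ᵥ v)) (a : ℝ) (b : Fin p → ℝ) :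
    (2 + (1 + 2 * (p * B)) / c₀)⁻¹ * n * (a ^ 2 + b ⬝ᵥ b) ≤
      ∑ i : Fin n, (a + w i ⬝ᵥ b) ^ 2 := by
  have hn0 : (0 : ℝ) < n := by positivity
  set m := colMean w n ⬝ᵥ b with hm
  have hmean : ∑ i : Fin n, w i ⬝ᵥ b = n * m := sum_dotProduct_eq_mul_colMean hn b
  set Q := (design w n *ᵥ b) ⬝ᵥ (design w n *ᵥ b) with hQ
  have hQ' : Q = ∑ i : Fin n, (w i ⬝ᵥ b - m) ^ 2 := by
    rw [hQ, dotProduct]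
    refine Finset.sum_congr rfl fun i _ => ?_
    rw [design_mulVec, sq]
  have hsplit : ∑ i : Fin n, (a + w i ⬝ᵥ b) ^ 2 = n * (a + m) ^ 2 + Q := by
    have e1 : ∀ i : Fin n, (a + w i ⬝ᵥ b) ^ 2 =
        (w i ⬝ᵥ b - m) ^ 2 + (2 * (a + m) * (w i ⬝ᵥ b) + ((a + m) ^ 2 - 2 * (a + m) * m)) :=
      fun i => by ring
    rw [hQ', Finset.sum_congr rfl fun i _ => e1 i, Finset.sum_add_distrib,
      Finset.sum_add_distrib, ← Finset.mul_sum, hmean, Finset.sum_const, Finset.card_univ,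
      Fintype.card_fin, nsmul_eq_mul]
    ring
  have hm2 : m ^ 2 ≤ p * B * (b ⬝ᵥ b) := by
    have h1 : (n * m) ^ 2 ≤ n * ∑ i : Fin n, (w i ⬝ᵥ b) ^ 2 := by
      rw [← hmean]
      simpa using sq_sum_le_card_mul_sum_sq (s := Finset.univ) (f := fun i : Fin n => w i ⬝ᵥ b)
    have h2 := sum_dotProduct_sq_le hw b
    have h3 : (n * n : ℝ) * m ^ 2 ≤ (n * n) * (p * B * (b ⬝ᵥ b)) := by
      have := mul_le_mul_of_nonneg_left h2 hn0.le
      nlinarith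
    exact le_of_mul_le_mul_left h3 (by positivity)
  have hbb : c₀ * n * (b ⬝ᵥ b) ≤ Q := hdesign b
  have hQ0 : 0 ≤ Q := by rw [hQ']; exact Finset.sum_nonneg fun i _ => sq_nonneg _
  have hb0 : 0 ≤ b ⬝ᵥ b := dotProduct_self_nonneg' b
  set G := 1 + 2 * (p * B) with hG
  have hG0 : 0 < G := by positivity
  have hL : 0 < 2 + G / c₀ := by positivity
  rw [hsplit, mul_assoc, inv_mul_le_iff₀ hL]
  have h1 : n * (a ^ 2 + b ⬝ᵥ b) ≤ 2 * (n * (a + m) ^ 2) + G * (n * (b ⬝ᵥ b)) := by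
    have : a ^ 2 + b ⬝ᵥ b ≤ 2 * (a + m) ^ 2 + G * (b ⬝ᵥ b) := by
      rw [hG]; nlinarith [sq_nonneg (a + 2 * m)]
    nlinarith [mul_le_mul_of_nonneg_left this hn0.le]
  have h2 : G * (n * (b ⬝ᵥ b)) ≤ G / c₀ * Q := by
    rw [div_mul_eq_mul_div, le_div_iff₀ hc₀]
    nlinarith
  have h3 : 0 ≤ G / c₀ * (n * (a + m) ^ 2) := by positivity
  nlinarith

/-- Positive definiteness persists after deleting the observations with large regressors. -/
lemma le_sum_filter_intercept_add_sq {w : ℕ → Fin p → ℝ} {n : ℕ} {M r C₀ c₁ : ℝ} (hM : 1 ≤ M)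
    (hr : 2 < r) (hmoment : ∀ j : Fin p, ∑ i : Fin n, |w i j| ^ r ≤ C₀ * n)
    (hfull : ∀ (a : ℝ) (b : Fin p → ℝ),
      c₁ * n * (a ^ 2 + b ⬝ᵥ b) ≤ ∑ i : Fin n, (a + w i ⬝ᵥ b) ^ 2) (hc₁ : c₁ ≤ 1)
    (hθ : (p + 2) * (M ^ (2 - r) * (p * C₀)) ≤ c₁ / 2) (s a : ℝ) (b : Fin p → ℝ) :
    c₁ / 2 * n * (s ^ 2 + a ^ 2 + b ⬝ᵥ b) ≤
      ∑ i : Fin n, if ∀ j, |w i j| ≤ M then s ^ 2 + (a + w i ⬝ᵥ b) ^ 2 else 0 := by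
  have hn0 : (0 : ℝ) ≤ n := by positivity
  have hM0 : 0 < M := by linarith
  have hb0 : 0 ≤ b ⬝ᵥ b := dotProduct_self_nonneg' b
  set N := s ^ 2 + a ^ 2 + b ⬝ᵥ b with hN
  have hN0 : 0 ≤ N := by positivity
  have hoff : ∀ i : Fin n, s ^ 2 + (a + w i ⬝ᵥ b) ^ 2 ≤
      (if ∀ j, |w i j| ≤ M then s ^ 2 + (a + w i ⬝ᵥ b) ^ 2 else 0) +
      (p + 2) * (M ^ (2 - r) * ∑ j, |w i j| ^ r) * N := by
    intro i
    split_ifs with h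
    · have : 0 ≤ (p + 2) * (M ^ (2 - r) * ∑ j, |w i j| ^ r) * N := by positivity
      linarith
    · have h1 := one_add_sum_sq_le_rpow hM hr h
      have h2 := dotProduct_sq_le (w i) b
      have h3 : s ^ 2 + (a + w i ⬝ᵥ b) ^ 2 ≤ (1 + ∑ j, w i j ^ 2) * N := by
        set W := ∑ j, w i j ^ 2 with hW
        set u := w i ⬝ᵥ b with hu
        have hW0 : 0 ≤ W := Finset.sum_nonneg fun j _ => sq_nonneg _
        -- Cauchy-Schwarz for `(1, w i)` and `(a, b)`
        have h4 : 2 * (a * u) ≤ W * a ^ 2 + b ⬝ᵥ b := by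
          have : (a * u) ^ 2 ≤ (W * a ^ 2) * (b ⬝ᵥ b) := by
            rw [mul_pow]; nlinarith [sq_nonneg a]
          have hp1 : 0 ≤ W * a ^ 2 := by positivity
          have := abs_le_of_sq_le_sq (a := 2 * (a * u)) (b := W * a ^ 2 + b ⬝ᵥ b)
            (by nlinarith [sq_nonneg (W * a ^ 2 - b ⬝ᵥ b)]) (by positivity)
          exact (abs_le.1 this).2
        rw [hN]
        nlinarith [mul_nonneg hW0 (sq_nonneg s)]
      rw [zero_add]
      exact h3.trans (mul_le_mul_of_nonneg_right h1 hN0)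
  have hsum := Finset.sum_le_sum fun (i : Fin n) (_ : i ∈ Finset.univ) => hoff i
  rw [Finset.sum_add_distrib, Finset.sum_add_distrib, Finset.sum_const, Finset.card_univ,
    Fintype.card_fin, nsmul_eq_mul, ← Finset.sum_mul, ← Finset.mul_sum, ← Finset.mul_sum,
    Finset.sum_comm] at hsum
  have hmom : ∑ j, ∑ i : Fin n, |w i j| ^ r ≤ p * C₀ * n := by
    refine (Finset.sum_le_sum fun j _ => hmoment j).trans (le_of_eq ?_)
    rw [Finset.sum_const, Finset.card_univ, Fintype.card_fin, nsmul_eq_mul]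
    ring
  have h5 : (p + 2) * (M ^ (2 - r) * ∑ j, ∑ i : Fin n, |w i j| ^ r) * N ≤ c₁ / 2 * n * N := by
    refine mul_le_mul_of_nonneg_right ?_ hN0
    calc (p + 2) * (M ^ (2 - r) * ∑ j, ∑ i : Fin n, |w i j| ^ r)
        ≤ (p + 2) * (M ^ (2 - r) * (p * C₀ * n)) := by gcongr
      _ = (p + 2) * (M ^ (2 - r) * (p * C₀)) * n := by ring
      _ ≤ c₁ / 2 * n := by gcongr
  have h6 := hfull a b
  have h7 : c₁ * n * s ^ 2 ≤ n * s ^ 2 := by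
    have := mul_le_mul_of_nonneg_right hc₁ (by positivity : 0 ≤ n * s ^ 2)
    linarith
  have h8 : c₁ * n * N = c₁ * n * s ^ 2 + c₁ * n * (a ^ 2 + b ⬝ᵥ b) := by rw [hN]; ring
  linarith

/-- The curvature event: the uncensored terms with bounded regressors and with standardized error
in a fixed window above their thresholds already give a positive definite quadratic form. -/
lemma failureVanishes_curvature {Ω : Type*} [MeasurableSpace Ω] {P : Measure Ω}
    [IsProbabilityMeasure P] {e : ℕ → Ω → ℝ} (hindep : iIndepFun e P)
    (hlaw : ∀ i, HasLaw (e i) (gaussianReal 0 1) P) (w : ℕ → Fin p → ℝ) (yL α₀ : ℝ) {σ₀ : ℝ}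
    (β₀ : Fin p → ℝ) (hσ₀ : 0 < σ₀) {M c₁ : ℝ} (hM : 0 ≤ M) (hc₁ : 0 < c₁)
    (hfull : ∀ᶠ n : ℕ in atTop, ∀ (s a : ℝ) (b : Fin p → ℝ), c₁ * n * (s ^ 2 + a ^ 2 + b ⬝ᵥ b) ≤
      ∑ i : Fin n, if ∀ j, |w i j| ≤ M then s ^ 2 + (a + w i ⬝ᵥ b) ^ 2 else 0) :
    ∃ c : ℝ, 0 < c ∧ FailureVanishes P (fun n => {ω | ∀ (s a : ℝ) (b : Fin p → ℝ),
      c * n * (s ^ 2 + a ^ 2 + b ⬝ᵥ b) ≤ ∑ i : Fin n,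
        if threshold w yL α₀ σ₀ β₀ i < e i ω then (s * e i ω - a - w i ⬝ᵥ b) ^ 2 else 0}) := by
  set K : ℝ := (|yL - α₀| + M * ∑ j, |β₀ j|) / σ₀ + 1 with hK
  have hK0 : 0 ≤ K := by positivity
  have hthr : ∀ i : ℕ, (∀ j, |w i j| ≤ M) → threshold w yL α₀ σ₀ β₀ i < K := by
    intro i hi
    have h1 : -(w i ⬝ᵥ β₀) ≤ M * ∑ j, |β₀ j| := by
      refine (neg_le_abs _).trans ?_
      rw [dotProduct, Finset.mul_sum]
      refine (Finset.abs_sum_le_sum_abs _ _).trans (Finset.sum_le_sum fun j _ => ?_)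
      rw [abs_mul]
      exact mul_le_mul_of_nonneg_right (hi j) (abs_nonneg _)
    have h2 : threshold w yL α₀ σ₀ β₀ i ≤ (|yL - α₀| + M * ∑ j, |β₀ j|) / σ₀ := by
      rw [threshold]
      gcongr
      linarith [le_abs_self (yL - α₀)]
    linarith
  obtain ⟨κ, hκ0, hκ⟩ := exists_window_curvature hK0
  classical
  let g : ℕ → ℝ → ℝ := fun i x =>
    if ∀ j, |w i j| ≤ M then (Set.Icc K (K + 1)).indicator (fun _ => 1) x else 0
  -- the coordinates of `(s, a, b)` are indexed by `Option (Option (Fin p))`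
  let u : ℕ → ℝ → Option (Option (Fin p)) → ℝ := fun i x o =>
    o.elim x fun o' => o'.elim (-1) fun j => -w i j
  let V : ℕ → ℝ → Option (Option (Fin p)) → ℝ := fun i x o => g i x * u i x o
  have hV : ∀ i x (v : Option (Option (Fin p)) → ℝ), (V i x ⬝ᵥ v) ^ 2 =
      if ∀ j, |w i j| ≤ M then (Set.Icc K (K + 1)).indicator
        (fun x => (v none * x - (v (some none) + w i ⬝ᵥ fun j => v (some (some j)))) ^ 2) x
        else 0 := by
    intro i x v
    have h1 : V i x ⬝ᵥ v =
        g i x * (v none * x - (v (some none) + w i ⬝ᵥ fun j => v (some (some j)))) := by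
      simp only [dotProduct, V, u, Fintype.sum_option, Option.elim, mul_assoc]
      rw [← Finset.mul_sum]
      simp only [neg_mul, Finset.sum_neg_distrib]
      ring
    rw [h1]
    by_cases hi : ∀ j, |w i j| ≤ M
    · by_cases hx : x ∈ Set.Icc K (K + 1)
      · simp [g, hi, hx]
      · simp [g, hi, hx]
    · simp [g, hi]
  have hgm : ∀ i, Measurable (g i) := fun i => by
    by_cases hi : ∀ j, |w i j| ≤ M
    · simp only [g, if_pos hi]
      exact measurable_const.indicator measurableSet_Icc
    · simp only [g, if_neg hi]
      exact measurable_const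
  have hq := failureVanishes_quadratic_form hindep hlaw (V := V) (M := K + 1 + 1 + M)
    (c := κ * c₁) (fun i o => (hgm i).mul ?_) ?_ (by positivity) ?_
  · refine ⟨κ * c₁ / 2, by positivity, hq.mono (Eventually.of_forall fun n ω hω s a b => ?_)⟩
    let v : Option (Option (Fin p)) → ℝ := fun o => o.elim s fun o' => o'.elim a b
    have h := hω v
    have hlhs : v ⬝ᵥ v = s ^ 2 + a ^ 2 + b ⬝ᵥ b := by
      simp only [v, dotProduct, Fintype.sum_option, Option.elim]
      ring
    simp only [hlhs, hV] at h
    refine h.trans (Finset.sum_le_sum fun i _ => ?_)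
    by_cases hi : ∀ j, |w i j| ≤ M
    · rw [if_pos hi]
      by_cases hx : e i ω ∈ Set.Icc K (K + 1)
      · rw [Set.indicator_of_mem hx, if_pos ((hthr i hi).trans_le hx.1)]
        exact le_of_eq (by simp only [v, Option.elim]; ring)
      · rw [Set.indicator_of_notMem hx]
        split_ifs <;> positivity
    · rw [if_neg hi]
      split_ifs <;> positivity
  · rcases o with _ | _ | j
    · exact measurable_id
    · exact measurable_const
    · exact measurable_const
  · intro i x o
    by_cases hi : ∀ j, |w i j| ≤ M
    · by_cases hx : x ∈ Set.Icc K (K + 1)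
      · have hg : g i x = 1 := by simp [g, hi, hx]
        simp only [V, hg, one_mul]
        rcases o with _ | _ | j
        · change |x| ≤ _
          rw [abs_of_nonneg (hK0.trans hx.1)]
          linarith [hx.2]
        · change |(-1 : ℝ)| ≤ _
          rw [abs_neg, abs_one]
          linarith
        · change |-w i j| ≤ _
          rw [abs_neg]
          linarith [hi j]
      · have hg : g i x = 0 := by simp [g, hx]
        simp only [V, hg, zero_mul, abs_zero]
        positivity
    · have hg : g i x = 0 := by simp [g, hi]
      simp only [V, hg, zero_mul, abs_zero]
      positivity
  · filter_upwards [hfull] with n hn v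
    have h1 := mul_le_mul_of_nonneg_left
      (hn (v none) (v (some none)) (fun j => v (some (some j)))) hκ0.le
    have hlhs : v ⬝ᵥ v = v none ^ 2 + v (some none) ^ 2 +
        (fun j => v (some (some j))) ⬝ᵥ fun j => v (some (some j)) := by
      simp only [dotProduct, Fintype.sum_option]; ring
    rw [hlhs]
    calc _ = κ * (c₁ * n * (v none ^ 2 + v (some none) ^ 2 +
        (fun j => v (some (some j))) ⬝ᵥ fun j => v (some (some j)))) := by ring
      _ ≤ _ := h1
      _ ≤ _ := by
        rw [Finset.mul_sum]
        refine Finset.sum_le_sum fun i _ => ?_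
        simp only [hV]
        by_cases hi : ∀ j, |w i j| ≤ M
        · simp only [if_pos hi]
          rw [integral_indicator measurableSet_Icc]
          exact hκ _ _
        · simp [if_neg hi]

end TobitVB

/-! ### Regularity of the sample with probability tending to one -/

namespace TobitVB

variable {p : ℕ}

lemma integral_sq_stdGaussian : ∫ x, x ^ 2 ∂(gaussianReal 0 1) = 1 := by
  have h := variance_id_gaussianReal (μ := 0) (v := 1)
  rw [variance_eq_integral measurable_id.aemeasurable] at h
  simpa using h

lemma integrable_one_sub_sq_gaussian :
    Integrable (fun x : ℝ => 1 - x ^ 2) (gaussianReal 0 1) :=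
  (integrable_const _).sub (integrable_pow_gaussian 2)

lemma integrable_one_sub_sq_sq_gaussian :
    Integrable (fun x : ℝ => (1 - x ^ 2) ^ 2) (gaussianReal 0 1) := by
  have h := ((integrable_const (1 : ℝ)).sub ((integrable_pow_gaussian 2).const_mul 2)).add
    (integrable_pow_gaussian 4)
  refine h.congr (ae_of_all _ fun x => ?_)
  simp only [Pi.add_apply, Pi.sub_apply]
  ring

lemma integral_one_sub_sq_gaussian : ∫ x, (1 - x ^ 2) ∂(gaussianReal 0 1) = 0 := by
  rw [integral_sub (integrable_const _) (integrable_pow_gaussian 2), integral_sq_stdGaussian]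
  simp

section probability
variable {Ω : Type*} [MeasurableSpace Ω] {P : Measure Ω} [IsProbabilityMeasure P]
  {e : ℕ → Ω → ℝ}

/-- The scores at the true parameters are weighted sums of independent centered terms, namely of
conditional expectations given the censored data, which have no larger variance than `h`. -/
lemma failureVanishes_score (hindep : iIndepFun e P)
    (hlaw : ∀ i, HasLaw (e i) (gaussianReal 0 1) P) (u : ℕ → ℝ) {h : ℝ → ℝ} (hh : Measurable h)
    (hi : Integrable h (gaussianReal 0 1))
    (hi2 : Integrable (fun x => h x ^ 2) (gaussianReal 0 1))
    (h0 : ∫ x, h x ∂(gaussianReal 0 1) = 0) {a : ℕ → ℝ} {B : ℝ}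
    (ha : ∀ n : ℕ, ∑ i : Fin n, a i ^ 2 ≤ B * n) {s : ℕ → ℝ}
    (hs : ∀ᶠ n in atTop, 0 < s n) (hlim : Tendsto (fun n : ℕ => (n : ℝ) / s n) atTop (𝓝 0)) :
    FailureVanishes P (fun n => {ω |
      (∑ i : Fin n, censorProj h (u i) (e i ω) * a i) ^ 2 ≤ s n}) := by
  refine failureVanishes_sum_sq_le hindep hlaw (ψ := fun i x => censorProj h (u i) x * a i)
    (fun i => (measurable_censorProj hh _).mul_const _) (fun i => ?_) (fun i => ?_)
    ((∫ x, h x ^ 2 ∂(gaussianReal 0 1)) * B) (fun n => ?_) hs hlim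
  · simp only [mul_pow]
    exact (integrable_censorProj_sq hi2 _).mul_const _
  · rw [integral_mul_const, integral_censorProj hi, h0, zero_mul]
  · have h1 : 0 ≤ ∫ x, h x ^ 2 ∂(gaussianReal 0 1) := integral_nonneg fun x => sq_nonneg _
    rw [mul_assoc]
    refine le_trans ?_ (mul_le_mul_of_nonneg_left (ha n) h1)
    rw [Finset.mul_sum]
    refine Finset.sum_le_sum fun i _ => ?_
    simp only [mul_pow]
    rw [integral_mul_const]
    exact mul_le_mul_of_nonneg_right (integral_censorProj_sq_le hi hi2 _) (sq_nonneg _)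

lemma failureVanishes_sum_sq_errors (hindep : iIndepFun e P)
    (hlaw : ∀ i, HasLaw (e i) (gaussianReal 0 1) P) :
    FailureVanishes P (fun n => {ω | ∑ i : Fin n, e i ω ^ 2 ≤ 2 * n}) := by
  have h := failureVanishes_sum_sq_le hindep hlaw (ψ := fun _ x => 1 - x ^ 2)
    (fun _ => by fun_prop) (fun _ => integrable_one_sub_sq_sq_gaussian)
    (fun _ => integral_one_sub_sq_gaussian) (∫ x, (1 - x ^ 2) ^ 2 ∂(gaussianReal 0 1))
    (fun n => by simp [mul_comm]) (s := fun n : ℕ => (1 * (n : ℝ)) ^ 2) ?_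
    (tendsto_div_const_mul_sq one_ne_zero)
  · refine h.mono (Eventually.of_forall fun n ω hω => ?_)
    have h1 : |∑ i : Fin n, (1 - e i ω ^ 2)| ≤ 1 * (n : ℝ) := abs_le_of_sq_le_sq hω (by positivity)
    rw [Finset.sum_sub_distrib] at h1
    have h2 := (abs_le.1 h1).1
    simp only [Finset.sum_const, Finset.card_univ, Fintype.card_fin, nsmul_eq_mul] at h2
    change ∑ i : Fin n, e i ω ^ 2 ≤ 2 * n
    linarith
  · filter_upwards [eventually_gt_atTop 0] with n hn
    have : (0 : ℝ) < n := by positivity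
    positivity

/-- Samples are regular with probability tending to one. -/
lemma exists_failureVanishes_regularSample (hindep : iIndepFun e P)
    (hlaw : ∀ i, HasLaw (e i) (gaussianReal 0 1) P) (w : ℕ → Fin p → ℝ) (yL α₀ : ℝ) {σ₀ : ℝ}
    (β₀ : Fin p → ℝ) (hσ₀ : 0 < σ₀) {r C₀ c₀ : ℝ} (hr : 2 < r) (hC₀ : 0 ≤ C₀)
    (hmoment : ∀ (n : ℕ) (j : Fin p), ∑ i : Fin n, |w i j| ^ r ≤ C₀ * n)
    (hc₀ : 0 < c₀)
    (hdesign : ∀ᶠ n : ℕ in atTop, ∀ v : Fin p → ℝ,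
      c₀ * n * (v ⬝ᵥ v) ≤ (design w n *ᵥ v) ⬝ᵥ (design w n *ᵥ v)) :
    ∃ (c B : ℝ) (D : ℕ → ℝ), 0 < c ∧ FailureVanishes P (fun n => {ω |
      RegularSample w yL α₀ σ₀ β₀ (fun i => e i ω) n c B (D n)}) := by
  set B : ℝ := 2 + C₀ with hB
  have hB0 : 0 ≤ B := by positivity
  have hw : ∀ (j : Fin p) (n : ℕ), ∑ i : Fin n, w i j ^ 2 ≤ B * n := by
    intro j n
    have h1 : ∀ i : Fin n, w i j ^ 2 ≤ 1 + |w i j| ^ r := fun i => by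
      simpa using sq_le_sq_add_rpow one_pos hr (w i j)
    refine (Finset.sum_le_sum fun i _ => h1 i).trans ?_
    rw [Finset.sum_add_distrib]
    simp only [Finset.sum_const, Finset.card_univ, Fintype.card_fin, nsmul_eq_mul, mul_one]
    have hn : (0 : ℝ) ≤ n := by positivity
    rw [hB]
    linarith [hmoment n j]
  set c₁ : ℝ := (2 + (1 + 2 * (p * B)) / c₀)⁻¹ with hc₁
  have hc₁0 : 0 < c₁ := by positivity
  have hc₁1 : c₁ ≤ 1 := by
    rw [hc₁]
    refine inv_le_one_of_one_le₀ ?_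
    have : 0 ≤ (1 + 2 * (p * B)) / c₀ := by positivity
    linarith
  obtain ⟨M, hM1, hMθ⟩ : ∃ M : ℝ, 1 ≤ M ∧ (p + 2) * (M ^ (2 - r) * (p * C₀)) ≤ c₁ / 2 := by
    have h1 := ((tendsto_rpow_neg_atTop (by linarith : 0 < r - 2)).mul_const
      (p * C₀)).const_mul ((p : ℝ) + 2)
    rw [zero_mul, mul_zero] at h1
    have h2 := h1.eventually (eventually_le_nhds (by positivity : 0 < c₁ / 2))
    obtain ⟨M, hM, hM1⟩ := (h2.and (eventually_ge_atTop 1)).exists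
    exact ⟨M, hM1, by simpa using hM⟩
  obtain ⟨c, hc, hcurv⟩ := failureVanishes_curvature hindep hlaw w yL α₀ β₀ hσ₀
    (by linarith : 0 ≤ M) (by positivity : 0 < c₁ / 2) (by
      filter_upwards [hdesign, eventually_gt_atTop 0] with n hn hn0 s a b
      exact le_sum_filter_intercept_add_sq hM1 hr (hmoment n)
        (le_sum_intercept_add_sq hn0 hc₀ hB0 (fun j => hw j n) hn) hc₁1 hMθ s a b)
  -- the scores have variance of order `n`, so any diverging factor is enough; this one is chosen
  -- so that the profiled score stays below the penalty `(log n) / 2` of one superfluous regressor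
  set η : ℝ := c / (4 * (p + 2)) with hη
  have hη0 : 0 < η := by positivity
  set D : ℕ → ℝ := fun n => η * n * Real.log n with hD
  have hD0 : ∀ᶠ n in atTop, 0 < D n := by
    filter_upwards [eventually_gt_atTop 1] with n hn
    have hn1 : (1 : ℝ) < n := by exact_mod_cast hn
    have := Real.log_pos hn1
    have hn0 : (0 : ℝ) < n := by linarith
    positivity
  have hlog : Tendsto (fun n : ℕ => Real.log (n : ℝ)) atTop atTop :=
    Real.tendsto_log_atTop.comp tendsto_natCast_atTop_atTop
  have hDlim : Tendsto (fun n : ℕ => (n : ℝ) / D n) atTop (𝓝 0) := by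
    have h1 := hlog.inv_tendsto_atTop.const_mul η⁻¹
    rw [mul_zero] at h1
    refine h1.congr' ?_
    filter_upwards [eventually_gt_atTop 1] with n hn
    have hn1 : (1 : ℝ) < n := by exact_mod_cast hn
    have := Real.log_pos hn1
    have hn0 : (0 : ℝ) < n := by linarith
    simp only [hD, Pi.inv_apply]
    field_simp
  have hid : Integrable (fun x : ℝ => x) (gaussianReal 0 1) := by
    simpa using integrable_pow_gaussian 1
  have hid0 : ∫ x, x ∂(gaussianReal 0 1) = 0 := integral_id_gaussianReal
  have hones : ∀ n : ℕ, ∑ _i : Fin n, (1 : ℝ) ^ 2 ≤ 1 * n := fun n => by simp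
  have hsI := failureVanishes_score hindep hlaw (threshold w yL α₀ σ₀ β₀) measurable_id hid
    (integrable_pow_gaussian 2) hid0 (a := fun _ => 1) hones hD0 hDlim
  have hsS := FailureVanishes.forall fun j : Fin p =>
    failureVanishes_score hindep hlaw (threshold w yL α₀ σ₀ β₀) measurable_id hid
      (integrable_pow_gaussian 2) hid0 (a := fun i => w i j) (hw j) hD0 hDlim
  have hsV := failureVanishes_score hindep hlaw (threshold w yL α₀ σ₀ β₀)
    (h := fun x => 1 - x ^ 2) (by fun_prop) integrable_one_sub_sq_gaussian
    integrable_one_sub_sq_sq_gaussian integral_one_sub_sq_gaussian (a := fun _ => 1) hones hD0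
    hDlim
  refine ⟨c, B, D, hc, ((((hcurv.inter hsI).inter hsS).inter hsV).inter
    (failureVanishes_sum_sq_errors hindep hlaw)).mono ?_⟩
  have hcn : ∀ᶠ n : ℕ in atTop, 2 ≤ c * n :=
    (tendsto_natCast_atTop_atTop.const_mul_atTop hc).eventually_ge_atTop 2
  filter_upwards [hdesign, hcn, eventually_ge_atTop 4, eventually_ge_atTop p] with
    n hdn hcn h4 hpn ω hω
  obtain ⟨⟨⟨⟨h1, h2⟩, h3⟩, h5⟩, h6⟩ := hω
  have hn0 : (0 : ℝ) < n := by positivity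
  exact
    { curvature := h1
      scoreIntercept := by
        have : (∑ i : Fin n, censorProj (fun x => x) (threshold w yL α₀ σ₀ β₀ i) (e i ω) * 1) ^ 2
          ≤ D n := h2
        simpa using this
      scoreSlope := fun j => Set.mem_iInter.1 h3 j
      scoreScale := by
        have : (∑ i : Fin n, censorProj (fun x => 1 - x ^ 2) (threshold w yL α₀ σ₀ β₀ i)
          (e i ω) * 1) ^ 2 ≤ D n := h5
        simpa using this
      errors := by
        have h7 : ∑ i : Fin n, e i ω ^ 2 ≤ 2 * n := h6
        have : 0 ≤ C₀ * n := by positivity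
        change ∑ i : Fin n, e i ω ^ 2 ≤ B * n
        rw [hB]
        linarith
      scale_pos := hσ₀
      c_pos := hc
      B_nonneg := hB0
      two_le := hcn
      four_le := h4
      dim_le := hpn
      score_small := by
        have h8 : (p + 2) * (D n / (c * n)) = 1 / 4 * Real.log n := by
          simp only [hD, hη]
          field_simp
        exact h8.le
      regressors := fun j => hw j n
      injective := fun v hv => by
        have h9 := hdn v
        rw [hv, dotProduct_zero] at h9
        have h10 := dotProduct_self_nonneg' v
        refine dotProduct_self_eq_zero.1 (le_antisymm ?_ h10)
        by_contra hne
        have : 0 < c₀ * n * (v ⬝ᵥ v) := by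
          have := not_le.1 hne
          positivity
        linarith }

end probability

lemma hasLaw_standardized {Ω : Type*} [MeasurableSpace Ω] {P : Measure Ω} {X : Ω → ℝ} {σ₀ : ℝ}
    (hσ₀ : 0 < σ₀) (h : HasLaw X (gaussianReal 0 (σ₀ ^ 2).toNNReal) P) :
    HasLaw (fun ω => X ω / σ₀) (gaussianReal 0 1) P := by
  have h1 := gaussianReal_div_const h σ₀
  have hne : (NNReal.mk (σ₀ ^ 2) (sq_nonneg σ₀)) ≠ 0 := fun h0 => by
    have : σ₀ ^ 2 = 0 := congrArg NNReal.toReal h0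
    exact hσ₀.ne' (by simpa using this)
  have h2 : (σ₀ ^ 2).toNNReal / NNReal.mk (σ₀ ^ 2) (sq_nonneg σ₀) = 1 := by
    rw [div_eq_one_iff_eq hne]
    exact Real.toNNReal_of_nonneg (sq_nonneg σ₀)
  rwa [zero_div, h2] at h1

lemma response_eq_censResp {Ω : Type*} (w : ℕ → Fin p → ℝ) (yL α₀ : ℝ) {σ₀ : ℝ}
    (β₀ : Fin p → ℝ) (hσ₀ : σ₀ ≠ 0) (ε : ℕ → Ω → ℝ) (n : ℕ) (ω : Ω) :
    response w yL α₀ β₀ ε n ω = censResp w yL α₀ σ₀ β₀ (fun i => ε i ω / σ₀) n := by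
  ext i
  rw [response, censResp, mul_div_cancel₀ _ hσ₀]

end TobitVB

theorem proposition8 {Ω : Type*} [MeasurableSpace Ω] (P : Measure Ω) [IsProbabilityMeasure P]
    {p : ℕ} (w : ℕ → Fin p → ℝ) (yL α₀ σ₀ : ℝ) (β₀ : Fin p → ℝ) (hσ₀ : 0 < σ₀)
    (ε : ℕ → Ω → ℝ) (hindep : iIndepFun ε P)
    (hlaw : ∀ i, HasLaw (ε i) (gaussianReal 0 (σ₀ ^ 2).toNNReal) P)
    (r C₀ c₀ : ℝ) (hr : 2 < r)
    (hmoment : ∀ (n : ℕ) (j : Fin p), ∑ i : Fin n, |w i j| ^ r ≤ C₀ * n)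
    (hc₀ : 0 < c₀)
    (hdesign : ∀ᶠ n : ℕ in atTop, ∀ v : Fin p → ℝ,
      c₀ * n * (v ⬝ᵥ v) ≤ (design w n *ᵥ v) ⬝ᵥ (design w n *ᵥ v)) :
    -- with probability tending to one, every model has a variational posterior, and the true
    -- model is the only minimizer of the VBC
    WithProbTendingToOne P (fun n => {ω |
        (∀ k : Finset (Fin p), ∃ q : VBState k,
          IsVB q (subDesign w n k) yL (response w yL α₀ β₀ ε n ω) n) ∧
        ∀ q : (k : Finset (Fin p)) → VBState k,
          (∀ k, IsVB (q k) (subDesign w n k) yL (response w yL α₀ β₀ ε n ω) n) →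
          argminSet (fun k =>
            (q k).VBC (subDesign w n k) yL (response w yL α₀ β₀ ε n ω) n) = {trueModel β₀}}) ∧
    -- the two variance plug-ins coincide asymptotically, the log discrepancy between
    -- `p(y | ẑ) p(ẑ | θ̂) / q(ẑ)` and `p(y | θ̂)` stays bounded, and the VBC has the BIC form
    (∃ C : ℝ, WithProbTendingToOne P (fun n => {ω |
        ∀ (k : Finset (Fin p)) (q : VBState k),
          IsVB q (subDesign w n k) yL (response w yL α₀ β₀ ε n ω) n →
          q.sigmaSqHat = q.b / (q.a - 1) ∧
          |q.sigmaSqHat - q.b / q.a| ≤ C / n ∧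
          |q.gap (subDesign w n k) yL (response w yL α₀ β₀ ε n ω)| ≤ C ∧
          |Real.log (q.pVBC (subDesign w n k) yL (response w yL α₀ β₀ ε n ω) n) -
            (Real.log (q.tobitLik (subDesign w n k) yL (response w yL α₀ β₀ ε n ω)) -
              ((k.card : ℝ) + 2) / 2 * Real.log n)| ≤ C})) ∧
    -- `p(y_i | ẑ_i) p(ẑ_i | θ̂) / q(ẑ_i) = p(y_i | θ̂)` holds asymptotically, uniformly in `i`
    (∀ δ : ℝ, 0 < δ → WithProbTendingToOne P (fun n => {ω |
        ∀ (k : Finset (Fin p)) (q : VBState k),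
          IsVB q (subDesign w n k) yL (response w yL α₀ β₀ ε n ω) n →
          ∀ i, |q.obsGap (subDesign w n k) yL (response w yL α₀ β₀ ε n ω) i| ≤ δ})) := by
  -- without regressors the sign of `C₀` is free
  have hmoment' : ∀ (n : ℕ) (j : Fin p), ∑ i : Fin n, |w i j| ^ r ≤ |C₀| * n := fun n j =>
    (hmoment n j).trans (mul_le_mul_of_nonneg_right (le_abs_self _) (Nat.cast_nonneg n))
  obtain ⟨c, B, D, hc, hreg⟩ := exists_failureVanishes_regularSample
    (hindep.comp (fun _ x => x / σ₀) fun _ => by fun_prop)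
    (fun i => hasLaw_standardized hσ₀ (hlaw i)) w yL α₀ β₀ hσ₀ hr (abs_nonneg C₀) hmoment' hc₀
    hdesign
  obtain ⟨K, ρ, hρ, hK⟩ := exists_regularSample_constants p yL α₀ σ₀ β₀ c B hσ₀
  simp only [response_eq_censResp w yL α₀ β₀ hσ₀.ne' ε]
  refine ⟨?_, ⟨K, ?_⟩, fun δ hδ => ?_⟩
  · refine (hreg.mono ?_).withProb
    have hlog : Tendsto (fun n : ℕ => Real.log (n : ℝ)) atTop atTop :=
      Real.tendsto_log_atTop.comp tendsto_natCast_atTop_atTop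
    have h1 : ∀ᶠ n : ℕ in atTop, K < 1 / 4 * Real.log n :=
      (hlog.const_mul_atTop (by norm_num : (0 : ℝ) < 1 / 4)).eventually_gt_atTop K
    have h2 : ∀ᶠ n : ℕ in atTop, K + ((p : ℝ) / 2 + 1) * Real.log n < c * n / 4 * ρ := by
      have hs : 0 < c / 4 * ρ := by positivity
      have ho := (Real.isLittleO_log_id_atTop.comp_tendsto
        tendsto_natCast_atTop_atTop (k := fun n : ℕ => (n : ℝ))).def
        (by positivity : 0 < c / 4 * ρ / 2 / ((p : ℝ) / 2 + 1))
      have hl := (tendsto_natCast_atTop_atTop.const_mul_atTop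
        (by positivity : 0 < c / 4 * ρ / 2)).eventually_gt_atTop K
      filter_upwards [ho, hl] with n hn hl
      have hn' : Real.log n ≤ c / 4 * ρ / 2 / ((p : ℝ) / 2 + 1) * n := by
        refine (le_abs_self _).trans ?_
        simpa using hn
      rw [div_mul_eq_mul_div, le_div_iff₀ (by positivity)] at hn'
      linarith
    filter_upwards [h1, h2] with n hn1 hn2 ω hω
    exact ⟨fun k => RegularSample.exists_isVB hω k, (hK w _ n _ hω).2 hn1 hn2⟩
  · exact (hreg.mono (Eventually.of_forall fun n ω hω k q hq =>
      ((hK w _ n _ hω).1 k q hq).1)).withProb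
  · refine (hreg.mono ?_).withProb
    obtain ⟨M, hM1, hMδ⟩ : ∃ M : ℝ, 1 ≤ M ∧ M ^ (2 - r) * (|K| * (p * |C₀|)) ≤ δ / 2 := by
      have h1 := (tendsto_rpow_neg_atTop (by linarith : 0 < r - 2)).mul_const
        (|K| * (p * |C₀|))
      rw [zero_mul] at h1
      have h2 := h1.eventually (eventually_le_nhds (by positivity : 0 < δ / 2))
      obtain ⟨M, hM, hM1⟩ := (h2.and (eventually_ge_atTop 1)).exists
      exact ⟨M, hM1, by simpa using hM⟩
    have h3 : ∀ᶠ n : ℕ in atTop, |K| * (1 + p * M ^ 2) / n ≤ δ / 2 :=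
      (tendsto_const_div_atTop_nhds_zero_nat (𝕜 := ℝ) (|K| * (1 + p * M ^ 2))).eventually
        (eventually_le_nhds (by positivity : 0 < δ / 2))
    filter_upwards [h3, eventually_gt_atTop 0] with n hn hn0 ω hω k q hq i
    refine (((hK w _ n _ hω).1 k q hq).2 i).trans ?_
    have hn0' : (0 : ℝ) < n := by positivity
    have hM0 : 0 < M := by linarith
    have hterm : ∀ j, w i j ^ 2 ≤ M ^ 2 + M ^ (2 - r) * (|C₀| * n) := fun j => by
      refine (sq_le_sq_add_rpow hM0 hr (w i j)).trans ?_
      have h4 : |w i j| ^ r ≤ |C₀| * n :=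
        (Finset.single_le_sum (f := fun i : Fin n => |w i j| ^ r) (fun _ _ => by positivity)
          (Finset.mem_univ i)).trans (hmoment' n j)
      gcongr
    have hsum : ∑ j, w i j ^ 2 ≤ p * (M ^ 2 + M ^ (2 - r) * (|C₀| * n)) := by
      refine (Finset.sum_le_sum fun j _ => hterm j).trans (le_of_eq ?_)
      rw [Finset.sum_const, Finset.card_univ, Fintype.card_fin, nsmul_eq_mul]
    calc K / n * (1 + ∑ j, w i j ^ 2)
        ≤ |K| / n * (1 + p * (M ^ 2 + M ^ (2 - r) * (|C₀| * n))) := by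
          have : 0 ≤ 1 + ∑ j, w i j ^ 2 := by positivity
          gcongr
          exact le_abs_self K
      _ = |K| * (1 + p * M ^ 2) / n + M ^ (2 - r) * (|K| * (p * |C₀|)) := by
          field_simp
          ring
      _ ≤ δ := by linarith
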